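/- Let $\rho\in(-1,1)$. For $n\ge 3$ let $(X_1,Y_1),\dots,(X_n,Y_n)$ be a random independent sample from a bivariate normal distribution with arbitrary means, arbitrary positive variances and correlation $\rho$. Let $$r=\frac{\overline{XY}-\overline X\,\overline Y}{\sqrt{\bigl(\overline{X^2}-\overline X^2\bigr)\bigl(\overline{Y^2}-\overline Y^2\bigr)}}$$ be Pearson's empirical correlation coefficient (bars denote sample means), and put $$m=\operatorname{arctanh}\rho+\frac{\rho}{2n},\qquad V=\frac1n+\frac{6-\rho^2}{2n^2},\qquad f_Z(z)=\frac{e^{-z^2/2}}{\sqrt{2\pi}}\Bigl(1+\frac{\Gamma_4\,(z^4-6z^2+3)}{24}\Bigr),\quad \Gamma_4=\frac2n .$$ ($f_Z$ is the Edgeworth density with skewness $\Gamma_3=0$ and excess kurtosis $\Gamma_4$.) Then, as $n\to\infty$, with constants in the $O$-terms that depend only on $\rho$: 1. $\operatorname{arctanh} r$ has, for all sufficiently large $n$, finite moments up to order four, and $$\mathbb E[\operatorname{arctanh} r]=m+O(n^{-2}),\qquad \operatorname{Var}(\operatorname{arctanh} r)=V+O(n^{-3}),$$ the skewness of $\operatorname{arctanh}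 r$ is $O(n^{-3/2})$, and its excess kurtosis is $\dfrac2n+O(n^{-2})$. 2. For all sufficiently large $n$, the standardized variable $(\operatorname{arctanh} r-m)/\sqrt V$ has a continuous density $g_n$ on $\mathbb R$, and $$\sup_{z\in\mathbb R}|g_n(z)-f_Z(z)|=O(n^{-3/2}).$$ 3. For all sufficiently large $n$, $r$ has a density $f$ that is concentrated and continuous on $(-1,1)$, and, uniformly in $x\in(-1,1)$, $$f(x)=\frac{f_Z\!\left(\dfrac{\operatorname{arctanh}(x)-m}{\sqrt V}\right)+O(n^{-3/2})}{(1-x^2)\sqrt V}.$$ -/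

import Mathlib

open MeasureTheory ProbabilityTheory

/-- `(X i, Y i)`, `i < n`, is a random independent sample of size `n` from the bivariate normal
distribution with means `μ₁`, `μ₂`, standard deviations `σ₁`, `σ₂` and correlation `ρ`. -/
structure IsBivariateNormalSample {Ω : Type*} [MeasurableSpace Ω] (P : Measure Ω) {n : ℕ}
    (X Y : Fin n → Ω → ℝ) (μ₁ μ₂ σ₁ σ₂ ρ : ℝ) : Prop where
  indep : iIndepFun (fun i ω => (X i ω, Y i ω)) P
  gaussian : ∀ i, HasGaussianLaw (fun ω => (X i ω, Y i ω)) P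
  mean_fst : ∀ i, ∫ ω, X i ω ∂P = μ₁
  mean_snd : ∀ i, ∫ ω, Y i ω ∂P = μ₂
  variance_fst : ∀ i, variance (X i) P = σ₁ ^ 2
  variance_snd : ∀ i, variance (Y i) P = σ₂ ^ 2
  covariance_eq : ∀ i, covariance (X i) (Y i) P = ρ * σ₁ * σ₂

/-- The sample mean. -/
noncomputable def sampleMean {n : ℕ} (x : Fin n → ℝ) : ℝ := (∑ i, x i) / n

/-- Pearson's empirical correlation coefficient of the points `(x i, y i)`, `i < n`. -/
noncomputable def sampleCorr {n : ℕ} (x y : Fin n → ℝ) : ℝ :=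
  (sampleMean (fun i => x i * y i) - sampleMean x * sampleMean y) /
    √((sampleMean (fun i => x i ^ 2) - sampleMean x ^ 2) *
      (sampleMean (fun i => y i ^ 2) - sampleMean y ^ 2))

/-- The skewness of a random variable. -/
noncomputable def skewness {Ω : Type*} [MeasurableSpace Ω] (Z : Ω → ℝ) (P : Measure Ω) : ℝ :=
  centralMoment Z 3 P / √(variance Z P) ^ 3

/-- The excess kurtosis of a random variable. -/
noncomputable def excessKurtosis {Ω : Type*} [MeasurableSpace Ω] (Z : Ω → ℝ) (P : Measure Ω) : ℝ :=
  centralMoment Z 4 P / variance Z P ^ 2 - 3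

/-- The Edgeworth density with skewness `Γ₃` and excess kurtosis `Γ₄`. -/
noncomputable def edgeworthDensity (Γ₃ Γ₄ z : ℝ) : ℝ :=
  Real.exp (-(z ^ 2 / 2)) / √(2 * Real.pi) *
    (1 + Γ₃ * (z ^ 3 - 3 * z) / 6 + Γ₄ * (z ^ 4 - 6 * z ^ 2 + 3) / 24 +
      Γ₃ ^ 2 * (z ^ 6 - 15 * z ^ 4 + 45 * z ^ 2 - 15) / 72)

/-- The corrected centre `artanh ρ + ρ / (2 n)` of the Fisher transformation. -/
noncomputable def fisherMean (ρ : ℝ) (n : ℕ) : ℝ := Real.artanh ρ + ρ / (2 * n)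

/-- The corrected variance `1 / n + (6 - ρ ^ 2) / (2 n ^ 2)` of the Fisher transformation. -/
noncomputable def fisherVar (ρ : ℝ) (n : ℕ) : ℝ := 1 / n + (6 - ρ ^ 2) / (2 * n ^ 2)

/-- The Fisher transformation `artanh r` of the empirical correlation coefficient of a sample. -/
noncomputable def fisherZ {Ω : Type*} {n : ℕ} (X Y : Fin n → Ω → ℝ) (ω : Ω) : ℝ :=
  Real.artanh (sampleCorr (fun i => X i ω) (fun i => Y i ω))

/-! Write κ = √(1 - ρ²) and M = n - 2. Sample correlation is invariant under increasing affine maps,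
so the sample may be taken as (uᵢ, ρ uᵢ + κ wᵢ) with u, w independent standard Gaussian vectors. In
an orthonormal basis that starts with the constant direction and the direction of the centred u, r
depends only on three independent quantities: the norm a of the centred u (chi, n - 1 degrees of
freedom), the component p of w along it (standard normal), and the norm b of the rest of w (chi, n -
2 degrees of freedom). Substituting p = b sinh z - (ρ/κ) a makes r = tanh z. Integrating out a and b
exactly and putting x = z - artanh ρ, the density of x is proportional to sech^M x · √(1 + ρ tanh x)
· J((1 - ρ²) / (2 (1 + ρ tanh x))), where J(q) is the integral of sech^(2M+1) t / √(1 + q sinh² t).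
This is `IsBivariateNormalSample.lintegral_sampleCorr_eq`; everything else is analysis of this
explicit weight, so all constants depend on ρ alone.

Up to a constant factor, J(q) = 1 - q/(4M) + O(M⁻²), which reduces the weight to sech^M x (√g - (1 -
ρ²)/(8M√g)) with g = 1 + ρ tanh x and relative error O(M⁻²) (`abs_fisherWeight_div_sub_le`).

Moments: x^k √g and x^k / √g are expanded in powers of tanh x. Under the probability density
proportional to sech^M the moments of tanh satisfy an exact recurrence, and an error O(|sinh
x|^(2k)) of exponential growth has mean O(M⁻ᵏ) (`SinhBound.isBigO_sechMean`). Arithmetic with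
truncated series in 1/M then gives mean, variance, skewness and kurtosis.

Density: in the standardized variable z, sech^M x = e^(-z²/2) e^D with D of order M^(-1/2). The
exponential is expanded to second order, the prefactor to order 1/M, and the normalising constant by
a Wallis product combined with log-convexity. The M^(-1/2) terms cancel, and the 1/M term is (z⁴ -
6z² + 3)/12 (`polyO_edgeworth_sub`). Remainders grow polynomially in z, but are multiplied by
e^(-z²/2) or sech^M x, which makes them uniformly O(M^(-3/2)). The density of r follows by the
change of variables r = tanh. -/

/-! ### Gaussian integrals: polar coordinates and rotation invariance. -/

theorem piFinSuccAbove_zero_symm_apply {k : ℕ} (z : ℝ × (Fin k → ℝ)) :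
    (MeasurableEquiv.piFinSuccAbove (fun _ : Fin (k + 1) => ℝ) 0).symm z = Fin.cons z.1 z.2 := by
  simp [MeasurableEquiv.piFinSuccAbove, Fin.insertNthEquiv]

theorem measurable_fin_cons {k : ℕ} :
    Measurable fun z : ℝ × (Fin k → ℝ) => (Fin.cons z.1 z.2 : Fin (k + 1) → ℝ) := by
  simp_rw [← piFinSuccAbove_zero_symm_apply]
  exact MeasurableEquiv.measurable _

theorem lintegral_pi_fin_succ {k : ℕ} (μ : Measure ℝ) [SigmaFinite μ]
    {F : (Fin (k + 1) → ℝ) → ENNReal} (hF : Measurable F) :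
    ∫⁻ x, F x ∂(Measure.pi fun _ => μ) =
      ∫⁻ p, ∫⁻ v : Fin k → ℝ, F (Fin.cons p v) ∂(Measure.pi fun _ => μ) ∂μ := by
  have h := (measurePreserving_piFinSuccAbove (n := k) (fun _ => μ) 0).symm
  rw [← h.lintegral_comp hF, lintegral_prod]
  · simp only [piFinSuccAbove_zero_symm_apply]
  · exact (hF.comp (MeasurableEquiv.measurable _)).aemeasurable

theorem lintegral_gaussianReal_zero_one {F : ℝ → ENNReal} (hF : Measurable F) :
    ∫⁻ x, F x ∂(gaussianReal 0 1) =
      ENNReal.ofReal (√(2 * Real.pi))⁻¹ * ∫⁻ x, F x * ENNReal.ofReal (Real.exp (-x ^ 2 / 2)) := by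
  rw [gaussianReal_of_var_ne_zero _ one_ne_zero,
    lintegral_withDensity_eq_lintegral_mul _ (measurable_gaussianPDF 0 1) hF,
    ← lintegral_const_mul' _ _ ENNReal.ofReal_ne_top]
  refine lintegral_congr fun x => ?_
  simp only [Pi.mul_apply, gaussianPDF, gaussianPDFReal, NNReal.coe_one, mul_one, sub_zero]
  rw [ENNReal.ofReal_mul (by positivity)]
  ring

/-- Normalising constants stay anonymous here and in the integral formulas that follow; total mass
one determines the final constant in
`IsBivariateNormalSample.lintegral_sampleCorr_eq_fisherDensity`. -/
theorem lintegral_pi_gaussianReal (k : ℕ) : ∃ c : ENNReal, ∀ F : (Fin k → ℝ) → ENNReal,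
    Measurable F → ∫⁻ x, F x ∂(Measure.pi fun _ => gaussianReal 0 1) =
      c * ∫⁻ x, F x * ENNReal.ofReal (Real.exp (-(∑ i, x i ^ 2) / 2)) := by
  induction k with
  | zero =>
    refine ⟨1, fun F hF => ?_⟩
    have : (volume : Measure (Fin 0 → ℝ)) = Measure.pi fun _ => gaussianReal 0 1 := by
      rw [volume_pi, Measure.pi_of_empty, Measure.pi_of_empty]
    rw [← this]
    simp
  | succ k ih =>
    obtain ⟨c, hc⟩ := ih
    refine ⟨ENNReal.ofReal (√(2 * Real.pi))⁻¹ * c, fun F hF => ?_⟩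
    have hcons : Measurable fun z : ℝ × (Fin k → ℝ) => (Fin.cons z.1 z.2 : Fin (k + 1) → ℝ) :=
      measurable_fin_cons
    have hcons' : ∀ p : ℝ, Measurable fun v : Fin k → ℝ => (Fin.cons p v : Fin (k + 1) → ℝ) :=
      fun p => hcons.comp (measurable_const.prodMk measurable_id)
    have hG : Measurable fun x : Fin (k + 1) → ℝ =>
      F x * ENNReal.ofReal (Real.exp (-(∑ i, x i ^ 2) / 2)) := by fun_prop
    have hin : Measurable fun p : ℝ => ∫⁻ v : Fin k → ℝ, F (Fin.cons p v) *
        ENNReal.ofReal (Real.exp (-(∑ i, v i ^ 2) / 2)) := by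
      refine Measurable.lintegral_prod_right (f := fun p v => F (Fin.cons p v) *
        ENNReal.ofReal (Real.exp (-(∑ i, v i ^ 2) / 2))) ?_
      have h1 := hF.comp hcons
      simp only [Function.uncurry_def, Function.comp_def] at h1 ⊢
      fun_prop
    rw [lintegral_pi_fin_succ _ hF, volume_pi, lintegral_pi_fin_succ _ hG, ← volume_pi]
    simp_rw [fun p : ℝ => hc (fun v => F (Fin.cons p v)) (hF.comp (hcons' p))]
    rw [lintegral_gaussianReal_zero_one (hin.const_mul _)]
    simp_rw [mul_assoc]
    rw [lintegral_const_mul]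
    swap
    · fun_prop
    congr 2
    refine lintegral_congr fun p => ?_
    rw [← lintegral_mul_const' _ _ ENNReal.ofReal_ne_top]
    refine lintegral_congr fun v => ?_
    rw [mul_assoc, ← ENNReal.ofReal_mul (by positivity), ← Real.exp_add]
    simp only [Fin.sum_univ_succ, Fin.cons_zero, Fin.cons_succ]
    congr 3
    ring

/-- Polar coordinates for nonnegative functions, without integrability: the punctured space is the
product of the unit sphere and a half-line carrying the measure y^(d-1) dy. -/
theorem lintegral_fun_norm_addHaar {E : Type*} [NormedAddCommGroup E] [NormedSpace ℝ E]
    [MeasurableSpace E] [Nontrivial E] (μ : Measure E) [FiniteDimensional ℝ E] [BorelSpace E]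
    [μ.IsAddHaarMeasure] {f : ℝ → ENNReal} (hf : Measurable f) :
    ∫⁻ x, f ‖x‖ ∂μ = μ.toSphere Set.univ *
      ∫⁻ y in Set.Ioi (0 : ℝ), ENNReal.ofReal (y ^ (Module.finrank ℝ E - 1)) * f y :=
  calc
    ∫⁻ x, f ‖x‖ ∂μ = ∫⁻ x : ({(0)}ᶜ : Set E), f (‖x.1‖) ∂(μ.comap (↑)) := by
      rw [lintegral_subtype_comap (measurableSet_singleton _).compl fun x ↦ f (‖x‖),
        restrict_compl_singleton]
    _ = ∫⁻ x, f x.2 ∂μ.toSphere.prod (.volumeIoiPow (Module.finrank ℝ E - 1)) := by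
      simpa using μ.measurePreserving_homeomorphUnitSphereProd.lintegral_comp_emb
        (Homeomorph.measurableEmbedding _) (f ∘ Subtype.val ∘ Prod.snd)
    _ = μ.toSphere Set.univ *
        ∫⁻ x : Set.Ioi (0 : ℝ), f x ∂.volumeIoiPow (Module.finrank ℝ E - 1) := by
      rw [lintegral_prod _ (by fun_prop)]
      simp [mul_comm]
    _ = _ := by
      simp only [Measure.volumeIoiPow]
      rw [lintegral_withDensity_eq_lintegral_mul _ (by fun_prop) (by fun_prop),
        ← lintegral_subtype_comap measurableSet_Ioi]
      rfl

/-- The chi law with k + 1 degrees of freedom: the Gaussian density is radial, so polar coordinates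
apply. -/
theorem lintegral_pi_gaussianReal_sum_sq (k : ℕ) : ∃ c : ENNReal, ∀ f : ℝ → ENNReal,
    Measurable f → ∫⁻ x, f (√(∑ i, x i ^ 2)) ∂(Measure.pi fun _ : Fin (k + 1) => gaussianReal 0 1) =
      c * ∫⁻ r in Set.Ioi (0 : ℝ), f r * ENNReal.ofReal (r ^ k * Real.exp (-r ^ 2 / 2)) := by
  obtain ⟨c, hc⟩ := lintegral_pi_gaussianReal (k + 1)
  refine ⟨c * (volume : Measure (EuclideanSpace ℝ (Fin (k + 1)))).toSphere Set.univ,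
    fun f hf => ?_⟩
  rw [hc _ (by fun_prop)]
  have h1 := (PiLp.volume_preserving_ofLp (Fin (k + 1))).lintegral_comp
    (f := fun x : Fin (k + 1) → ℝ =>
      f (√(∑ i, x i ^ 2)) * ENNReal.ofReal (Real.exp (-(∑ i, x i ^ 2) / 2))) (by fun_prop)
  have h2 := lintegral_fun_norm_addHaar (volume : Measure (EuclideanSpace ℝ (Fin (k + 1))))
    (f := fun r => f r * ENNReal.ofReal (Real.exp (-r ^ 2 / 2))) (by fun_prop)
  rw [← h1, mul_assoc]
  congr 1
  simp only [finrank_euclideanSpace, Fintype.card_fin, Nat.add_sub_cancel] at h2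
  have h3 : ∀ x : EuclideanSpace ℝ (Fin (k + 1)), √(∑ i, x i ^ 2) = ‖x‖ := fun x => by
    simp [EuclideanSpace.norm_eq]
  have h4 : ∀ x : EuclideanSpace ℝ (Fin (k + 1)), (∑ i, x i ^ 2) = ‖x‖ ^ 2 := fun x => by
    rw [← h3, Real.sq_sqrt (Finset.sum_nonneg fun i _ => sq_nonneg _)]
  refine (lintegral_congr fun x : EuclideanSpace ℝ (Fin (k + 1)) => by
    rw [h3 x, h4 x]).trans (h2.trans ?_)
  congr 1
  refine setLIntegral_congr_fun measurableSet_Ioi fun r hr => ?_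
  have : (0 : ℝ) < r := hr
  rw [ENNReal.ofReal_mul (by positivity)]
  ring

/-- The standard Gaussian measure is invariant under linear isometries, in particular under passing
to the coordinates of any orthonormal basis. -/
theorem measurePreserving_pi_gaussianReal_inner {n : ℕ}
    (b : OrthonormalBasis (Fin n) ℝ (EuclideanSpace ℝ (Fin n))) :
    MeasurePreserving (fun (w : Fin n → ℝ) i => inner ℝ (b i) (WithLp.toLp 2 w))
      (Measure.pi fun _ => gaussianReal 0 1) (Measure.pi fun _ => gaussianReal 0 1) := by
  have h1 : MeasurePreserving (WithLp.toLp 2 : (Fin n → ℝ) → EuclideanSpace ℝ (Fin n))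
      (Measure.pi fun _ => gaussianReal 0 1) (stdGaussian _) :=
    ⟨by fun_prop, map_pi_eq_stdGaussian⟩
  have h2 : MeasurePreserving b.repr (stdGaussian _) (stdGaussian _) :=
    ⟨by fun_prop, stdGaussian_map b.repr⟩
  have h3 : MeasurePreserving (WithLp.ofLp : EuclideanSpace ℝ (Fin n) → (Fin n → ℝ))
      (stdGaussian _) (Measure.pi fun _ => gaussianReal 0 1) := by
    refine ⟨by fun_prop, ?_⟩
    rw [← map_pi_eq_stdGaussian, Measure.map_map (by fun_prop) (by fun_prop)]
    exact Measure.map_id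
  have h := h3.comp (h2.comp h1)
  convert! h using 1
  ext w i
  simp [OrthonormalBasis.repr_apply_apply]

theorem sum_sq_eq_sum_inner_sq {n : ℕ}
    (b : OrthonormalBasis (Fin n) ℝ (EuclideanSpace ℝ (Fin n))) (w : Fin n → ℝ) :
    ∑ i, w i ^ 2 = ∑ i, inner ℝ (b i) (WithLp.toLp 2 w) ^ 2 := by
  have := b.sum_sq_norm_inner_right (WithLp.toLp 2 w)
  simp only [Real.norm_eq_abs, sq_abs, EuclideanSpace.norm_sq_eq] at this
  exact this.symm

/-! ### The correlation coefficient of Gaussian vectors in an adapted basis. -/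

/-- The correlation coefficient as a function of the norm `a` of the centred first sample and of
the components `p`, `q` of the centred noise parallel and orthogonal to it. -/
noncomputable def corrOfComponents (ρ a p q : ℝ) : ℝ :=
  (ρ * a + √(1 - ρ ^ 2) * p) / √((ρ * a + √(1 - ρ ^ 2) * p) ^ 2 + (1 - ρ ^ 2) * q ^ 2)

theorem measurable_corrOfComponents (ρ : ℝ) :
    Measurable fun z : ℝ × ℝ × ℝ => corrOfComponents ρ z.1 z.2.1 z.2.2 := by
  unfold corrOfComponents
  fun_prop

/-- Centring removes the sums of u and w, and the remaining second moments are polynomials in a, p,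
q. A factor a/n comes out of both the numerator and the root. -/
theorem sampleCorr_add_eq {n : ℕ} (hn : 0 < n) {ρ : ℝ} (hρ : ρ ^ 2 ≤ 1) (u w : Fin n → ℝ)
    {a p q : ℝ} (ha : 0 < a) (hau : a ^ 2 = ∑ i, u i ^ 2 - (∑ i, u i) ^ 2 / n)
    (hp : a * p = ∑ i, u i * w i - (∑ i, u i) * (∑ i, w i) / n)
    (hq : q ^ 2 = ∑ i, w i ^ 2 - (∑ i, w i) ^ 2 / n - p ^ 2) :
    sampleCorr u (fun i => ρ * u i + √(1 - ρ ^ 2) * w i) = corrOfComponents ρ a p q := by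
  have hn' : (0 : ℝ) < n := by exact_mod_cast hn
  set κ := √(1 - ρ ^ 2) with hκ
  have hκ2 : κ ^ 2 = 1 - ρ ^ 2 := Real.sq_sqrt (by linarith)
  have e1 : ∑ i, u i * (ρ * u i + κ * w i) = ρ * ∑ i, u i ^ 2 + κ * ∑ i, u i * w i := by
    rw [Finset.mul_sum, Finset.mul_sum, ← Finset.sum_add_distrib]
    exact Finset.sum_congr rfl fun i _ => by ring
  have e2 : ∑ i, (ρ * u i + κ * w i) = ρ * ∑ i, u i + κ * ∑ i, w i := by
    rw [Finset.mul_sum, Finset.mul_sum, ← Finset.sum_add_distrib]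
  have e3 : ∑ i, (ρ * u i + κ * w i) ^ 2 =
      ρ ^ 2 * ∑ i, u i ^ 2 + 2 * ρ * κ * ∑ i, u i * w i + κ ^ 2 * ∑ i, w i ^ 2 := by
    rw [Finset.mul_sum, Finset.mul_sum, Finset.mul_sum, ← Finset.sum_add_distrib,
      ← Finset.sum_add_distrib]
    exact Finset.sum_congr rfl fun i _ => by ring
  unfold sampleCorr sampleMean corrOfComponents
  rw [← hκ, ← hκ2, e1, e2, e3]
  set U := ∑ i, u i
  set W := ∑ i, w i
  have f1 : ∑ i, u i ^ 2 = a ^ 2 + U ^ 2 / n := by linarith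
  have f2 : ∑ i, u i * w i = a * p + U * W / n := by linarith
  have f3 : ∑ i, w i ^ 2 = q ^ 2 + p ^ 2 + W ^ 2 / n := by linarith
  rw [f1, f2, f3]
  have g1 : (ρ * (a ^ 2 + U ^ 2 / n) + κ * (a * p + U * W / n)) / n - U / n * ((ρ * U + κ * W) / n)
      = a / n * (ρ * a + κ * p) := by
    field_simp
    ring
  have g2 : ((a ^ 2 + U ^ 2 / n) / n - (U / n) ^ 2) *
      ((ρ ^ 2 * (a ^ 2 + U ^ 2 / n) + 2 * ρ * κ * (a * p + U * W / n) +
        κ ^ 2 * (q ^ 2 + p ^ 2 + W ^ 2 / n)) / n - ((ρ * U + κ * W) / n) ^ 2) =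
      (a / n) ^ 2 * ((ρ * a + κ * p) ^ 2 + κ ^ 2 * q ^ 2) := by
    field_simp
    ring
  rw [g1, g2, Real.sqrt_mul (by positivity), Real.sqrt_sq (by positivity)]
  rw [mul_div_mul_left _ _ (by positivity)]

theorem exists_orthonormalBasis_zero {n : ℕ} {f : EuclideanSpace ℝ (Fin (n + 1))}
    (hf : ‖f‖ = 1) :
    ∃ b : OrthonormalBasis (Fin (n + 1)) ℝ (EuclideanSpace ℝ (Fin (n + 1))), b 0 = f := by
  obtain ⟨b, hb⟩ := Orthonormal.exists_orthonormalBasis_extension_of_card_eq (𝕜 := ℝ)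
    (E := EuclideanSpace ℝ (Fin (n + 1))) (ι := Fin (n + 1)) (by simp) (v := fun _ => f)
    (s := {0}) ⟨fun _ => hf, fun i j hij => absurd (Subsingleton.elim i j) hij⟩
  exact ⟨b, hb 0 rfl⟩

theorem exists_orthonormalBasis_zero_one {n : ℕ} {f e : EuclideanSpace ℝ (Fin (n + 2))}
    (hf : ‖f‖ = 1) (he : ‖e‖ = 1) (hfe : inner ℝ f e = 0) :
    ∃ b : OrthonormalBasis (Fin (n + 2)) ℝ (EuclideanSpace ℝ (Fin (n + 2))),
      b 0 = f ∧ b 1 = e := by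
  obtain ⟨b, hb⟩ := Orthonormal.exists_orthonormalBasis_extension_of_card_eq (𝕜 := ℝ)
    (E := EuclideanSpace ℝ (Fin (n + 2))) (ι := Fin (n + 2)) (by simp)
    (v := fun i => if i = 0 then f else e) (s := {0, 1}) <| by
      constructor
      · rintro ⟨i, hi⟩
        simp only [Set.domRestrict_apply]
        split_ifs <;> assumption
      · rintro ⟨i, hi⟩ ⟨k, hk⟩ hik
        have hik' : i ≠ k := fun h => hik (Subtype.ext h)
        simp only [Set.mem_insert_iff, Set.mem_singleton_iff] at hi hk
        simp only [Set.domRestrict_apply]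
        rcases hi with rfl | rfl <;> rcases hk with rfl | rfl
        · exact absurd rfl hik'
        · simpa using hfe
        · simpa [real_inner_comm] using hfe
        · exact absurd rfl hik'
  refine ⟨b, ?_, ?_⟩
  · simpa using hb 0 (by simp)
  · simpa using hb 1 (by simp)

/-- When basis vector 0 is the normalised constant vector, dropping coordinate 0 is centring; it
costs one degree of freedom. -/
theorem lintegral_pi_gaussianReal_tail (k : ℕ) : ∃ c : ENNReal, ∀ F : ℝ → ENNReal,
    Measurable F →
      ∫⁻ x : Fin (k + 2) → ℝ, F (√(∑ i : Fin (k + 1), x i.succ ^ 2))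
        ∂(Measure.pi fun _ => gaussianReal 0 1) =
      c * ∫⁻ r in Set.Ioi (0 : ℝ), F r * ENNReal.ofReal (r ^ k * Real.exp (-r ^ 2 / 2)) := by
  obtain ⟨c, hc⟩ := lintegral_pi_gaussianReal_sum_sq k
  refine ⟨c, fun F hF => ?_⟩
  rw [lintegral_pi_fin_succ _ (by fun_prop)]
  simp only [Fin.cons_succ]
  rw [hc F hF]
  simp

/-- With coordinate 0 removed by centring, coordinate 1 becomes the component along the centred
first sample and the others enter only through their norm, which has two degrees of freedom fewer
than the full vector. -/
theorem lintegral_pi_gaussianReal_one_tail (k : ℕ) : ∃ c : ENNReal, ∀ G : ℝ → ℝ → ENNReal,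
    Measurable (Function.uncurry G) →
      ∫⁻ x : Fin (k + 3) → ℝ, G (x 1) (√(∑ i : Fin (k + 1), x i.succ.succ ^ 2))
        ∂(Measure.pi fun _ => gaussianReal 0 1) =
      c * ∫⁻ p, (∫⁻ r in Set.Ioi (0 : ℝ), G p r *
        ENNReal.ofReal (r ^ k * Real.exp (-r ^ 2 / 2))) * ENNReal.ofReal (Real.exp (-p ^ 2 / 2)) := by
  obtain ⟨c, hc⟩ := lintegral_pi_gaussianReal_sum_sq k
  refine ⟨ENNReal.ofReal (√(2 * Real.pi))⁻¹ * c, fun G hG => ?_⟩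
  have hG' : ∀ {α : Type} [MeasurableSpace α] {f g : α → ℝ}, Measurable f → Measurable g →
      Measurable fun x => G (f x) (g x) := fun hf hg => hG.comp (hf.prodMk hg)
  rw [lintegral_pi_fin_succ _ (hG' (by fun_prop) (by fun_prop))]
  have : ∀ p : ℝ, ∫⁻ v : Fin (k + 2) → ℝ, G ((Fin.cons p v : Fin (k + 3) → ℝ) 1)
      (√(∑ i : Fin (k + 1), (Fin.cons p v : Fin (k + 3) → ℝ) i.succ.succ ^ 2))
        ∂(Measure.pi fun _ => gaussianReal 0 1) =
      ∫⁻ v : Fin (k + 2) → ℝ, G (v 0) (√(∑ i : Fin (k + 1), v i.succ ^ 2))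
        ∂(Measure.pi fun _ => gaussianReal 0 1) := fun p => rfl
  simp only [this, lintegral_const, measure_univ, mul_one]
  rw [lintegral_pi_fin_succ _ (hG' (by fun_prop) (by fun_prop))]
  simp only [Fin.cons_zero, Fin.cons_succ]
  have h2 : ∀ p, ∫⁻ v : Fin (k + 1) → ℝ, G p (√(∑ i, v i ^ 2))
      ∂(Measure.pi fun _ => gaussianReal 0 1) = c * ∫⁻ r in Set.Ioi (0 : ℝ), G p r *
        ENNReal.ofReal (r ^ k * Real.exp (-r ^ 2 / 2)) := fun p =>
    hc (G p) (hG' measurable_const measurable_id)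
  simp only [h2]
  have hm : Measurable fun p => ∫⁻ r in Set.Ioi (0 : ℝ), G p r *
        ENNReal.ofReal (r ^ k * Real.exp (-r ^ 2 / 2)) := by
    refine Measurable.lintegral_prod_right (f := fun p r => G p r *
        ENNReal.ofReal (r ^ k * Real.exp (-r ^ 2 / 2))) ?_
    simp only [Function.uncurry_def] at hG ⊢
    fun_prop
  rw [lintegral_gaussianReal_zero_one (hm.const_mul c), mul_assoc]
  congr 1
  rw [← lintegral_const_mul _ (by fun_prop)]
  simp only [mul_assoc]

/-- Law of the correlation coefficient of `u` and `ρ u + √(1 - ρ²) w` for independent standard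
Gaussian vectors `u`, `w`. -/
theorem lintegral_sampleCorr_gaussian {ρ : ℝ} (hρ : ρ ^ 2 ≤ 1) (j : ℕ) :
    ∃ c : ENNReal, ∀ F : ℝ → ENNReal, Measurable F →
      ∫⁻ u : Fin (j + 3) → ℝ, ∫⁻ w : Fin (j + 3) → ℝ,
        F (sampleCorr u (fun i => ρ * u i + √(1 - ρ ^ 2) * w i))
          ∂(Measure.pi fun _ => gaussianReal 0 1) ∂(Measure.pi fun _ => gaussianReal 0 1) =
      c * ∫⁻ a in Set.Ioi (0 : ℝ), (∫⁻ p, (∫⁻ q in Set.Ioi (0 : ℝ),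
          F (corrOfComponents ρ a p q) * ENNReal.ofReal (q ^ j * Real.exp (-q ^ 2 / 2))) *
            ENNReal.ofReal (Real.exp (-p ^ 2 / 2))) *
        ENNReal.ofReal (a ^ (j + 1) * Real.exp (-a ^ 2 / 2)) := by
  obtain ⟨c₁, hc₁⟩ := lintegral_pi_gaussianReal_tail (j + 1)
  obtain ⟨c₂, hc₂⟩ := lintegral_pi_gaussianReal_one_tail j
  refine ⟨c₁ * c₂, fun F hF => ?_⟩
  have hFm : Measurable fun z : ℝ × ℝ × ℝ => F (corrOfComponents ρ z.1 z.2.1 z.2.2) :=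
    hF.comp (measurable_corrOfComponents ρ)
  set Ψ : ℝ → ENNReal := fun a => ∫⁻ p, (∫⁻ q in Set.Ioi (0 : ℝ),
          F (corrOfComponents ρ a p q) * ENNReal.ofReal (q ^ j * Real.exp (-q ^ 2 / 2))) *
            ENNReal.ofReal (Real.exp (-p ^ 2 / 2)) with hΨ
  have hΨm : Measurable Ψ := by
    have h1 : Measurable fun z : ℝ × ℝ => ∫⁻ q in Set.Ioi (0 : ℝ),
        F (corrOfComponents ρ z.1 z.2 q) * ENNReal.ofReal (q ^ j * Real.exp (-q ^ 2 / 2)) := by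
      refine Measurable.lintegral_prod_right (f := fun (z : ℝ × ℝ) q =>
        F (corrOfComponents ρ z.1 z.2 q) * ENNReal.ofReal (q ^ j * Real.exp (-q ^ 2 / 2))) ?_
      refine Measurable.mul ?_ (by fun_prop)
      exact hFm.comp (by fun_prop : Measurable fun z : (ℝ × ℝ) × ℝ => (z.1.1, z.1.2, z.2))
    refine Measurable.lintegral_prod_right (f := fun a p => (∫⁻ q in Set.Ioi (0 : ℝ),
          F (corrOfComponents ρ a p q) * ENNReal.ofReal (q ^ j * Real.exp (-q ^ 2 / 2))) *
            ENNReal.ofReal (Real.exp (-p ^ 2 / 2))) ?_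
    exact h1.mul (by fun_prop)
  set n : ℝ := ((j + 3 : ℕ) : ℝ) with hn
  have hn0 : 0 < n := by positivity
  -- The unit constant vector; projecting orthogonally to it centres a sample.
  set f : EuclideanSpace ℝ (Fin (j + 3)) := WithLp.toLp 2 fun _ => 1 / √n with hf
  have hfn : ‖f‖ = 1 := by
    rw [EuclideanSpace.norm_eq, Real.sqrt_eq_one]
    simp only [hf, Real.norm_eq_abs, sq_abs, div_pow, one_pow, Real.sq_sqrt hn0.le,
      Finset.sum_const, Finset.card_univ, Fintype.card_fin, nsmul_eq_mul]
    rw [← hn]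
    field_simp
  have hfi : ∀ w : Fin (j + 3) → ℝ, inner ℝ f (WithLp.toLp 2 w) ^ 2 = (∑ i, w i) ^ 2 / n := by
    intro w
    have : inner ℝ f (WithLp.toLp 2 w) = (∑ i, w i) / √n := by
      simp [hf, PiLp.inner_apply, Finset.sum_mul, div_eq_mul_inv]
    rw [this, div_pow, Real.sq_sqrt hn0.le]
  set A : (Fin (j + 3) → ℝ) → ℝ := fun u => √(∑ i, u i ^ 2 - (∑ i, u i) ^ 2 / n) with hA
  obtain ⟨b, hb⟩ := exists_orthonormalBasis_zero hfn
  have houter : ∀ G : ℝ → ENNReal, Measurable G →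
      ∫⁻ u, G (A u) ∂(Measure.pi fun _ => gaussianReal 0 1) =
        c₁ * ∫⁻ r in Set.Ioi (0 : ℝ), G r * ENNReal.ofReal (r ^ (j + 1) * Real.exp (-r ^ 2 / 2)) := by
    intro G hG
    rw [← hc₁ G hG]
    refine Eq.trans ?_ ((measurePreserving_pi_gaussianReal_inner b).lintegral_comp
      (f := fun x => G (√(∑ i : Fin (j + 2), x i.succ ^ 2))) (by fun_prop))
    refine lintegral_congr fun u => ?_
    rw [hA]
    simp only
    rw [sum_sq_eq_sum_inner_sq b u, Fin.sum_univ_succ, hb, hfi]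
    congr 2
    ring
  have hAn : ∀ u : Fin (j + 3) → ℝ, 0 ≤ ∑ i, u i ^ 2 - (∑ i, u i) ^ 2 / n := by
    intro u
    rw [sum_sq_eq_sum_inner_sq b u, Fin.sum_univ_succ, hb, hfi, add_sub_cancel_left]
    positivity
  -- Testing the chi law on the indicator of {0}: almost surely `u` is not constant, so its centred
  -- direction exists.
  have hA0 : ∀ᵐ u ∂(Measure.pi fun _ : Fin (j + 3) => gaussianReal 0 1), 0 < A u := by
    have h0 := houter (Set.indicator {0} 1) (measurable_one.indicator (measurableSet_singleton 0))
    rw [setLIntegral_congr_fun (g := fun _ => 0) measurableSet_Ioi, lintegral_zero, mul_zero,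
      lintegral_eq_zero_iff] at h0
    · filter_upwards [h0] with u hu
      refine lt_of_le_of_ne (Real.sqrt_nonneg _) fun h => ?_
      simp [← h] at hu
    · refine (measurable_one.indicator (measurableSet_singleton 0)).comp ?_
      fun_prop
    · intro r hr
      have : (0 : ℝ) < r := hr
      simp [this.ne']
  have hinner : ∀ u : Fin (j + 3) → ℝ, 0 < A u → ∫⁻ w : Fin (j + 3) → ℝ,
      F (sampleCorr u (fun i => ρ * u i + √(1 - ρ ^ 2) * w i))
          ∂(Measure.pi fun _ => gaussianReal 0 1) = c₂ * Ψ (A u) := by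
    intro u hu
    have hA2 : A u ^ 2 = ∑ i, u i ^ 2 - (∑ i, u i) ^ 2 / n := Real.sq_sqrt (hAn u)
    -- The direction of the centred first sample. A basis extending `f`, `e` varies with `u`, but by
    -- rotation invariance the integral over `w` sees `u` only through `A u`.
    set e : EuclideanSpace ℝ (Fin (j + 3)) :=
      WithLp.toLp 2 fun i => (u i - (∑ k, u k) / n) / A u with he
    have hen : ‖e‖ = 1 := by
      rw [EuclideanSpace.norm_eq, Real.sqrt_eq_one]
      simp only [he, Real.norm_eq_abs, sq_abs, div_pow]
      rw [← Finset.sum_div, hA2]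
      have : ∑ i, (u i - (∑ k, u k) / n) ^ 2 = ∑ i, u i ^ 2 - (∑ i, u i) ^ 2 / n := by
        simp only [sub_sq, Finset.sum_sub_distrib, Finset.sum_add_distrib, ← Finset.mul_sum,
          ← Finset.sum_mul, Finset.sum_const, Finset.card_univ, Fintype.card_fin, nsmul_eq_mul]
        rw [← hn]
        field_simp
        ring
      rw [this]
      exact div_self (by rw [← hA2]; positivity)
    have hfe : inner ℝ f e = 0 := by
      simp only [hf, he, PiLp.inner_apply, RCLike.inner_apply, conj_trivial]
      rw [← Finset.sum_mul, ← Finset.sum_div, Finset.sum_sub_distrib]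
      simp only [Finset.sum_const, Finset.card_univ, Fintype.card_fin, nsmul_eq_mul]
      rw [← hn, mul_div_cancel₀ _ hn0.ne']
      simp
    have hei : ∀ w : Fin (j + 3) → ℝ, A u * inner ℝ e (WithLp.toLp 2 w) =
        ∑ i, u i * w i - (∑ i, u i) * (∑ i, w i) / n := by
      intro w
      simp only [he, PiLp.inner_apply, RCLike.inner_apply, conj_trivial]
      rw [Finset.mul_sum, Finset.mul_sum, Finset.sum_div (f := fun i => (∑ k, u k) * w i),
        ← Finset.sum_sub_distrib]
      refine Finset.sum_congr rfl fun i _ => ?_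
      field_simp
    obtain ⟨b', hb0, hb1⟩ := exists_orthonormalBasis_zero_one hfn hen hfe
    have h1 := hc₂ (fun p q => F (corrOfComponents ρ (A u) p q))
      (hFm.comp (by fun_prop : Measurable fun z : ℝ × ℝ => (A u, z.1, z.2)))
    rw [hΨ]
    simp only
    rw [← h1]
    refine Eq.trans ?_ ((measurePreserving_pi_gaussianReal_inner b').lintegral_comp
      (f := fun x => F (corrOfComponents ρ (A u) (x 1) (√(∑ i : Fin (j + 1), x i.succ.succ ^ 2)))) ?_)
    · refine lintegral_congr fun w => ?_
      rw [sampleCorr_add_eq (by omega) hρ u w hu hA2 (hei w), hb1]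
      have hs : ∑ i, w i ^ 2 = inner ℝ f (WithLp.toLp 2 w) ^ 2 + (inner ℝ e (WithLp.toLp 2 w) ^ 2 +
          ∑ i : Fin (j + 1), inner ℝ (b' i.succ.succ) (WithLp.toLp 2 w) ^ 2) := by
        rw [sum_sq_eq_sum_inner_sq b' w, Fin.sum_univ_succ, Fin.sum_univ_succ, hb0,
          Fin.succ_zero_eq_one, hb1]
      rw [Real.sq_sqrt (by positivity), hs, hfi]
      ring
    · exact hFm.comp (by fun_prop : Measurable fun x : Fin (j + 3) → ℝ =>
        (A u, x 1, √(∑ i : Fin (j + 1), x i.succ.succ ^ 2)))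
  have : ∫⁻ u : Fin (j + 3) → ℝ, ∫⁻ w : Fin (j + 3) → ℝ,
        F (sampleCorr u (fun i => ρ * u i + √(1 - ρ ^ 2) * w i))
          ∂(Measure.pi fun _ => gaussianReal 0 1) ∂(Measure.pi fun _ => gaussianReal 0 1) =
      ∫⁻ u : Fin (j + 3) → ℝ, c₂ * Ψ (A u) ∂(Measure.pi fun _ => gaussianReal 0 1) := by
    refine lintegral_congr_ae ?_
    filter_upwards [hA0] with u hu using hinner u hu
  rw [this, houter (fun a => c₂ * Ψ a) (hΨm.const_mul _), mul_assoc]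
  congr 1
  simp only [mul_assoc]
  exact lintegral_const_mul _ (by fun_prop)

/-! ### Affine invariance and reduction to independent standard normals. -/

theorem sampleMean_affine {n : ℕ} (hn : 0 < n) (a b : ℝ) (x : Fin n → ℝ) :
    sampleMean (fun i => a + b * x i) = a + b * sampleMean x := by
  have hn' : (n : ℝ) ≠ 0 := by positivity
  unfold sampleMean
  rw [Finset.sum_add_distrib, ← Finset.mul_sum]
  simp only [Finset.sum_const, Finset.card_univ, Fintype.card_fin, nsmul_eq_mul]
  field_simp

theorem sampleMean_affine_mul_affine {n : ℕ} (hn : 0 < n) (a b c d : ℝ) (x y : Fin n → ℝ) :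
    sampleMean (fun i => (a + b * x i) * (c + d * y i)) -
        sampleMean (fun i => a + b * x i) * sampleMean (fun i => c + d * y i) =
      b * d * (sampleMean (fun i => x i * y i) - sampleMean x * sampleMean y) := by
  have hn' : (n : ℝ) ≠ 0 := by positivity
  have h : ∑ i, (a + b * x i) * (c + d * y i) =
      n * (a * c) + a * d * ∑ i, y i + b * c * ∑ i, x i + b * d * ∑ i, x i * y i := by
    rw [Finset.mul_sum, Finset.mul_sum, Finset.mul_sum]
    have : (n : ℝ) * (a * c) = ∑ _i : Fin n, a * c := by simp
    rw [this, ← Finset.sum_add_distrib, ← Finset.sum_add_distrib, ← Finset.sum_add_distrib]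
    exact Finset.sum_congr rfl fun i _ => by ring
  rw [sampleMean_affine hn, sampleMean_affine hn]
  unfold sampleMean
  rw [h]
  field_simp
  ring

theorem sampleCorr_affine {n : ℕ} (hn : 0 < n) (a c : ℝ) {b d : ℝ} (hb : 0 < b) (hd : 0 < d)
    (x y : Fin n → ℝ) :
    sampleCorr (fun i => a + b * x i) (fun i => c + d * y i) = sampleCorr x y := by
  unfold sampleCorr
  have h1 := sampleMean_affine_mul_affine hn a b a b x x
  have h2 := sampleMean_affine_mul_affine hn c d c d y y
  simp only [← sq] at h1 h2
  rw [sampleMean_affine_mul_affine hn, h1, h2, show b ^ 2 * (sampleMean (fun i => x i ^ 2) -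
      sampleMean x ^ 2) * (d ^ 2 * (sampleMean (fun i => y i ^ 2) - sampleMean y ^ 2)) =
      (b * d) ^ 2 * ((sampleMean (fun i => x i ^ 2) - sampleMean x ^ 2) *
        (sampleMean (fun i => y i ^ 2) - sampleMean y ^ 2)) by ring,
    Real.sqrt_mul (by positivity), Real.sqrt_sq (by positivity),
    mul_div_mul_left _ _ (by positivity)]

/-- The second component is the normalised residual of the regression of Y on X. It is uncorrelated
with X, hence independent of it because the pair is jointly Gaussian. -/
theorem map_standardize_eq {Ω : Type*} [MeasurableSpace Ω] {P : Measure Ω}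
    [IsProbabilityMeasure P] {X Y : Ω → ℝ} {μ₁ μ₂ σ₁ σ₂ ρ κ : ℝ} (hσ₁ : 0 < σ₁) (hσ₂ : 0 < σ₂)
    (hκ : 0 < κ) (hκρ : κ ^ 2 = 1 - ρ ^ 2)
    (hG : HasGaussianLaw (fun ω => (X ω, Y ω)) P) (hX : ∫ ω, X ω ∂P = μ₁) (hY : ∫ ω, Y ω ∂P = μ₂)
    (hvX : variance X P = σ₁ ^ 2) (hvY : variance Y P = σ₂ ^ 2)
    (hcov : covariance X Y P = ρ * σ₁ * σ₂) :
    P.map (fun ω => ((X ω - μ₁) / σ₁, ((Y ω - μ₂) / σ₂ - ρ * ((X ω - μ₁) / σ₁)) / κ)) =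
      (gaussianReal 0 1).prod (gaussianReal 0 1) := by
  set a := 1 / (σ₂ * κ) with ha
  set b := -ρ / (σ₁ * κ) with hb
  set c := 1 / σ₁ with hc
  have hXm : MemLp X 2 P := hG.fst.memLp_two
  have hYm : MemLp Y 2 P := hG.snd.memLp_two
  have hL := hG.map_fun ((c • ContinuousLinearMap.fst ℝ ℝ ℝ).prod
    (a • ContinuousLinearMap.snd ℝ ℝ ℝ + b • ContinuousLinearMap.fst ℝ ℝ ℝ))
  have hL' : HasGaussianLaw (fun ω => (c * X ω, a * Y ω + b * X ω)) P := hL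
  have hcX : covariance X X P = σ₁ ^ 2 := by
    rw [covariance_self hXm.aestronglyMeasurable.aemeasurable, hvX]
  have hcov0 : covariance (fun ω => c * X ω) (fun ω => a * Y ω + b * X ω) P = 0 := by
    have := covariance_add_right (X := fun ω => c * X ω) (hXm.const_mul c) (hYm.const_mul a)
      (hXm.const_mul b)
    refine this.trans ?_
    simp only [covariance_const_mul_left, covariance_const_mul_right]
    rw [hcX, hcov, ha, hb]
    field_simp
    ring
  have hind := hL'.indepFun_of_covariance_eq_zero hcov0
  have hvU : variance (fun ω => c * X ω) P = 1 := by
    rw [variance_const_mul, hvX, hc]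
    field_simp
  have hvW : variance (fun ω => a * Y ω + b * X ω) P = 1 := by
    have := variance_fun_add (hYm.const_mul a) (hXm.const_mul b)
    rw [this, variance_const_mul, variance_const_mul, hvX, hvY, covariance_const_mul_left,
      covariance_const_mul_right, covariance_comm, hcov, ha, hb]
    field_simp
    rw [hκρ]
    ring
  have hmU : ∫ ω, c * X ω ∂P = c * μ₁ := by rw [integral_const_mul, hX]
  have hmW : ∫ ω, a * Y ω + b * X ω ∂P = a * μ₂ + b * μ₁ := by
    rw [integral_add (hYm.const_mul a |>.integrable (by norm_num))
      (hXm.const_mul b |>.integrable (by norm_num)), integral_const_mul, integral_const_mul, hX, hY]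
  have hlU := hL'.fst.map_eq_gaussianReal
  have hlW := hL'.snd.map_eq_gaussianReal
  rw [hvU, hmU, Real.toNNReal_one] at hlU
  rw [hvW, hmW, Real.toNNReal_one] at hlW
  have hUm := hL'.fst.aemeasurable
  have hWm := hL'.snd.aemeasurable
  have hsU : P.map (fun ω => c * X ω - c * μ₁) = gaussianReal 0 1 := by
    have := gaussianReal_map_sub_const (μ := c * μ₁) (v := 1) (c * μ₁)
    rw [← hlU, AEMeasurable.map_map_of_aemeasurable (by fun_prop) hUm, sub_self] at this
    exact this
  have hsW : P.map (fun ω => a * Y ω + b * X ω - (a * μ₂ + b * μ₁)) = gaussianReal 0 1 := by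
    have := gaussianReal_map_sub_const (μ := a * μ₂ + b * μ₁) (v := 1) (a * μ₂ + b * μ₁)
    rw [← hlW, AEMeasurable.map_map_of_aemeasurable (by fun_prop) hWm, sub_self] at this
    exact this
  have hind' : IndepFun (fun ω => c * X ω - c * μ₁)
      (fun ω => a * Y ω + b * X ω - (a * μ₂ + b * μ₁)) P :=
    hind.comp (φ := fun t => t - c * μ₁) (ψ := fun t => t - (a * μ₂ + b * μ₁))
      (by fun_prop) (by fun_prop)
  rw [indepFun_iff_map_prod_eq_prod_map_map (by fun_prop) (by fun_prop), hsU, hsW] at hind'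
  rw [← hind']
  congr 1
  funext ω
  rw [ha, hb, hc]
  ext <;> field_simp
  ring

/-- The law of the correlation coefficient of a bivariate normal sample does not depend on the
means and the variances. -/
theorem IsBivariateNormalSample.lintegral_sampleCorr {Ω : Type*} [MeasurableSpace Ω]
    {P : Measure Ω} [IsProbabilityMeasure P] {n : ℕ} (hn : 0 < n) {X Y : Fin n → Ω → ℝ}
    {μ₁ μ₂ σ₁ σ₂ ρ : ℝ} (hσ₁ : 0 < σ₁) (hσ₂ : 0 < σ₂) (hρ : ρ ^ 2 < 1)
    (h : IsBivariateNormalSample P X Y μ₁ μ₂ σ₁ σ₂ ρ) {F : ℝ → ENNReal} (hF : Measurable F) :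
    ∫⁻ ω, F (sampleCorr (fun i => X i ω) (fun i => Y i ω)) ∂P =
      ∫⁻ u : Fin n → ℝ, ∫⁻ w : Fin n → ℝ,
        F (sampleCorr u (fun i => ρ * u i + √(1 - ρ ^ 2) * w i))
          ∂(Measure.pi fun _ => gaussianReal 0 1) ∂(Measure.pi fun _ => gaussianReal 0 1) := by
  set κ := √(1 - ρ ^ 2) with hκ
  have hκ0 : 0 < κ := Real.sqrt_pos.2 (by linarith)
  have hκ2 : κ ^ 2 = 1 - ρ ^ 2 := Real.sq_sqrt (by linarith)
  set T : Fin n → Ω → ℝ × ℝ := fun i ω =>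
    ((X i ω - μ₁) / σ₁, ((Y i ω - μ₂) / σ₂ - ρ * ((X i ω - μ₁) / σ₁)) / κ) with hT
  have hTlaw : ∀ i, P.map (T i) = (gaussianReal 0 1).prod (gaussianReal 0 1) := fun i =>
    map_standardize_eq hσ₁ hσ₂ hκ0 hκ2 (h.gaussian i) (h.mean_fst i) (h.mean_snd i)
      (h.variance_fst i) (h.variance_snd i) (h.covariance_eq i)
  have hXY : ∀ i, AEMeasurable (fun ω => (X i ω, Y i ω)) P := fun i => (h.gaussian i).aemeasurable
  have hg : Measurable fun z : ℝ × ℝ =>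
      ((z.1 - μ₁) / σ₁, ((z.2 - μ₂) / σ₂ - ρ * ((z.1 - μ₁) / σ₁)) / κ) := by fun_prop
  have hTm : ∀ i, AEMeasurable (T i) P := fun i => hg.comp_aemeasurable (hXY i)
  have hTi : iIndepFun T P := h.indep.comp (fun _ z =>
    ((z.1 - μ₁) / σ₁, ((z.2 - μ₂) / σ₂ - ρ * ((z.1 - μ₁) / σ₁)) / κ)) fun _ => hg
  have hlaw := (iIndepFun_iff_map_fun_eq_pi_map hTm).1 hTi
  simp only [hTlaw] at hlaw
  have hFm : Measurable fun z : (Fin n → ℝ) × (Fin n → ℝ) =>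
      F (sampleCorr z.1 (fun i => ρ * z.1 i + κ * z.2 i)) := by
    refine hF.comp ?_
    unfold sampleCorr sampleMean
    fun_prop
  rw [← lintegral_prod (fun z : (Fin n → ℝ) × (Fin n → ℝ) =>
    F (sampleCorr z.1 (fun i => ρ * z.1 i + κ * z.2 i))) hFm.aemeasurable]
  have hmp := measurePreserving_arrowProdEquivProdArrow ℝ ℝ (Fin n)
    (fun _ => gaussianReal 0 1) (fun _ => gaussianReal 0 1)
  rw [← hmp.lintegral_comp hFm, ← hlaw]
  refine Eq.trans ?_ (lintegral_map' (hFm.comp (MeasurableEquiv.measurable _)).aemeasurable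
    (by fun_prop)).symm
  refine lintegral_congr fun ω => ?_
  congr 1
  have e1 : ∀ i, X i ω = μ₁ + σ₁ * (T i ω).1 := fun i => by
    simp only [hT]
    field_simp
    ring
  have e2 : ∀ i, Y i ω = μ₂ + σ₂ * (ρ * (T i ω).1 + κ * (T i ω).2) := fun i => by
    simp only [hT]
    field_simp
    ring
  simp only [e1, e2]
  rw [sampleCorr_affine hn _ _ hσ₁ hσ₂]
  rfl

/-! ### Changes of variables. -/

theorem lintegral_Ioi_comp_mul {c : ℝ} (hc : 0 < c) (f : ℝ → ENNReal) :
    ∫⁻ x in Set.Ioi (0 : ℝ), f x = ENNReal.ofReal c * ∫⁻ x in Set.Ioi (0 : ℝ), f (c * x) := by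
  have h := lintegral_image_eq_lintegral_abs_deriv_mul (s := Set.Ioi (0 : ℝ)) (f := fun x => c * x)
    (f' := fun _ => c) measurableSet_Ioi
    (fun x _ => by simpa using ((hasDerivAt_id x).const_mul c).hasDerivWithinAt)
    (fun x _ y _ hxy => mul_left_cancel₀ hc.ne' hxy) f
  have himg : (fun x => c * x) '' Set.Ioi (0 : ℝ) = Set.Ioi 0 := by
    simpa using Set.image_mul_left_Ioi hc 0
  rw [himg] at h
  rw [h, abs_of_pos hc, lintegral_const_mul' _ _ ENNReal.ofReal_ne_top]

theorem lintegral_comp_sinh {b : ℝ} (hb : 0 < b) (a : ℝ) (f : ℝ → ENNReal) :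
    ∫⁻ p, f p = ∫⁻ z, ENNReal.ofReal (b * Real.cosh z) * f (b * Real.sinh z - a) := by
  have h := lintegral_image_eq_lintegral_abs_deriv_mul (s := Set.univ)
    (f := fun z => b * Real.sinh z - a) (f' := fun z => b * Real.cosh z) MeasurableSet.univ
    (fun z _ => (((Real.hasDerivAt_sinh z).const_mul b).sub_const a).hasDerivWithinAt)
    (fun x _ y _ hxy => Real.sinh_injective (mul_left_cancel₀ hb.ne' (sub_left_injective hxy))) f
  have himg : (fun z => b * Real.sinh z - a) '' Set.univ = Set.univ := by
    rw [Set.image_univ, Set.range_eq_univ]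
    intro y
    refine ⟨Real.arsinh ((y + a) / b), ?_⟩
    simp only [Real.sinh_arsinh]
    field_simp
    ring
  rw [himg] at h
  simp only [Measure.restrict_univ] at h
  rw [h]
  refine lintegral_congr fun z => ?_
  rw [abs_of_pos (mul_pos hb (Real.cosh_pos z))]

/-- The substitution is chosen so that v² + 1 - 2 (1 - 2q) v becomes 4 q v cosh² t; see
`exp_two_mul_arsinh_quadratic`. -/
theorem lintegral_Ioi_comp_exp_arsinh {q : ℝ} (hq : 0 < q) (f : ℝ → ENNReal) :
    ∫⁻ v in Set.Ioi (0 : ℝ), f v = ∫⁻ t, ENNReal.ofReal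
      (Real.exp (2 * Real.arsinh (√q * Real.sinh t)) *
        (2 * √q * Real.cosh t / √(1 + q * Real.sinh t ^ 2))) *
      f (Real.exp (2 * Real.arsinh (√q * Real.sinh t))) := by
  have hq' : 0 < √q := Real.sqrt_pos.2 hq
  have h := lintegral_image_eq_lintegral_abs_deriv_mul (s := Set.univ)
    (f := fun t => Real.exp (2 * Real.arsinh (√q * Real.sinh t)))
    (f' := fun t => Real.exp (2 * Real.arsinh (√q * Real.sinh t)) *
        (2 * √q * Real.cosh t / √(1 + q * Real.sinh t ^ 2))) MeasurableSet.univ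
    (fun t _ => by
      have h1 := (((Real.hasDerivAt_sinh t).const_mul (√q)).arsinh.const_mul 2).exp
      refine (h1.congr_deriv ?_).hasDerivWithinAt
      rw [mul_pow, Real.sq_sqrt hq.le]
      simp only [smul_eq_mul]
      ring)
    (fun x _ y _ hxy => by
      have h1 := Real.exp_injective hxy
      have h2 := Real.arsinh_injective (mul_left_cancel₀ two_ne_zero h1)
      exact Real.sinh_injective (mul_left_cancel₀ hq'.ne' h2)) f
  have himg : (fun t => Real.exp (2 * Real.arsinh (√q * Real.sinh t))) '' Set.univ =
      Set.Ioi 0 := by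
    ext v
    simp only [Set.image_univ, Set.mem_range, Set.mem_Ioi]
    refine ⟨fun ⟨t, ht⟩ => ht ▸ Real.exp_pos _, fun hv => ?_⟩
    refine ⟨Real.arsinh (Real.sinh (Real.log v / 2) / √q), ?_⟩
    rw [Real.sinh_arsinh, mul_div_cancel₀ _ hq'.ne', Real.arsinh_sinh,
      mul_div_cancel₀ _ two_ne_zero, Real.exp_log hv]
  rw [himg] at h
  rw [h, Measure.restrict_univ]
  refine lintegral_congr fun t => ?_
  rw [abs_of_pos]
  have := Real.cosh_pos t
  positivity

/-! ### Integrals of powers of sech. -/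

theorem abs_le_abs_sinh (x : ℝ) : |x| ≤ |Real.sinh x| := by
  rw [Real.abs_sinh]
  exact Real.self_le_sinh_iff.2 (abs_nonneg x)

theorem continuous_sech : Continuous fun x : ℝ => 1 / Real.cosh x :=
  continuous_const.div Real.continuous_cosh fun x => (Real.cosh_pos x).ne'

theorem integrable_sech_pow {k : ℕ} (hk : 2 ≤ k) :
    Integrable fun x : ℝ => (1 / Real.cosh x) ^ k := by
  refine integrable_inv_one_add_sq.mono' (continuous_sech.pow k).aestronglyMeasurable ?_
  refine Filter.Eventually.of_forall fun x => ?_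
  have hc := Real.one_le_cosh x
  have hc0 := Real.cosh_pos x
  rw [Real.norm_eq_abs, abs_of_pos (by positivity)]
  have h1 : (1 / Real.cosh x) ^ k ≤ (1 / Real.cosh x) ^ 2 :=
    pow_le_pow_of_le_one (by positivity) (by rw [div_le_one hc0]; exact hc) hk
  refine h1.trans ?_
  rw [div_pow, one_pow, one_div]
  refine inv_anti₀ (by positivity) ?_
  rw [Real.cosh_sq]
  have h2 : x ^ 2 ≤ Real.sinh x ^ 2 := by
    rw [sq_le_sq]
    exact abs_le_abs_sinh x
  linarith

/-- The integral `∫ sech ^ (2 M + 1) / √(1 + q sinh ^ 2)` over the real line. -/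
noncomputable def sechIntegral (M : ℕ) (q : ℝ) : ℝ :=
  ∫ t, (1 / Real.cosh t) ^ (2 * M + 1) / √(1 + q * Real.sinh t ^ 2)

theorem sqrt_one_add_mul_sinh_sq_pos {q : ℝ} (hq : 0 ≤ q) (t : ℝ) :
    0 < √(1 + q * Real.sinh t ^ 2) := Real.sqrt_pos.2 (by positivity)

theorem continuous_sechIntegrand (M : ℕ) {q : ℝ} (hq : 0 ≤ q) :
    Continuous fun t => (1 / Real.cosh t) ^ (2 * M + 1) / √(1 + q * Real.sinh t ^ 2) :=
  (continuous_sech.pow _).div (by fun_prop) fun t => (sqrt_one_add_mul_sinh_sq_pos hq t).ne'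

theorem sechIntegrand_le (M : ℕ) {q : ℝ} (hq : 0 ≤ q) (t : ℝ) :
    ‖(1 / Real.cosh t) ^ (2 * M + 1) / √(1 + q * Real.sinh t ^ 2)‖ ≤
      (1 / Real.cosh t) ^ (2 * M + 1) := by
  have h1 := sqrt_one_add_mul_sinh_sq_pos hq t
  have h2 := Real.cosh_pos t
  rw [Real.norm_eq_abs, abs_of_nonneg (by positivity)]
  refine div_le_self (by positivity) ?_
  rw [Real.one_le_sqrt]
  nlinarith [sq_nonneg (Real.sinh t)]

theorem integrable_sechIntegrand {M : ℕ} (hM : 1 ≤ M) {q : ℝ} (hq : 0 ≤ q) :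
    Integrable fun t => (1 / Real.cosh t) ^ (2 * M + 1) / √(1 + q * Real.sinh t ^ 2) :=
  (integrable_sech_pow (k := 2 * M + 1) (by omega)).mono'
    (continuous_sechIntegrand M hq).aestronglyMeasurable
    (Filter.Eventually.of_forall (sechIntegrand_le M hq))

/-! ### Integrating out the two norms. -/

/-- With e = exp (arsinh y) one has e² = 2 y e + 1, hence v + 1/v = 4 y² + 2 for v = e²; then cosh²
= 1 + sinh². -/
theorem exp_two_mul_arsinh_quadratic {q θ : ℝ} (hq : 0 ≤ q) (hθ : θ = 1 - 2 * q) (t : ℝ) :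
    Real.exp (2 * Real.arsinh (√q * Real.sinh t)) ^ 2 + 1 -
        2 * θ * Real.exp (2 * Real.arsinh (√q * Real.sinh t)) =
      Real.exp (2 * Real.arsinh (√q * Real.sinh t)) * (4 * q * Real.cosh t ^ 2) := by
  set y := √q * Real.sinh t with hy
  have hy2 : y ^ 2 = q * Real.sinh t ^ 2 := by rw [hy, mul_pow, Real.sq_sqrt hq]
  have he : Real.exp (Real.arsinh y) = y + √(1 + y ^ 2) := Real.exp_arsinh y
  set e := Real.exp (Real.arsinh y)
  have hv : Real.exp (2 * Real.arsinh y) = e ^ 2 := by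
    rw [two_mul, Real.exp_add, sq]
  have hee : e ^ 2 = 2 * y * e + 1 := by
    have hs : √(1 + y ^ 2) ^ 2 = 1 + y ^ 2 := Real.sq_sqrt (by positivity)
    rw [he]
    linear_combination hs
  rw [hv, Real.cosh_sq, hθ]
  have h4 : (e ^ 2) ^ 2 + 1 = e ^ 2 * (4 * y ^ 2 + 2) := by
    linear_combination (e ^ 2 + 2 * y * e - 1) * hee
  linear_combination h4 + 4 * e ^ 2 * hy2

/-- The exponent is homogeneous of degree two, so passing to the ratio v of β b to α a's scale
separates the b-integral and leaves the integral of v^M (v² + 1 - 2θv)^(-(M+1)). After v = exp (2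
arsinh (√q sinh t)) the powers of v cancel against dv, and `sechIntegral` remains. -/
theorem lintegral_quadratic_exp {M : ℕ} (hM : 1 ≤ M) {α β q θ : ℝ} (hα : 0 < α) (hβ : 0 < β)
    (hq : 0 < q) (hθ : θ = 1 - 2 * q) :
    ∫⁻ b in Set.Ioi (0 : ℝ), ∫⁻ a in Set.Ioi (0 : ℝ), ENNReal.ofReal ((a * b) ^ M *
        Real.exp (-(α ^ 2 * a ^ 2 + β ^ 2 * b ^ 2 - 2 * θ * (α * a) * (β * b)) / 2)) =
      (∫⁻ b in Set.Ioi (0 : ℝ), ENNReal.ofReal (b ^ (2 * M + 1) * Real.exp (-b ^ 2 / 2))) *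
        ENNReal.ofReal ((1 / (α * β)) ^ (M + 1) * (2 * √q * (1 / (4 * q)) ^ (M + 1)) *
          sechIntegral M q) := by
  set c₀ := ∫⁻ b in Set.Ioi (0 : ℝ), ENNReal.ofReal (b ^ (2 * M + 1) * Real.exp (-b ^ 2 / 2))
  have hq1 : θ < 1 := by linarith
  have hQ : ∀ v : ℝ, 0 < v → 0 < v ^ 2 + 1 - 2 * θ * v := fun v hv => by
    nlinarith [sq_nonneg (v - 1)]
  have integral_inner : ∀ b ∈ Set.Ioi (0 : ℝ), ∫⁻ a in Set.Ioi (0 : ℝ), ENNReal.ofReal ((a * b) ^ M *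
        Real.exp (-(α ^ 2 * a ^ 2 + β ^ 2 * b ^ 2 - 2 * θ * (α * a) * (β * b)) / 2)) =
      ∫⁻ v in Set.Ioi (0 : ℝ), ENNReal.ofReal ((β / α) ^ (M + 1) * v ^ M *
        (b ^ (2 * M + 1) * Real.exp (-(β ^ 2 * b ^ 2 * (v ^ 2 + 1 - 2 * θ * v)) / 2))) := by
    intro b hb
    have hb : 0 < b := hb
    -- Substitute a = (β b / α) v; the exponent becomes -β² b² (v² + 1 - 2θv) / 2.
    rw [lintegral_Ioi_comp_mul (c := β * b / α) (by positivity),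
      ← lintegral_const_mul' _ _ ENNReal.ofReal_ne_top]
    refine lintegral_congr fun v => ?_
    rw [← ENNReal.ofReal_mul (by positivity)]
    congr 1
    have : α ^ 2 * (β * b / α * v) ^ 2 + β ^ 2 * b ^ 2 - 2 * θ * (α * (β * b / α * v)) * (β * b) =
        β ^ 2 * b ^ 2 * (v ^ 2 + 1 - 2 * θ * v) := by
      field_simp
    rw [this]
    simp only [mul_pow, div_pow, pow_succ, pow_mul]
    field_simp
    simp
  rw [setLIntegral_congr_fun measurableSet_Ioi integral_inner, lintegral_lintegral_swap (by fun_prop)]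
  have integral_middle : ∀ v ∈ Set.Ioi (0 : ℝ), ∫⁻ b in Set.Ioi (0 : ℝ), ENNReal.ofReal
        ((β / α) ^ (M + 1) * v ^ M * (b ^ (2 * M + 1) *
          Real.exp (-(β ^ 2 * b ^ 2 * (v ^ 2 + 1 - 2 * θ * v)) / 2))) =
      ENNReal.ofReal ((1 / (α * β)) ^ (M + 1) * v ^ M *
        (1 / (v ^ 2 + 1 - 2 * θ * v)) ^ (M + 1)) * c₀ := by
    intro v hv
    have hv : 0 < v := hv
    have hQv := hQ v hv
    set Q := v ^ 2 + 1 - 2 * θ * v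
    have hsQ : √Q ^ 2 = Q := Real.sq_sqrt hQv.le
    have hsQ0 : 0 < √Q := Real.sqrt_pos.2 hQv
    -- Rescaling b removes v from the exponential and produces the power Q^(-(M+1)).
    rw [lintegral_Ioi_comp_mul (c := 1 / (β * √Q)) (by positivity),
      ← lintegral_const_mul' _ _ ENNReal.ofReal_ne_top,
      ← lintegral_const_mul' _ _ ENNReal.ofReal_ne_top]
    refine setLIntegral_congr_fun measurableSet_Ioi fun b hb => ?_
    have hb : 0 < b := hb
    rw [← ENNReal.ofReal_mul (by positivity), ← ENNReal.ofReal_mul (by positivity)]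
    congr 1
    have : β ^ 2 * (1 / (β * √Q) * b) ^ 2 * Q = b ^ 2 := by
      field_simp
      rw [hsQ]
    rw [this]
    have h2 : (1 / Q) ^ (M + 1) = (1 / √Q) ^ (2 * M + 1) * (1 / √Q) := by
      rw [← pow_succ, show 2 * M + 1 + 1 = 2 * (M + 1) by ring, pow_mul, div_pow 1 (√Q), hsQ]
      simp
    rw [h2]
    simp only [mul_pow, div_pow, pow_succ, pow_mul]
    field_simp
    simp
  rw [setLIntegral_congr_fun measurableSet_Ioi integral_middle, lintegral_mul_const _ (by fun_prop), mul_comm]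
  congr 1
  rw [lintegral_Ioi_comp_exp_arsinh hq]
  have hJ : 0 ≤ (1 / (α * β)) ^ (M + 1) * (2 * √q * (1 / (4 * q)) ^ (M + 1)) := by positivity
  rw [ENNReal.ofReal_mul hJ, sechIntegral,
    ofReal_integral_eq_lintegral_ofReal (integrable_sechIntegrand hM hq.le)
      (Filter.Eventually.of_forall fun t => by have := Real.cosh_pos t; simp only [Pi.zero_apply]; positivity),
    ← lintegral_const_mul' _ _ ENNReal.ofReal_ne_top]
  refine lintegral_congr fun t => ?_
  have hc := Real.cosh_pos t
  rw [← ENNReal.ofReal_mul (by positivity), ← ENNReal.ofReal_mul hJ,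
    exp_two_mul_arsinh_quadratic hq.le hθ]
  congr 1
  set v := Real.exp (2 * Real.arsinh (√q * Real.sinh t))
  have hv : 0 < v := Real.exp_pos _
  have hs := sqrt_one_add_mul_sinh_sq_pos hq.le t
  simp only [mul_pow, div_pow, pow_succ, pow_mul, one_pow]
  field_simp

/-! ### The exact law of the correlation coefficient. -/

/-- The density, up to a normalising constant, of `artanh r - artanh ρ`, where `r` is the
correlation coefficient of a bivariate normal sample of size `M + 2` with correlation `ρ`. -/
noncomputable def fisherWeight (ρ : ℝ) (M : ℕ) (x : ℝ) : ℝ :=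
  (1 / Real.cosh x) ^ M * √(1 + ρ * Real.tanh x) *
    sechIntegral M ((1 - ρ ^ 2) / (2 * (1 + ρ * Real.tanh x)))

theorem one_add_mul_tanh_pos {ρ : ℝ} (hρ : ρ ∈ Set.Ioo (-1 : ℝ) 1) (x : ℝ) :
    0 < 1 + ρ * Real.tanh x := by
  have h1 := Real.abs_tanh_lt_one x
  have h2 : |ρ| < 1 := abs_lt.2 hρ
  have h3 : |ρ * Real.tanh x| < 1 := by
    rw [abs_mul]
    exact mul_lt_one_of_nonneg_of_lt_one_left (abs_nonneg _) h2 h1.le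
  linarith [(abs_lt.1 h3).1]

theorem sech_sq (x : ℝ) : (1 / Real.cosh x) ^ 2 = 1 - Real.tanh x ^ 2 := by
  have := Real.cosh_pos x
  rw [Real.tanh_eq_sinh_div_cosh]
  field_simp
  rw [Real.cosh_sq]
  ring

/-- This choice of p makes the numerator κ b sinh z and the root κ b cosh z; Fisher's transformation
is thus the coordinate in which the law is computed. -/
theorem corrOfComponents_eq_tanh {ρ : ℝ} (hρ : ρ ∈ Set.Ioo (-1 : ℝ) 1) {a b : ℝ} (hb : 0 < b)
    (z : ℝ) :
    corrOfComponents ρ a (b * Real.sinh z - ρ / √(1 - ρ ^ 2) * a) b = Real.tanh z := by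
  have hρ2 : 0 < 1 - ρ ^ 2 := by nlinarith [hρ.1, hρ.2]
  have hκ : 0 < √(1 - ρ ^ 2) := Real.sqrt_pos.2 hρ2
  have hκ2 : √(1 - ρ ^ 2) ^ 2 = 1 - ρ ^ 2 := Real.sq_sqrt hρ2.le
  have hc := Real.cosh_pos z
  unfold corrOfComponents
  rw [← hκ2, Real.sqrt_sq hκ.le]
  set κ := √(1 - ρ ^ 2)
  have h1 : ρ * a + κ * (b * Real.sinh z - ρ / κ * a) = κ * b * Real.sinh z := by
    field_simp
    ring
  have h2 : (κ * b * Real.sinh z) ^ 2 + κ ^ 2 * b ^ 2 = (κ * b * Real.cosh z) ^ 2 := by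
    rw [mul_pow, mul_pow _ (Real.cosh z), Real.cosh_sq]
    ring
  rw [h1, h2, Real.sqrt_sq (by positivity), Real.tanh_eq_sinh_div_cosh]
  field_simp

theorem tanh_artanh_add {ρ : ℝ} (hρ : ρ ∈ Set.Ioo (-1 : ℝ) 1) (x : ℝ) :
    Real.tanh (Real.artanh ρ + x) = (ρ + Real.tanh x) / (1 + ρ * Real.tanh x) := by
  have hc := Real.cosh_pos x
  have hρ2 : 0 < 1 - ρ ^ 2 := by nlinarith [hρ.1, hρ.2]
  have hκ : 0 < √(1 - ρ ^ 2) := Real.sqrt_pos.2 hρ2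
  have h1 := one_add_mul_tanh_pos hρ x
  rw [Real.tanh_eq_sinh_div_cosh, Real.sinh_add, Real.cosh_add, Real.sinh_artanh hρ,
    Real.cosh_artanh hρ]
  rw [Real.tanh_eq_sinh_div_cosh] at h1 ⊢
  have h2 : 0 < Real.cosh x + ρ * Real.sinh x := by
    have := mul_pos h1 hc
    field_simp at this
    linarith
  field_simp

theorem cosh_artanh_add {ρ : ℝ} (hρ : ρ ∈ Set.Ioo (-1 : ℝ) 1) (x : ℝ) :
    Real.cosh (Real.artanh ρ + x) =
      Real.cosh x * (1 + ρ * Real.tanh x) / √(1 - ρ ^ 2) := by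
  have hc := Real.cosh_pos x
  have hρ2 : 0 < 1 - ρ ^ 2 := by nlinarith [hρ.1, hρ.2]
  have hκ : 0 < √(1 - ρ ^ 2) := Real.sqrt_pos.2 hρ2
  rw [Real.cosh_add, Real.sinh_artanh hρ, Real.cosh_artanh hρ, Real.tanh_eq_sinh_div_cosh]
  field_simp

/-- Recentring at artanh ρ replaces cosh z by cosh x · g/κ and q by κ²/(2g), where g = 1 + ρ tanh x.
The factors contribute g^(-M), g^(-1/2) and g^(M+1); only √g survives. -/
theorem fisherWeight_shift {ρ : ℝ} (hρ : ρ ∈ Set.Ioo (-1 : ℝ) 1) (M : ℕ) :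
    ∃ c : ℝ, 0 ≤ c ∧ ∀ x q z, z = Real.artanh ρ + x → q = (1 - ρ * Real.tanh z) / 2 →
      Real.cosh z * ((1 / (1 / √(1 - ρ ^ 2) * Real.cosh z)) ^ (M + 1) *
        (2 * √q * (1 / (4 * q)) ^ (M + 1)) * sechIntegral M q) = c * fisherWeight ρ M x := by
  have hρ2 : 0 < 1 - ρ ^ 2 := by nlinarith [hρ.1, hρ.2]
  have hκ : 0 < √(1 - ρ ^ 2) := Real.sqrt_pos.2 hρ2
  have hκ2 : √(1 - ρ ^ 2) ^ 2 = 1 - ρ ^ 2 := Real.sq_sqrt hρ2.le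
  set κ := √(1 - ρ ^ 2)
  refine ⟨2 * κ ^ (M + 1) * (1 / 4) ^ (M + 1) * (2 / κ) ^ M * √2 / κ, by positivity, ?_⟩
  intro x q z hz hq
  have hg := one_add_mul_tanh_pos hρ x
  have hc := Real.cosh_pos x
  have hq' : q = (1 - ρ ^ 2) / (2 * (1 + ρ * Real.tanh x)) := by
    rw [hq, hz, tanh_artanh_add hρ]
    field_simp
    ring
  have hch : Real.cosh (Real.artanh ρ + x) = Real.cosh x * (1 + ρ * Real.tanh x) / κ :=
    cosh_artanh_add hρ x
  rw [fisherWeight, ← hq', hz, hch]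
  rw [← hκ2] at hq'
  set g := 1 + ρ * Real.tanh x
  have hsq : √q = κ / (√2 * √g) := by
    rw [hq', Real.sqrt_div (by positivity), Real.sqrt_sq hκ.le, Real.sqrt_mul (by norm_num)]
  have hq0 : 0 < q := by rw [hq']; positivity
  have hsg : √g ^ 2 = g := Real.sq_sqrt hg.le
  have hsg0 : 0 < √g := Real.sqrt_pos.2 hg
  have hs2 : √2 ^ 2 = (2 : ℝ) := Real.sq_sqrt (by norm_num)
  have hs20 : 0 < √(2 : ℝ) := Real.sqrt_pos.2 (by norm_num)
  have hq4 : 1 / (4 * q) = 1 / 4 * (2 * √g ^ 2 / κ ^ 2) := by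
    rw [hq', hsg]
    field_simp
  rw [hsq, hq4]
  have hgg : g = √g ^ 2 := hsg.symm
  generalize sechIntegral M q = J
  rw [hgg, Real.sqrt_sq hsg0.le]
  simp only [mul_pow, div_pow, pow_succ, one_pow]
  field_simp
  linear_combination (-J) * hs2

theorem continuous_tanh : Continuous Real.tanh := by
  have : Real.tanh = fun x => Real.sinh x / Real.cosh x :=
    funext fun x => Real.tanh_eq_sinh_div_cosh x
  rw [this]
  exact Real.continuous_sinh.div Real.continuous_cosh fun x => (Real.cosh_pos x).ne'

theorem continuousOn_sechIntegral {M : ℕ} (hM : 1 ≤ M) :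
    ContinuousOn (sechIntegral M) (Set.Ici 0) := by
  refine continuousOn_of_dominated (bound := fun t => (1 / Real.cosh t) ^ (2 * M + 1)) ?_ ?_
    (integrable_sech_pow (by omega)) ?_
  · exact fun q hq => (continuous_sechIntegrand M hq).aestronglyMeasurable
  · exact fun q hq => Filter.Eventually.of_forall (sechIntegrand_le M hq)
  · refine Filter.Eventually.of_forall fun t => ?_
    refine ContinuousOn.div (by fun_prop) (by fun_prop) fun q hq => ?_
    exact (sqrt_one_add_mul_sinh_sq_pos hq t).ne'

theorem continuous_fisherWeight {ρ : ℝ} (hρ : ρ ∈ Set.Ioo (-1 : ℝ) 1) {M : ℕ} (hM : 1 ≤ M) :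
    Continuous (fisherWeight ρ M) := by
  have hρ2 : 0 < 1 - ρ ^ 2 := by nlinarith [hρ.1, hρ.2]
  have ht := continuous_tanh
  refine ((continuous_sech.pow M).mul (by fun_prop)).mul
    ((continuousOn_sechIntegral hM).comp_continuous ?_ fun x => ?_)
  · refine continuous_const.div (by fun_prop) fun x => ?_
    have := one_add_mul_tanh_pos hρ x
    positivity
  · have := one_add_mul_tanh_pos hρ x
    exact Set.mem_Ici.2 (by positivity)

/-- After p = b sinh z - (ρ/κ) a the Jacobian b cosh z raises b^j to b^(j+1), so a and b carry the
same power M. Tonelli moves z outside, `lintegral_quadratic_exp` integrates out a and b, and a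
translation recentres z. -/
theorem lintegral_corrOfComponents {ρ : ℝ} (hρ : ρ ∈ Set.Ioo (-1 : ℝ) 1) (j : ℕ) :
    ∃ c : ENNReal, ∀ F : ℝ → ENNReal, Measurable F →
      ∫⁻ a in Set.Ioi (0 : ℝ), (∫⁻ p, (∫⁻ b in Set.Ioi (0 : ℝ),
          F (corrOfComponents ρ a p b) * ENNReal.ofReal (b ^ j * Real.exp (-b ^ 2 / 2))) *
            ENNReal.ofReal (Real.exp (-p ^ 2 / 2))) *
        ENNReal.ofReal (a ^ (j + 1) * Real.exp (-a ^ 2 / 2)) =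
      c * ∫⁻ x, F (Real.tanh (Real.artanh ρ + x)) *
        ENNReal.ofReal (fisherWeight ρ (j + 1) x) := by
  have hρ2 : 0 < 1 - ρ ^ 2 := by nlinarith [hρ.1, hρ.2]
  have hκ : 0 < √(1 - ρ ^ 2) := Real.sqrt_pos.2 hρ2
  have hκ2 : √(1 - ρ ^ 2) ^ 2 = 1 - ρ ^ 2 := Real.sq_sqrt hρ2.le
  obtain ⟨c₁, hc₁, hc₁'⟩ := fisherWeight_shift hρ (j + 1)
  set M := j + 1 with hM
  set c₀ := ∫⁻ b in Set.Ioi (0 : ℝ), ENNReal.ofReal (b ^ (2 * M + 1) * Real.exp (-b ^ 2 / 2))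
  refine ⟨c₀ * ENNReal.ofReal c₁, fun F hF => ?_⟩
  have hcorr := fun (a b : ℝ) (hb : 0 < b) z => corrOfComponents_eq_tanh hρ (a := a) hb z
  set κ := √(1 - ρ ^ 2)
  have hFm : Measurable fun z : ℝ × ℝ × ℝ => F (corrOfComponents ρ z.1 z.2.1 z.2.2) :=
    hF.comp (measurable_corrOfComponents ρ)
  have hFt : Measurable fun z => F (Real.tanh z) := hF.comp continuous_tanh.measurable
  -- The integrand of `lintegral_quadratic_exp` with α = 1/κ, β = cosh z and θ = ρ tanh z.
  obtain ⟨Q, hQ⟩ : ∃ Q : ℝ → ℝ → ℝ → ENNReal, ∀ a b z, Q a b z = ENNReal.ofReal ((a * b) ^ M *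
      Real.exp (-((1 / κ) ^ 2 * a ^ 2 + Real.cosh z ^ 2 * b ^ 2 -
        2 * (ρ * Real.tanh z) * (1 / κ * a) * (Real.cosh z * b)) / 2)) := ⟨_, fun _ _ _ => rfl⟩
  have hQm : Measurable fun w : ℝ × ℝ × ℝ => Q w.1 w.2.1 w.2.2 := by
    simp_rw [hQ, Real.tanh_eq_sinh_div_cosh]
    fun_prop
  obtain ⟨G, hG⟩ : ∃ G : ℝ → ℝ → ℝ → ENNReal, ∀ a b z,
      G a b z = F (Real.tanh z) * ENNReal.ofReal (Real.cosh z) * Q a b z := ⟨_, fun _ _ _ => rfl⟩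
  have hGm : Measurable fun w : ℝ × ℝ × ℝ => G w.1 w.2.1 w.2.2 := by
    simp_rw [hG]
    exact ((hFt.comp (by fun_prop : Measurable fun w : ℝ × ℝ × ℝ => w.2.2)).mul
      (by fun_prop)).mul hQm
  have integral_inner : ∀ a ∈ Set.Ioi (0 : ℝ), (∫⁻ p, (∫⁻ b in Set.Ioi (0 : ℝ),
          F (corrOfComponents ρ a p b) * ENNReal.ofReal (b ^ j * Real.exp (-b ^ 2 / 2))) *
            ENNReal.ofReal (Real.exp (-p ^ 2 / 2))) *
        ENNReal.ofReal (a ^ (j + 1) * Real.exp (-a ^ 2 / 2)) =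
      ∫⁻ b in Set.Ioi (0 : ℝ), ∫⁻ z, G a b z := by
    intro a ha
    have ha : 0 < a := ha
    rw [← lintegral_mul_const' _ _ ENNReal.ofReal_ne_top]
    have hpull : ∀ p, (∫⁻ b in Set.Ioi (0 : ℝ),
          F (corrOfComponents ρ a p b) * ENNReal.ofReal (b ^ j * Real.exp (-b ^ 2 / 2))) *
            ENNReal.ofReal (Real.exp (-p ^ 2 / 2)) *
        ENNReal.ofReal (a ^ (j + 1) * Real.exp (-a ^ 2 / 2)) = ∫⁻ b in Set.Ioi (0 : ℝ),
          F (corrOfComponents ρ a p b) * ENNReal.ofReal (b ^ j * Real.exp (-b ^ 2 / 2)) *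
            ENNReal.ofReal (Real.exp (-p ^ 2 / 2)) *
        ENNReal.ofReal (a ^ (j + 1) * Real.exp (-a ^ 2 / 2)) := fun p => by
      rw [lintegral_mul_const' _ _ ENNReal.ofReal_ne_top,
        lintegral_mul_const' _ _ ENNReal.ofReal_ne_top]
    simp only [hpull]
    rw [lintegral_lintegral_swap]
    swap
    · refine Measurable.aemeasurable ?_
      refine ((Measurable.mul ?_ (by fun_prop)).mul (by fun_prop)).mul (by fun_prop)
      exact hFm.comp (by fun_prop : Measurable fun z : ℝ × ℝ => (a, z.1, z.2))
    refine setLIntegral_congr_fun measurableSet_Ioi fun b hb => ?_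
    have hb : 0 < b := hb
    rw [lintegral_comp_sinh hb (ρ / κ * a)]
    refine lintegral_congr fun z => ?_
    have hcz := Real.cosh_pos z
    rw [hcorr a b hb, hG, hQ, mul_comm, mul_assoc, mul_assoc, mul_assoc, mul_assoc]
    congr 1
    rw [← ENNReal.ofReal_mul (by positivity), ← ENNReal.ofReal_mul (by positivity),
      ← ENNReal.ofReal_mul (by positivity), ← ENNReal.ofReal_mul (by positivity)]
    congr 1
    -- Expand the square in p: 1 + (ρ/κ)² = 1/κ² collects the a² terms, and 1 + sinh² = cosh² the b²
    -- terms.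
    have he : Real.exp (-((1 / κ) ^ 2 * a ^ 2 + Real.cosh z ^ 2 * b ^ 2 -
          2 * (ρ * Real.tanh z) * (1 / κ * a) * (Real.cosh z * b)) / 2) =
        Real.exp (-b ^ 2 / 2) * (Real.exp (-(b * Real.sinh z - ρ / κ * a) ^ 2 / 2) *
          Real.exp (-a ^ 2 / 2)) := by
      rw [← Real.exp_add, ← Real.exp_add]
      congr 1
      have hk : (1 / κ) ^ 2 = 1 + (ρ / κ) ^ 2 := by
        field_simp
        linarith
      have ht : Real.tanh z * Real.cosh z = Real.sinh z := by
        rw [Real.tanh_eq_sinh_div_cosh, div_mul_cancel₀ _ hcz.ne']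
      linear_combination (-a ^ 2 / 2) * hk + (-b ^ 2 / 2) * Real.cosh_sq z +
        (ρ * (1 / κ) * a * b) * ht
    rw [he, hM]
    ring
  have integral_middle : ∀ a, ∫⁻ b in Set.Ioi (0 : ℝ), ∫⁻ z, G a b z =
      ∫⁻ z, ∫⁻ b in Set.Ioi (0 : ℝ), G a b z := by
    intro a
    rw [lintegral_lintegral_swap]
    exact (hGm.comp (by fun_prop : Measurable fun z : ℝ × ℝ => (a, z.1, z.2))).aemeasurable
  have integral_swap : ∫⁻ a in Set.Ioi (0 : ℝ), ∫⁻ z, ∫⁻ b in Set.Ioi (0 : ℝ), G a b z =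
      ∫⁻ z, ∫⁻ b in Set.Ioi (0 : ℝ), ∫⁻ a in Set.Ioi (0 : ℝ), G a b z := by
    rw [lintegral_lintegral_swap]
    swap
    · exact (Measurable.lintegral_prod_right (f := fun (w : ℝ × ℝ) b => G w.1 b w.2)
        (hGm.comp (by fun_prop : Measurable fun z : (ℝ × ℝ) × ℝ =>
          (z.1.1, z.2, z.1.2)))).aemeasurable
    refine lintegral_congr fun z => ?_
    rw [lintegral_lintegral_swap]
    exact (hGm.comp (by fun_prop : Measurable fun w : ℝ × ℝ => (w.1, w.2, z))).aemeasurable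
  have integral_outer : ∀ x, ∫⁻ b in Set.Ioi (0 : ℝ), ∫⁻ a in Set.Ioi (0 : ℝ), G a b (Real.artanh ρ + x) =
      c₀ * ENNReal.ofReal c₁ * (F (Real.tanh (Real.artanh ρ + x)) *
        ENNReal.ofReal (fisherWeight ρ M x)) := by
    intro x
    set z := Real.artanh ρ + x with hz
    have hcz := Real.cosh_pos z
    have hθ : ρ * Real.tanh z = 1 - 2 * ((1 - ρ * Real.tanh z) / 2) := by ring
    have hq0 : 0 < (1 - ρ * Real.tanh z) / 2 := by
      have := one_add_mul_tanh_pos hρ (-z)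
      rw [Real.tanh_neg] at this
      linarith
    have hquad := lintegral_quadratic_exp (M := M) (by omega) (α := 1 / κ) (β := Real.cosh z)
      (by positivity) hcz hq0 hθ
    simp only [← hQ] at hquad
    have hQa : ∀ b, Measurable fun a => Q a b z := fun b =>
      hQm.comp (by fun_prop : Measurable fun a : ℝ => (a, b, z))
    have hQb : Measurable fun b => ∫⁻ a in Set.Ioi (0 : ℝ), Q a b z :=
      Measurable.lintegral_prod_right (f := fun b a => Q a b z)
        (hQm.comp (by fun_prop : Measurable fun w : ℝ × ℝ => (w.2, w.1, z)))
    simp only [hG, lintegral_const_mul _ (hQa _), lintegral_const_mul _ hQb, hquad]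
    have := hc₁' x _ z hz rfl
    generalize ((1 / (1 / κ * Real.cosh z)) ^ (M + 1) *
      (2 * √((1 - ρ * Real.tanh z) / 2) * (1 / (4 * ((1 - ρ * Real.tanh z) / 2))) ^ (M + 1)) *
        sechIntegral M ((1 - ρ * Real.tanh z) / 2)) = R at *
    calc F (Real.tanh z) * ENNReal.ofReal (Real.cosh z) * (c₀ * ENNReal.ofReal R) =
        c₀ * (F (Real.tanh z) * (ENNReal.ofReal (Real.cosh z) * ENNReal.ofReal R)) := by ring
      _ = c₀ * (F (Real.tanh z) * (ENNReal.ofReal c₁ * ENNReal.ofReal (fisherWeight ρ M x))) := by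
        rw [← ENNReal.ofReal_mul hcz.le, ← ENNReal.ofReal_mul hc₁, this]
      _ = _ := by ring
  rw [setLIntegral_congr_fun measurableSet_Ioi integral_inner]
  simp only [integral_middle]
  rw [integral_swap, ← lintegral_add_left_eq_self _ (Real.artanh ρ)]
  simp only [integral_outer]
  refine lintegral_const_mul _ ?_
  refine (hFt.comp (measurable_const_add _)).mul ?_
  exact (continuous_fisherWeight hρ (by omega)).measurable.ennreal_ofReal

/-- The law of the correlation coefficient of a bivariate normal sample. -/
theorem IsBivariateNormalSample.lintegral_sampleCorr_eq {ρ : ℝ} (hρ : ρ ∈ Set.Ioo (-1 : ℝ) 1)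
    {M : ℕ} (hM : 1 ≤ M) : ∃ c : ENNReal, ∀ {Ω : Type*} [MeasurableSpace Ω]
    {P : Measure Ω} [IsProbabilityMeasure P] {X Y : Fin (M + 2) → Ω → ℝ}
    {μ₁ μ₂ σ₁ σ₂ : ℝ}, 0 < σ₁ → 0 < σ₂ → IsBivariateNormalSample P X Y μ₁ μ₂ σ₁ σ₂ ρ →
    ∀ {F : ℝ → ENNReal}, Measurable F →
    ∫⁻ ω, F (sampleCorr (fun i => X i ω) (fun i => Y i ω)) ∂P =
      c * ∫⁻ x, F (Real.tanh (Real.artanh ρ + x)) * ENNReal.ofReal (fisherWeight ρ M x) := by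
  obtain ⟨j, rfl⟩ : ∃ j, M = j + 1 := ⟨M - 1, by omega⟩
  have hρ2 : ρ ^ 2 < 1 := by nlinarith [hρ.1, hρ.2]
  obtain ⟨c₁, hc₁⟩ := lintegral_sampleCorr_gaussian hρ2.le j
  obtain ⟨c₂, hc₂⟩ := lintegral_corrOfComponents hρ j
  refine ⟨c₁ * c₂, fun hσ₁ hσ₂ h F hF => ?_⟩
  rw [h.lintegral_sampleCorr (by omega) hσ₁ hσ₂ hρ2 hF, hc₁ F hF, hc₂ F hF, mul_assoc]

/-! ### Recurrences for moments under powers of sech. -/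

theorem hasDerivAt_sech (x : ℝ) :
    HasDerivAt (fun x => 1 / Real.cosh x) (-(Real.tanh x * (1 / Real.cosh x))) x := by
  have hc := Real.cosh_pos x
  have h := (Real.hasDerivAt_cosh x).inv hc.ne'
  simp only [one_div]
  refine h.congr_deriv ?_
  rw [Real.tanh_eq_sinh_div_cosh]
  field_simp

theorem hasDerivAt_tanh (x : ℝ) : HasDerivAt Real.tanh (1 - Real.tanh x ^ 2) x := by
  have hc := Real.cosh_pos x
  have h := (Real.hasDerivAt_sinh x).div (Real.hasDerivAt_cosh x) hc.ne'
  have he : Real.tanh = fun x => Real.sinh x / Real.cosh x :=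
    funext fun x => Real.tanh_eq_sinh_div_cosh x
  rw [he]
  refine h.congr_deriv ?_
  field_simp

theorem sech_pos (x : ℝ) : 0 < 1 / Real.cosh x := by
  have := Real.cosh_pos x
  positivity

theorem sech_le_one (x : ℝ) : 1 / Real.cosh x ≤ 1 := by
  rw [div_le_one (Real.cosh_pos x)]
  exact Real.one_le_cosh x

theorem integrable_mul_sech_pow {k p M : ℕ} (hM : k + p + 2 ≤ M) {f : ℝ → ℝ} (hf : Continuous f)
    {C : ℝ} (hC : ∀ x, |f x| ≤ C * |Real.sinh x| ^ k * Real.cosh x ^ p) :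
    Integrable fun x => f x * (1 / Real.cosh x) ^ M := by
  refine ((integrable_sech_pow (le_refl 2)).const_mul |C|).mono'
    (hf.mul (continuous_sech.pow M)).aestronglyMeasurable ?_
  refine Filter.Eventually.of_forall fun x => ?_
  have hc := Real.cosh_pos x
  have hs : |Real.sinh x| ≤ Real.cosh x := by
    rw [Real.abs_sinh, ← Real.cosh_abs]
    exact (Real.sinh_lt_cosh _).le
  rw [norm_mul, Real.norm_eq_abs, Real.norm_eq_abs, abs_of_pos (pow_pos (sech_pos x) M)]
  have h1 : |f x| ≤ |C| * Real.cosh x ^ (k + p) := by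
    refine (hC x).trans ?_
    rw [pow_add, ← mul_assoc]
    gcongr
    exact le_abs_self C
  have h2 : (1 / Real.cosh x) ^ M ≤ (1 / Real.cosh x) ^ (k + p + 2) :=
    pow_le_pow_of_le_one (sech_pos x).le (sech_le_one x) hM
  calc |f x| * (1 / Real.cosh x) ^ M
      ≤ |C| * Real.cosh x ^ (k + p) * (1 / Real.cosh x) ^ (k + p + 2) := by gcongr
    _ = |C| * (1 / Real.cosh x) ^ 2 := by
      rw [pow_add _ (k + p), mul_assoc, ← mul_assoc (Real.cosh x ^ (k + p)), ← mul_pow,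
        mul_one_div_cancel hc.ne', one_pow, one_mul]

theorem abs_tanh_le_abs_sinh (x : ℝ) : |Real.tanh x| ≤ |Real.sinh x| := by
  rw [Real.tanh_eq_sinh_div_cosh, abs_div, abs_of_pos (Real.cosh_pos x)]
  exact div_le_self (abs_nonneg _) (Real.one_le_cosh x)

theorem integrable_tanh_pow_mul_sech_pow (k : ℕ) {M : ℕ} (hM : 2 ≤ M) :
    Integrable fun x => Real.tanh x ^ k * (1 / Real.cosh x) ^ M := by
  refine integrable_mul_sech_pow (k := 0) (p := 0) (C := 1) (by omega) (continuous_tanh.pow k)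
    fun x => ?_
  rw [abs_pow]
  simpa using pow_le_one₀ (n := k) (abs_nonneg _) (Real.abs_tanh_lt_one x).le

theorem integrable_sinh_pow_mul_sech_pow {k M : ℕ} (hM : k + 2 ≤ M) :
    Integrable fun x => Real.sinh x ^ k * (1 / Real.cosh x) ^ M := by
  refine integrable_mul_sech_pow (k := k) (p := 0) (C := 1) (by omega)
    (Real.continuous_sinh.pow k) fun x => ?_
  rw [abs_pow]
  simp

theorem integral_tanh_mul_sech_pow {M : ℕ} (hM : 2 ≤ M) :
    ∫ x, Real.tanh x * (1 / Real.cosh x) ^ M = 0 := by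
  have hi := integrable_tanh_pow_mul_sech_pow 1 hM
  simp only [pow_one] at hi
  have h := integral_eq_zero_of_hasDerivAt_of_integrable
    (f := fun x => (1 / Real.cosh x) ^ M)
    (f' := fun x => -(M : ℝ) * (Real.tanh x * (1 / Real.cosh x) ^ M)) (fun x => ?_)
    (hi.const_mul _) (integrable_sech_pow hM)
  · rw [integral_const_mul] at h
    have hM' : (M : ℝ) ≠ 0 := by positivity
    simpa [hM'] using h
  · refine ((hasDerivAt_sech x).pow M).congr_deriv ?_
    obtain ⟨j, rfl⟩ : ∃ j, M = j + 1 := ⟨M - 1, by omega⟩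
    simp only [Nat.add_sub_cancel]
    ring

/-- Integrate the derivative of tanh^(k+1) sech^M and use tanh' = 1 - tanh². This exact recurrence
is the reason for expanding in tanh x rather than in x. -/
theorem integral_tanh_pow_add_two_mul_sech_pow (k : ℕ) {M : ℕ} (hM : 2 ≤ M) :
    (M + k + 1 : ℝ) * ∫ x, Real.tanh x ^ (k + 2) * (1 / Real.cosh x) ^ M =
      (k + 1) * ∫ x, Real.tanh x ^ k * (1 / Real.cosh x) ^ M := by
  have h0 := integrable_tanh_pow_mul_sech_pow k hM
  have h1 := integrable_tanh_pow_mul_sech_pow (k + 1) hM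
  have h2 := integrable_tanh_pow_mul_sech_pow (k + 2) hM
  have h := integral_eq_zero_of_hasDerivAt_of_integrable
    (f := fun x => Real.tanh x ^ (k + 1) * (1 / Real.cosh x) ^ M)
    (f' := fun x => (k + 1 : ℝ) * (Real.tanh x ^ k * (1 / Real.cosh x) ^ M) -
      (M + k + 1 : ℝ) * (Real.tanh x ^ (k + 2) * (1 / Real.cosh x) ^ M)) (fun x => ?_)
    ((h0.const_mul _).sub (h2.const_mul _)) h1
  · rw [integral_sub (h0.const_mul _) (h2.const_mul _), integral_const_mul,
      integral_const_mul] at h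
    linarith
  · refine (((hasDerivAt_tanh x).pow (k + 1)).mul ((hasDerivAt_sech x).pow M)).congr_deriv ?_
    obtain ⟨j, rfl⟩ : ∃ j, M = j + 1 := ⟨M - 1, by omega⟩
    simp only [Nat.add_sub_cancel, Pi.pow_apply]
    push_cast
    ring

/-- Integrate the derivative of sinh^(k+1) sech^(M-1) and use cosh² = 1 + sinh². -/
theorem integral_sinh_pow_add_two_mul_sech_pow {k M : ℕ} (hM : k + 4 ≤ M) :
    (M - k - 2 : ℝ) * ∫ x, Real.sinh x ^ (k + 2) * (1 / Real.cosh x) ^ M =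
      (k + 1) * ∫ x, Real.sinh x ^ k * (1 / Real.cosh x) ^ M := by
  have h0 := integrable_sinh_pow_mul_sech_pow (k := k) (M := M) (by omega)
  have h1 := integrable_sinh_pow_mul_sech_pow (k := k + 1) (M := M - 1) (by omega)
  have h2 := integrable_sinh_pow_mul_sech_pow (k := k + 2) (M := M) (by omega)
  have h := integral_eq_zero_of_hasDerivAt_of_integrable
    (f := fun x => Real.sinh x ^ (k + 1) * (1 / Real.cosh x) ^ (M - 1))
    (f' := fun x => (k + 1 : ℝ) * (Real.sinh x ^ k * (1 / Real.cosh x) ^ M) -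
      (M - k - 2 : ℝ) * (Real.sinh x ^ (k + 2) * (1 / Real.cosh x) ^ M)) (fun x => ?_)
    ((h0.const_mul _).sub (h2.const_mul _)) h1
  · rw [integral_sub (h0.const_mul _) (h2.const_mul _), integral_const_mul,
      integral_const_mul] at h
    linarith
  · refine (((Real.hasDerivAt_sinh x).pow (k + 1)).mul
      ((hasDerivAt_sech x).pow (M - 1))).congr_deriv ?_
    obtain ⟨j, rfl⟩ : ∃ j, M = j + 2 := ⟨M - 2, by omega⟩
    have hc := Real.cosh_pos x
    rw [Real.tanh_eq_sinh_div_cosh]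
    simp only [show j + 2 - 1 = j + 1 by omega, Nat.add_sub_cancel, Pi.pow_apply]
    push_cast
    have hcs : Real.cosh x ^ 2 = Real.sinh x ^ 2 + 1 := Real.cosh_sq x
    simp only [pow_succ, div_pow, one_pow]
    simp only [pow_succ, pow_zero, one_mul] at hcs
    field_simp
    simp only [sq]
    linear_combination (k + 1 : ℝ) * Real.sinh x ^ k * hcs

/-- The integral of `sech ^ M` over the real line. -/
noncomputable def sechMass (M : ℕ) : ℝ := ∫ x, (1 / Real.cosh x) ^ M

theorem sechMass_pos {M : ℕ} (hM : 2 ≤ M) : 0 < sechMass M := by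
  refine (integral_pos_iff_support_of_nonneg (fun x => (pow_pos (sech_pos x) M).le)
    (integrable_sech_pow hM)).2 ?_
  have : (Function.support fun x : ℝ => (1 / Real.cosh x) ^ M) = Set.univ :=
    Set.eq_univ_of_forall fun x => (pow_pos (sech_pos x) M).ne'
  rw [this]
  simp

theorem sechMass_add_two {M : ℕ} (hM : 2 ≤ M) :
    (M + 1 : ℝ) * sechMass (M + 2) = M * sechMass M := by
  have h := integral_tanh_pow_add_two_mul_sech_pow 0 hM
  have h2 := integrable_tanh_pow_mul_sech_pow 2 hM
  have h0 := integrable_sech_pow hM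
  have : sechMass (M + 2) = sechMass M - ∫ x, Real.tanh x ^ 2 * (1 / Real.cosh x) ^ M := by
    unfold sechMass
    rw [← integral_sub h0 h2]
    refine integral_congr_ae (Filter.Eventually.of_forall fun x => ?_)
    simp only
    rw [pow_add, sech_sq]
    ring
  rw [this]
  simp only [pow_zero, one_mul, zero_add, CharP.cast_eq_zero, add_zero] at h
  unfold sechMass
  linarith

/-- The ratio of consecutive masses of equal parity is (M+1)/M ≤ 2, so a fixed number of factors
cosh can be absorbed at the price of a constant. -/
theorem sechMass_le_two_pow (p : ℕ) {M : ℕ} (hM : 2 ≤ M) :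
    sechMass M ≤ 2 ^ p * sechMass (M + 2 * p) := by
  induction p with
  | zero => simp
  | succ p ih =>
    have h1 := sechMass_add_two (M := M + 2 * p) (by omega)
    have h2 := sechMass_pos (M := M + 2 * p + 2) (by omega)
    have h3 : sechMass (M + 2 * p) ≤ 2 * sechMass (M + 2 * p + 2) := by
      have hM' : (1 : ℝ) ≤ ((M + 2 * p : ℕ) : ℝ) := by exact_mod_cast (by omega : 1 ≤ M + 2 * p)
      nlinarith
    rw [show M + 2 * (p + 1) = M + 2 * p + 2 by ring, pow_succ]
    calc sechMass M ≤ 2 ^ p * sechMass (M + 2 * p) := ih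
      _ ≤ 2 ^ p * (2 * sechMass (M + 2 * p + 2)) := by gcongr
      _ = _ := by ring

/-- Iterate the recurrence: each further sinh² costs (2k+1)/(M-2k-2), and the lower bound on M keeps
that denominator at least M/2. -/
theorem integral_sinh_pow_mul_sech_pow_le (k : ℕ) : ∃ C : ℝ, 0 ≤ C ∧ ∀ M : ℕ, 4 * k + 4 ≤ M →
    ∫ x, Real.sinh x ^ (2 * k) * (1 / Real.cosh x) ^ M ≤ C / M ^ k * sechMass M := by
  induction k with
  | zero => exact ⟨1, zero_le_one, fun M _ => by simp [sechMass]⟩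
  | succ k ih =>
    obtain ⟨C, hC0, hC⟩ := ih
    refine ⟨2 * (2 * k + 1) * C, by positivity, fun M hM => ?_⟩
    have h1 := integral_sinh_pow_add_two_mul_sech_pow (k := 2 * k) (M := M) (by omega)
    have h2 := hC M (by omega)
    have hM' : (4 * k + 8 : ℝ) ≤ M := by exact_mod_cast (by omega : 4 * k + 8 ≤ M)
    have hk : (0 : ℝ) ≤ k := Nat.cast_nonneg k
    have hpos : (0 : ℝ) < M := by linarith
    have hden : (M : ℝ) / 2 ≤ M - 2 * k - 2 := by linarith
    set I := ∫ x, Real.sinh x ^ (2 * (k + 1)) * (1 / Real.cosh x) ^ M with hI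
    have hI0 : 0 ≤ I := integral_nonneg fun x => by
      have := (sech_pos x).le
      simp only [Pi.zero_apply, pow_mul]
      positivity
    push_cast at h1
    rw [show 2 * k + 2 = 2 * (k + 1) by ring, ← hI] at h1
    have h3 : (M : ℝ) / 2 * I ≤ (2 * k + 1) * (C / M ^ k * sechMass M) := by
      calc (M : ℝ) / 2 * I ≤ (M - 2 * k - 2) * I := by gcongr
        _ = _ := h1
        _ ≤ _ := by gcongr
    have h4 : 2 * (2 * (k : ℝ) + 1) * C / M ^ (k + 1) * sechMass M =
        2 / M * ((2 * k + 1) * (C / M ^ k * sechMass M)) := by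
      rw [pow_succ]
      field_simp
    rw [h4]
    calc I = 2 / M * (M / 2 * I) := by field_simp
      _ ≤ _ := by gcongr

/-! ### Error terms measured by sinh, and means under sech^M. -/

section

open Filter Asymptotics

/-- `f` is continuous, of size `O(|sinh x| ^ m)` at the origin and of exponential growth. -/
def SinhBound (m : ℕ) (f : ℝ → ℝ) : Prop :=
  Continuous f ∧ ∃ (p : ℕ) (C : ℝ), 0 ≤ C ∧ ∀ x, |f x| ≤ C * |Real.sinh x| ^ m * Real.cosh x ^ p

theorem abs_sinh_le_cosh (x : ℝ) : |Real.sinh x| ≤ Real.cosh x := by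
  rw [Real.abs_sinh, ← Real.cosh_abs]
  exact (Real.sinh_lt_cosh _).le

namespace SinhBound

variable {f g : ℝ → ℝ} {k m : ℕ}

theorem of_abs_le_pow (hf : Continuous f) {C : ℝ} (hC : 0 ≤ C)
    (h : ∀ x, |f x| ≤ C * |Real.sinh x| ^ m) : SinhBound m f :=
  ⟨hf, 0, C, hC, fun x => by simpa using h x⟩

theorem of_bounded (hf : Continuous f) {C : ℝ} (h : ∀ x, |f x| ≤ C) : SinhBound 0 f :=
  of_abs_le_pow hf ((abs_nonneg _).trans (h 0)) fun x => by simpa using h x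

theorem const (c : ℝ) : SinhBound 0 fun _ => c := of_bounded continuous_const fun _ => le_refl |c|

theorem id : SinhBound 1 fun x => x :=
  of_abs_le_pow continuous_id zero_le_one fun x => by simpa using abs_le_abs_sinh x

theorem tanh : SinhBound 1 fun x => Real.tanh x :=
  of_abs_le_pow continuous_tanh zero_le_one fun x => by simpa using abs_tanh_le_abs_sinh x

theorem mono (hf : SinhBound m f) (h : k ≤ m) : SinhBound k f := by
  obtain ⟨hc, p, C, hC, hb⟩ := hf
  refine ⟨hc, m - k + p, C, hC, fun x => (hb x).trans ?_⟩
  have h1 := abs_sinh_le_cosh x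
  have h2 := Real.cosh_pos x
  obtain ⟨j, rfl⟩ := Nat.exists_eq_add_of_le h
  rw [Nat.add_sub_cancel_left, pow_add, pow_add]
  calc C * (|Real.sinh x| ^ k * |Real.sinh x| ^ j) * Real.cosh x ^ p
      ≤ C * (|Real.sinh x| ^ k * Real.cosh x ^ j) * Real.cosh x ^ p := by gcongr
    _ = _ := by ring

theorem mul (hf : SinhBound k f) (hg : SinhBound m g) : SinhBound (k + m) fun x => f x * g x := by
  obtain ⟨hc, p, C, hC, hb⟩ := hf
  obtain ⟨hc', p', C', hC', hb'⟩ := hg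
  refine ⟨hc.mul hc', p + p', C * C', mul_nonneg hC hC', fun x => ?_⟩
  have h2 := Real.cosh_pos x
  rw [abs_mul, pow_add, pow_add]
  calc |f x| * |g x| ≤ (C * |Real.sinh x| ^ k * Real.cosh x ^ p) *
        (C' * |Real.sinh x| ^ m * Real.cosh x ^ p') := by gcongr <;> solve_by_elim
    _ = _ := by ring

theorem add (hf : SinhBound m f) (hg : SinhBound m g) : SinhBound m fun x => f x + g x := by
  obtain ⟨hc, p, C, hC, hb⟩ := hf
  obtain ⟨hc', p', C', hC', hb'⟩ := hg
  refine ⟨hc.add hc', p + p', C + C', add_nonneg hC hC', fun x => ?_⟩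
  have h1 := Real.one_le_cosh x
  have h2 := Real.cosh_pos x
  have h3 : Real.cosh x ^ p ≤ Real.cosh x ^ (p + p') := pow_le_pow_right₀ h1 (by omega)
  have h4 : Real.cosh x ^ p' ≤ Real.cosh x ^ (p + p') := pow_le_pow_right₀ h1 (by omega)
  calc |f x + g x| ≤ |f x| + |g x| := abs_add_le _ _
    _ ≤ C * |Real.sinh x| ^ m * Real.cosh x ^ p + C' * |Real.sinh x| ^ m * Real.cosh x ^ p' :=
      add_le_add (hb x) (hb' x)
    _ ≤ C * |Real.sinh x| ^ m * Real.cosh x ^ (p + p') +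
        C' * |Real.sinh x| ^ m * Real.cosh x ^ (p + p') := by gcongr
    _ = _ := by ring

theorem const_mul (c : ℝ) (hf : SinhBound m f) : SinhBound m fun x => c * f x := by
  simpa using (const c).mul hf

theorem sub (hf : SinhBound m f) (hg : SinhBound m g) : SinhBound m fun x => f x - g x := by
  simpa [sub_eq_add_neg] using hf.add (hg.const_mul (-1))

theorem pow (hf : SinhBound m f) (j : ℕ) : SinhBound (m * j) fun x => f x ^ j := by
  induction j with
  | zero => simpa using const 1
  | succ j ih => simpa [pow_succ, mul_add] using ih.mul hf

theorem tanh_pow (j : ℕ) : SinhBound j fun x => Real.tanh x ^ j := by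
  simpa using tanh.pow j

theorem id_pow (j : ℕ) : SinhBound j fun x => x ^ j := by
  simpa using id.pow j

theorem congr (hf : SinhBound m f) (h : ∀ x, g x = f x) : SinhBound m g := by
  rwa [funext h]

theorem integrable (hf : SinhBound m f) :
    ∀ᶠ M : ℕ in atTop, Integrable fun x => f x * (1 / Real.cosh x) ^ M := by
  obtain ⟨hc, p, C, _, hb⟩ := hf
  filter_upwards [eventually_ge_atTop (m + p + 2)] with M hM
  exact integrable_mul_sech_pow hM hc hb

end SinhBound

/-- The mean of `f` with respect to the probability density proportional to `sech ^ M`. -/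
noncomputable def sechMean (M : ℕ) (f : ℝ → ℝ) : ℝ :=
  (∫ x, f x * (1 / Real.cosh x) ^ M) / sechMass M

/-- The exponential growth cosh^p is absorbed by lowering the exponent of sech by 2p (an even shift,
as `sechMass_le_two_pow` requires). What remains is the mean of sinh^(2k), which is O(M⁻ᵏ). -/
theorem SinhBound.isBigO_sechMean {k : ℕ} {f : ℝ → ℝ} (hf : SinhBound (2 * k) f) :
    (fun M : ℕ => sechMean M f) =O[atTop] fun M : ℕ => ((M : ℝ)⁻¹) ^ k := by
  obtain ⟨hc, p, C, hC, hb⟩ := hf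
  obtain ⟨D, hD, hD'⟩ := integral_sinh_pow_mul_sech_pow_le k
  refine IsBigO.of_bound (C * D * 2 ^ k * 2 ^ p) ?_
  filter_upwards [eventually_ge_atTop (4 * k + 4 * p + 4)] with M hM
  have hA : 0 < sechMass M := sechMass_pos (by omega)
  have hA' : 0 < sechMass (M - 2 * p) := sechMass_pos (by omega)
  have hM0 : (0 : ℝ) < M := by exact_mod_cast (by omega : 0 < M)
  have hbound : ∀ x, ‖f x * (1 / Real.cosh x) ^ M‖ ≤
      C * (Real.sinh x ^ (2 * k) * (1 / Real.cosh x) ^ (M - 2 * p)) := by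
    intro x
    have h1 := Real.one_le_cosh x
    have h2 := Real.cosh_pos x
    have h3 := sech_pos x
    have h4 : |Real.sinh x| ^ (2 * k) = Real.sinh x ^ (2 * k) := by
      rw [pow_mul, pow_mul, sq_abs]
    have h5 : (1 / Real.cosh x) ^ M =
        (1 / Real.cosh x) ^ (M - 2 * p) * (1 / Real.cosh x) ^ (2 * p) := by
      rw [← pow_add]
      congr 1
      omega
    have h6 : Real.cosh x ^ p ≤ Real.cosh x ^ (2 * p) := pow_le_pow_right₀ h1 (by omega)
    have h7 : 0 ≤ Real.sinh x ^ (2 * k) := by rw [← h4]; positivity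
    rw [norm_mul, Real.norm_eq_abs, Real.norm_eq_abs, abs_of_pos (pow_pos h3 M)]
    calc |f x| * (1 / Real.cosh x) ^ M
        ≤ C * |Real.sinh x| ^ (2 * k) * Real.cosh x ^ (2 * p) * (1 / Real.cosh x) ^ M := by
          gcongr
          exact (hb x).trans (by gcongr)
      _ = C * (Real.sinh x ^ (2 * k) * (1 / Real.cosh x) ^ (M - 2 * p)) *
          (Real.cosh x * (1 / Real.cosh x)) ^ (2 * p) := by
          rw [h4, h5, mul_pow]
          ring
      _ = _ := by rw [mul_one_div_cancel h2.ne', one_pow, mul_one]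
  have hI : ‖∫ x, f x * (1 / Real.cosh x) ^ M‖ ≤
      C * (D / ((M - 2 * p : ℕ) : ℝ) ^ k * sechMass (M - 2 * p)) := by
    refine (norm_integral_le_of_norm_le
      ((integrable_sinh_pow_mul_sech_pow (k := 2 * k) (M := M - 2 * p) (by omega)).const_mul C)
      (Eventually.of_forall hbound)).trans ?_
    rw [integral_const_mul]
    gcongr
    exact hD' _ (by omega)
  have hA2 : sechMass (M - 2 * p) ≤ 2 ^ p * sechMass M := by
    have := sechMass_le_two_pow p (M := M - 2 * p) (by omega)
    rwa [show M - 2 * p + 2 * p = M by omega] at this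
  have hM2 : (M : ℝ) / 2 ≤ ((M - 2 * p : ℕ) : ℝ) := by
    rw [Nat.cast_sub (by omega)]
    have : (4 * p : ℝ) ≤ M := by exact_mod_cast (by omega : 4 * p ≤ M)
    push_cast
    linarith
  have hM3 : D / ((M - 2 * p : ℕ) : ℝ) ^ k ≤ D / ((M : ℝ) / 2) ^ k := by gcongr
  rw [sechMean, norm_div, Real.norm_eq_abs (sechMass M), abs_of_pos hA, div_le_iff₀ hA,
    Real.norm_of_nonneg (by positivity : (0 : ℝ) ≤ ((M : ℝ)⁻¹) ^ k)]
  calc _ ≤ C * (D / ((M - 2 * p : ℕ) : ℝ) ^ k * sechMass (M - 2 * p)) := hI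
    _ ≤ C * (D / ((M : ℝ) / 2) ^ k * (2 ^ p * sechMass M)) := by gcongr
    _ = _ := by
      rw [div_pow, inv_pow]
      field_simp

theorem sechMean_add_of_integrable {M : ℕ} {f g : ℝ → ℝ}
    (hf : Integrable fun x => f x * (1 / Real.cosh x) ^ M)
    (hg : Integrable fun x => g x * (1 / Real.cosh x) ^ M) :
    sechMean M (fun x => f x + g x) = sechMean M f + sechMean M g := by
  unfold sechMean
  rw [← add_div, ← integral_add hf hg]
  simp only [add_mul]

theorem sechMean_const_mul (M : ℕ) (c : ℝ) (f : ℝ → ℝ) :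
    sechMean M (fun x => c * f x) = c * sechMean M f := by
  unfold sechMean
  simp only [mul_assoc]
  rw [integral_const_mul, mul_div_assoc]

theorem sechMean_tanh_pow_zero {M : ℕ} (hM : 2 ≤ M) :
    sechMean M (fun x => Real.tanh x ^ 0) = 1 := by
  unfold sechMean
  simp only [pow_zero, one_mul]
  exact div_self (sechMass_pos hM).ne'

theorem sechMean_tanh_pow_one {M : ℕ} (hM : 2 ≤ M) :
    sechMean M (fun x => Real.tanh x ^ 1) = 0 := by
  unfold sechMean
  simp only [pow_one, integral_tanh_mul_sech_pow hM, zero_div]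

theorem sechMean_tanh_pow_add_two (k : ℕ) {M : ℕ} (hM : 2 ≤ M) :
    sechMean M (fun x => Real.tanh x ^ (k + 2)) =
      (k + 1) / (M + k + 1) * sechMean M (fun x => Real.tanh x ^ k) := by
  have h := integral_tanh_pow_add_two_mul_sech_pow k hM
  have hA := sechMass_pos hM
  unfold sechMean
  have : (0 : ℝ) < M + k + 1 := by positivity
  field_simp
  linarith

theorem sechMean_tanh_pow_odd (k : ℕ) {M : ℕ} (hM : 2 ≤ M) :
    sechMean M (fun x => Real.tanh x ^ (2 * k + 1)) = 0 := by
  induction k with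
  | zero => exact sechMean_tanh_pow_one hM
  | succ k ih =>
    rw [show 2 * (k + 1) + 1 = 2 * k + 1 + 2 by ring, sechMean_tanh_pow_add_two _ hM, ih, mul_zero]

/-! Expansions in powers of `tanh x`. -/

/-- On the half-line f and g - f both increase from 0; parity gives the other half. The elementary
Taylor bounds for tanh and log cosh are instances. -/
theorem abs_le_of_deriv_le {f g f' g' : ℝ → ℝ} (hf : ∀ x, HasDerivAt f (f' x) x)
    (hg : ∀ x, HasDerivAt g (g' x) x) (hf0 : f 0 = 0) (hg0 : g 0 = 0)
    (hf' : ∀ x, 0 ≤ x → 0 ≤ f' x) (hfg : ∀ x, 0 ≤ x → f' x ≤ g' x)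
    (hfo : ∀ x, |f (-x)| = |f x|) (hgo : ∀ x, |g (-x)| = |g x|) (x : ℝ) : |f x| ≤ |g x| := by
  have key : ∀ x, 0 ≤ x → |f x| ≤ |g x| := by
    intro x hx
    have h1 : MonotoneOn f (Set.Ici 0) := monotoneOn_of_deriv_nonneg (convex_Ici 0)
      (fun y _ => (hf y).continuousAt.continuousWithinAt)
      (fun y _ => (hf y).differentiableAt.differentiableWithinAt)
      (fun y hy => by
        rw [interior_Ici] at hy
        rw [(hf y).deriv]
        exact hf' y (le_of_lt hy))
    have h2 : MonotoneOn (fun y => g y - f y) (Set.Ici 0) :=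
      monotoneOn_of_deriv_nonneg (convex_Ici 0)
      (fun y _ => ((hg y).sub (hf y)).continuousAt.continuousWithinAt)
      (fun y _ => ((hg y).sub (hf y)).differentiableAt.differentiableWithinAt)
      (fun y hy => by
        rw [interior_Ici] at hy
        have := ((hg y).sub (hf y)).deriv
        rw [show (fun y => g y - f y) = g - f from rfl, this]
        exact sub_nonneg.2 (hfg y (le_of_lt hy)))
    have h3 := h1 (Set.mem_Ici.2 le_rfl) (Set.mem_Ici.2 hx) hx
    have h4 := h2 (Set.mem_Ici.2 le_rfl) (Set.mem_Ici.2 hx) hx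
    simp only [hf0, hg0, sub_zero] at h3 h4
    rw [abs_of_nonneg h3, abs_of_nonneg (by linarith)]
    linarith
  rcases le_total 0 x with hx | hx
  · exact key x hx
  · rw [← hfo, ← hgo]
    exact key (-x) (by linarith)

theorem SinhBound.id_sub_tanh : SinhBound 3 fun x => x - Real.tanh x := by
  refine of_abs_le_pow (continuous_id.sub continuous_tanh) zero_le_one fun x => ?_
  rw [one_mul, ← abs_pow]
  refine abs_le_of_deriv_le (f' := fun x => Real.tanh x ^ 2)
    (g' := fun x => 3 * Real.sinh x ^ 2 * Real.cosh x) (f := fun x => x - Real.tanh x)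
    (g := fun x => Real.sinh x ^ 3)
    (fun x => ((hasDerivAt_id x).sub (hasDerivAt_tanh x)).congr_deriv (by ring))
    (fun x => ((Real.hasDerivAt_sinh x).pow 3).congr_deriv (by norm_num)) (by simp) (by simp)
    (fun x _ => sq_nonneg _) (fun x _ => ?_) (fun x => ?_) (fun x => ?_) x
  · have h1 := sq_le_sq.2 (abs_tanh_le_abs_sinh x)
    have h2 := Real.one_le_cosh x
    nlinarith [sq_nonneg (Real.sinh x)]
  · rw [Real.tanh_neg, ← abs_neg]
    ring_nf
  · rw [Real.sinh_neg, ← abs_neg]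
    ring_nf

theorem SinhBound.id_sub_tanh_sub_cube :
    SinhBound 5 fun x => x - (Real.tanh x + Real.tanh x ^ 3 / 3) := by
  have ht := continuous_tanh
  refine of_abs_le_pow (by fun_prop) zero_le_one fun x => ?_
  rw [one_mul, ← abs_pow]
  refine abs_le_of_deriv_le (f' := fun x => Real.tanh x ^ 4)
    (g' := fun x => 5 * Real.sinh x ^ 4 * Real.cosh x)
    (f := fun x => x - (Real.tanh x + Real.tanh x ^ 3 / 3))
    (g := fun x => Real.sinh x ^ 5)
    (fun x => ((hasDerivAt_id x).sub ((hasDerivAt_tanh x).add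
      (((hasDerivAt_tanh x).pow 3).div_const 3))).congr_deriv (by push_cast; ring))
    (fun x => ((Real.hasDerivAt_sinh x).pow 5).congr_deriv (by norm_num)) (by simp) (by simp)
    (fun x _ => by positivity) (fun x _ => ?_) (fun x => ?_) (fun x => ?_) x
  · have h1 := sq_le_sq.2 (abs_tanh_le_abs_sinh x)
    have h2 := Real.one_le_cosh x
    have h3 : Real.tanh x ^ 4 ≤ Real.sinh x ^ 4 := by
      calc Real.tanh x ^ 4 = (Real.tanh x ^ 2) ^ 2 := by ring
        _ ≤ (Real.sinh x ^ 2) ^ 2 := by gcongr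
        _ = _ := by ring
    have h4 : 0 ≤ Real.sinh x ^ 4 := by positivity
    nlinarith
  · rw [Real.tanh_neg, ← abs_neg]
    ring_nf
  · rw [Real.sinh_neg, ← abs_neg]
    ring_nf

theorem SinhBound.id_pow_sub (k : ℕ) : SinhBound (k + 2) fun x => x ^ k - Real.tanh x ^ k := by
  induction k with
  | zero => exact ((const 0).mul (tanh_pow 2)).mono (by omega) |>.congr fun x => by simp
  | succ k ih =>
    have h1 := id.mul ih
    have h2 := id_sub_tanh.mul (tanh_pow k)
    exact ((h1.mono (by omega)).add (h2.mono (by omega : k + 1 + 2 ≤ _))).congr fun x => by ring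

/-- The coefficient k/3 is that of t^(k+2) in (t + t³/3)^k, as artanh t = t + t³/3 + O(t⁵). -/
theorem SinhBound.id_pow_sub_sub (k : ℕ) :
    SinhBound (k + 4) fun x => x ^ k - (Real.tanh x ^ k + k / 3 * Real.tanh x ^ (k + 2)) := by
  induction k with
  | zero => exact ((const 0).mul (tanh_pow 4)).mono (by omega) |>.congr fun x => by simp
  | succ k ih =>
    have h1 := id.mul ih
    have h2 := id_sub_tanh_sub_cube.mul (tanh_pow k)
    have h3 := (id_sub_tanh.mul (tanh_pow (k + 2))).const_mul (k / 3 : ℝ)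
    exact (((h1.mono (by omega)).add (h2.mono (by omega : k + 1 + 4 ≤ _))).add
      (h3.mono (by omega))).congr fun x => by push_cast; ring

/-- Rationalise: the square of the cubic Taylor polynomial exceeds 1 + s by s⁴ times a bounded
factor, and the polynomial stays above 3/10, which keeps the conjugate away from 0. -/
theorem abs_sqrt_one_add_sub_le {s : ℝ} (hs : |s| < 1) :
    |√(1 + s) - (1 + s / 2 - s ^ 2 / 8 + s ^ 3 / 16)| ≤ |s| ^ 4 := by
  obtain ⟨h1, h2⟩ := abs_lt.1 hs
  set p := 1 + s / 2 - s ^ 2 / 8 + s ^ 3 / 16 with hp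
  have hp0 : 3 / 10 ≤ p := by
    rw [hp]
    nlinarith [sq_nonneg s, sq_nonneg (s + 1), mul_nonneg (sq_nonneg s) (by linarith : 0 ≤ 1 + s)]
  have hq := Real.sqrt_nonneg (1 + s)
  have hq2 : √(1 + s) ^ 2 = 1 + s := Real.sq_sqrt (by linarith)
  have hpp : p ^ 2 - (1 + s) = s ^ 4 * (5 / 64 - s / 64 + s ^ 2 / 256) := by
    rw [hp]
    ring
  have h3 : (√(1 + s) - p) * (√(1 + s) + p) = -(s ^ 4 * (5 / 64 - s / 64 + s ^ 2 / 256)) := by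
    linear_combination hq2 - hpp
  have h4 : |√(1 + s) - p| * (√(1 + s) + p) = |s| ^ 4 * (5 / 64 - s / 64 + s ^ 2 / 256) := by
    rw [← abs_of_pos (by linarith : 0 < √(1 + s) + p), ← abs_mul, h3, abs_neg, abs_mul, abs_pow,
      abs_of_pos (by nlinarith [sq_nonneg s] : 0 < 5 / 64 - s / 64 + s ^ 2 / 256)]
  have h5 : 5 / 64 - s / 64 + s ^ 2 / 256 ≤ 3 / 10 := by nlinarith
  have h6 : 0 ≤ |s| ^ 4 := by positivity
  nlinarith [abs_nonneg (√(1 + s) - p)]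

/-- The inverse root blows up at s = -1, hence the margin δ; it is applied with δ = 1 - |ρ|. -/
theorem abs_inv_sqrt_one_add_sub_le {s δ : ℝ} (hδ : 0 < δ) (hs : |s| ≤ 1 - δ) :
    |1 / √(1 + s) - (1 - s / 2)| ≤ 2 / δ * |s| ^ 2 := by
  obtain ⟨h1, h2⟩ := abs_le.1 hs
  have h0 : 0 < 1 + s := by linarith
  set h := 1 / √(1 + s) with hh
  have hpos : 0 < h := by rw [hh]; positivity
  have hq2 : h ^ 2 = 1 / (1 + s) := by rw [hh, div_pow, one_pow, Real.sq_sqrt h0.le]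
  have h3 : (h - (1 - s / 2)) * (h + (1 - s / 2)) = s ^ 2 * ((3 - s) / 4) / (1 + s) := by
    have : (h - (1 - s / 2)) * (h + (1 - s / 2)) = h ^ 2 - (1 - s / 2) ^ 2 := by ring
    rw [this, hq2]
    field_simp
    ring
  have hden : 1 / 2 ≤ h + (1 - s / 2) := by linarith
  have h4 : |h - (1 - s / 2)| * (h + (1 - s / 2)) = |s| ^ 2 * ((3 - s) / 4) / (1 + s) := by
    rw [← abs_of_pos (by linarith : 0 < h + (1 - s / 2)), ← abs_mul, h3, abs_div, abs_mul,
      abs_pow, abs_of_pos h0, abs_of_pos (by linarith : 0 < (3 - s) / 4)]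
  have h5 : |s| ^ 2 * ((3 - s) / 4) / (1 + s) ≤ |s| ^ 2 / δ := by
    gcongr
    · nlinarith [sq_nonneg |s|]
    · linarith
  have h6 : |h - (1 - s / 2)| * (1 / 2) ≤ |s| ^ 2 / δ := by
    refine le_trans ?_ (h4.le.trans h5)
    gcongr
  calc |h - (1 - s / 2)| = 2 * (|h - (1 - s / 2)| * (1 / 2)) := by ring
    _ ≤ 2 * (|s| ^ 2 / δ) := by gcongr
    _ = _ := by ring

theorem abs_mul_tanh_le {ρ : ℝ} (x : ℝ) : |ρ * Real.tanh x| ≤ |ρ| := by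
  rw [abs_mul]
  exact mul_le_of_le_one_right (abs_nonneg _) (Real.abs_tanh_lt_one x).le

theorem continuous_sqrt_one_add_mul_tanh (ρ : ℝ) :
    Continuous fun x => √(1 + ρ * Real.tanh x) := by
  have := continuous_tanh
  fun_prop

theorem continuous_inv_sqrt_one_add_mul_tanh {ρ : ℝ} (hρ : ρ ∈ Set.Ioo (-1 : ℝ) 1) :
    Continuous fun x => 1 / √(1 + ρ * Real.tanh x) :=
  continuous_const.div (continuous_sqrt_one_add_mul_tanh ρ) fun x =>
    (Real.sqrt_pos.2 (one_add_mul_tanh_pos hρ x)).ne'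

theorem SinhBound.sqrt_one_add_mul_tanh {ρ : ℝ} (hρ : ρ ∈ Set.Ioo (-1 : ℝ) 1) :
    SinhBound 4 fun x => √(1 + ρ * Real.tanh x) -
      (1 + ρ * Real.tanh x / 2 - (ρ * Real.tanh x) ^ 2 / 8 + (ρ * Real.tanh x) ^ 3 / 16) := by
  have hρ' : |ρ| < 1 := abs_lt.2 hρ
  have h0 := continuous_sqrt_one_add_mul_tanh ρ
  have h1 := continuous_tanh
  refine of_abs_le_pow (by fun_prop) zero_le_one fun x => ?_
  refine (abs_sqrt_one_add_sub_le ((abs_mul_tanh_le x).trans_lt hρ')).trans ?_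
  rw [one_mul, abs_mul]
  gcongr
  calc |ρ| * |Real.tanh x| ≤ 1 * |Real.sinh x| :=
        mul_le_mul hρ'.le (abs_tanh_le_abs_sinh x) (abs_nonneg _) zero_le_one
    _ = _ := one_mul _

theorem SinhBound.inv_sqrt_one_add_mul_tanh {ρ : ℝ} (hρ : ρ ∈ Set.Ioo (-1 : ℝ) 1) :
    SinhBound 2 fun x => 1 / √(1 + ρ * Real.tanh x) - (1 - ρ * Real.tanh x / 2) := by
  have hρ' : |ρ| < 1 := abs_lt.2 hρ
  have h0 := continuous_inv_sqrt_one_add_mul_tanh hρ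
  have h1 := continuous_tanh
  have hδ : 0 < 1 - |ρ| := by linarith
  refine of_abs_le_pow (by fun_prop) (by positivity : 0 ≤ 2 / (1 - |ρ|)) fun x => ?_
  refine (abs_inv_sqrt_one_add_sub_le hδ ((abs_mul_tanh_le x).trans (by linarith))).trans ?_
  rw [abs_mul]
  gcongr
  calc |ρ| * |Real.tanh x| ≤ 1 * |Real.sinh x| :=
        mul_le_mul hρ'.le (abs_tanh_le_abs_sinh x) (abs_nonneg _) zero_le_one
    _ = _ := one_mul _

/-- Multiply t^k + (k/3) t^(k+2) by the cubic Taylor polynomial of √(1 + ρ t) and drop the terms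
t^(k+4) and t^(k+5). -/
theorem SinhBound.id_pow_mul_sqrt {ρ : ℝ} (hρ : ρ ∈ Set.Ioo (-1 : ℝ) 1) (k : ℕ) :
    SinhBound (k + 4) fun x => x ^ k * √(1 + ρ * Real.tanh x) -
      (Real.tanh x ^ k + ρ / 2 * Real.tanh x ^ (k + 1) +
        (k / 3 - ρ ^ 2 / 8) * Real.tanh x ^ (k + 2) +
        (ρ ^ 3 / 16 + k * ρ / 6) * Real.tanh x ^ (k + 3)) := by
  have h1 := (sqrt_one_add_mul_tanh hρ).mul (id_pow k)
  have hp : SinhBound 0 fun x => 1 + ρ * Real.tanh x / 2 - (ρ * Real.tanh x) ^ 2 / 8 +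
      (ρ * Real.tanh x) ^ 3 / 16 := by
    have a := (const 1).add ((tanh.const_mul (ρ / 2)).mono (by omega))
    have b := a.sub (((tanh_pow 2).const_mul (ρ ^ 2 / 8)).mono (by omega))
    exact (b.add (((tanh_pow 3).const_mul (ρ ^ 3 / 16)).mono (by omega))).congr fun x => by ring
  have h2 := (id_pow_sub_sub k).mul hp
  have h3 := (tanh_pow (k + 4)).const_mul (-(k * ρ ^ 2 / 24 : ℝ))
  have h4 := (tanh_pow (k + 5)).const_mul (k * ρ ^ 3 / 48 : ℝ)
  exact ((((h1.mono (by omega : k + 4 ≤ _)).add h2).add h3).add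
    (h4.mono (by omega))).congr fun x => by ring

theorem SinhBound.id_pow_mul_inv_sqrt {ρ : ℝ} (hρ : ρ ∈ Set.Ioo (-1 : ℝ) 1) (k : ℕ) :
    SinhBound (k + 2) fun x => x ^ k * (1 / √(1 + ρ * Real.tanh x)) -
      (Real.tanh x ^ k - ρ / 2 * Real.tanh x ^ (k + 1)) := by
  have h1 := (inv_sqrt_one_add_mul_tanh hρ).mul (id_pow k)
  have hp : SinhBound 0 fun x => 1 - ρ * Real.tanh x / 2 :=
    ((const 1).sub ((tanh.const_mul (ρ / 2)).mono (by omega))).congr fun x => by ring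
  have h2 := (id_pow_sub k).mul hp
  exact ((h1.mono (by omega : k + 2 ≤ _)).add h2).congr fun x => by ring

/-! ### Expansion of the weight for large M. -/

theorem inv_sqrt_one_add_bounds {y : ℝ} (hy : 0 ≤ y) :
    |1 / √(1 + y) - (1 - y / 2)| ≤ y ^ 2 := by
  have ha : 1 ≤ √(1 + y) := Real.one_le_sqrt.2 (by linarith)
  have ha2 : √(1 + y) ^ 2 = 1 + y := Real.sq_sqrt (by linarith)
  set a := √(1 + y)
  have hy' : y = a ^ 2 - 1 := by linarith
  have h1 : 1 / a - (1 - y / 2) = (a - 1) ^ 2 * ((a + 2) / (2 * a)) := by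
    rw [hy']
    field_simp
    ring
  have h2 : (a + 2) / (2 * a) ≤ (a + 1) ^ 2 := by
    rw [div_le_iff₀ (by linarith)]
    nlinarith [sq_nonneg a, mul_nonneg (sub_nonneg.2 ha) (sub_nonneg.2 ha),
      mul_nonneg (mul_nonneg (sub_nonneg.2 ha) (sub_nonneg.2 ha)) (sub_nonneg.2 ha)]
  have h3 : 0 ≤ (a + 2) / (2 * a) := by positivity
  rw [h1, abs_of_nonneg (by positivity), hy']
  calc (a - 1) ^ 2 * ((a + 2) / (2 * a)) ≤ (a - 1) ^ 2 * (a + 1) ^ 2 := by gcongr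
    _ = _ := by ring

/-- Expand 1/√(1 + q sinh²) to first order. Under sech^(2M+1) the mean of sinh² is 1/(2M-1), giving
the term -q/(4M), and that of sinh⁴ is 3/((2M-1)(2M-3)), controlling the error. -/
theorem abs_sechIntegral_div_sub_le {M : ℕ} (hM : 3 ≤ M) {q : ℝ} (hq : 0 ≤ q) (hq1 : q ≤ 1) :
    |sechIntegral M q / sechMass (2 * M + 1) - (1 - q / (4 * M))| ≤ 4 / (M : ℝ) ^ 2 := by
  have hA := sechMass_pos (M := 2 * M + 1) (by omega)
  have hM' : (3 : ℝ) ≤ M := by exact_mod_cast hM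
  set A := sechMass (2 * M + 1) with hAdef
  have i0 := integrable_sech_pow (k := 2 * M + 1) (by omega)
  have i2 := integrable_sinh_pow_mul_sech_pow (k := 2) (M := 2 * M + 1) (by omega)
  have i4 := integrable_sinh_pow_mul_sech_pow (k := 4) (M := 2 * M + 1) (by omega)
  have iJ := integrable_sechIntegrand (M := M) (by omega) hq
  have h2 := integral_sinh_pow_add_two_mul_sech_pow (k := 0) (M := 2 * M + 1) (by omega)
  have h4 := integral_sinh_pow_add_two_mul_sech_pow (k := 2) (M := 2 * M + 1) (by omega)
  simp only [pow_zero, one_mul, zero_add, Nat.reduceAdd] at h2 h4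
  push_cast at h2 h4
  set I2 := ∫ x, Real.sinh x ^ 2 * (1 / Real.cosh x) ^ (2 * M + 1) with hI2
  set I4 := ∫ x, Real.sinh x ^ 4 * (1 / Real.cosh x) ^ (2 * M + 1) with hI4
  have hI2' : I2 = A / (2 * M - 1) := by
    rw [eq_div_iff (by linarith), hAdef, sechMass]
    linarith
  have hI4' : I4 = 3 * A / ((2 * M - 1) * (2 * M - 3)) := by
    rw [eq_div_iff (by nlinarith)]
    rw [hI2', mul_div_assoc', eq_div_iff (by linarith)] at h4
    linarith
  have hmain : |sechIntegral M q - (A - q / 2 * I2)| ≤ q ^ 2 * I4 := by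
    have e1 : sechIntegral M q - (A - q / 2 * I2) =
        ∫ x, (1 / Real.cosh x) ^ (2 * M + 1) *
          (1 / √(1 + q * Real.sinh x ^ 2) - (1 - q * Real.sinh x ^ 2 / 2)) := by
      have i02 : Integrable fun x => (1 / Real.cosh x) ^ (2 * M + 1) -
          q / 2 * (Real.sinh x ^ 2 * (1 / Real.cosh x) ^ (2 * M + 1)) := i0.sub (i2.const_mul _)
      rw [sechIntegral, hAdef, sechMass, hI2, ← integral_const_mul,
        ← integral_sub i0 (i2.const_mul _), ← integral_sub iJ i02]
      refine integral_congr_ae (Eventually.of_forall fun x => ?_)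
      ring
    rw [e1, hI4, ← integral_const_mul, ← Real.norm_eq_abs]
    refine norm_integral_le_of_norm_le (i4.const_mul _) (Eventually.of_forall fun x => ?_)
    have h3 := pow_pos (sech_pos x) (2 * M + 1)
    rw [norm_mul, Real.norm_of_nonneg h3.le, Real.norm_eq_abs]
    have := inv_sqrt_one_add_bounds (y := q * Real.sinh x ^ 2) (by positivity)
    calc _ ≤ (1 / Real.cosh x) ^ (2 * M + 1) * (q * Real.sinh x ^ 2) ^ 2 := by gcongr
      _ = _ := by ring
  have e2 : sechIntegral M q / A - (1 - q / (4 * M)) =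
      (sechIntegral M q - (A - q / 2 * I2)) / A - q / (4 * M * (2 * M - 1)) := by
    rw [hI2']
    obtain ⟨d, hd⟩ : ∃ d : ℝ, d = 2 * M - 1 := ⟨_, rfl⟩
    have hd0 : d ≠ 0 := by linarith
    have hMd : (M : ℝ) = (d + 1) / 2 := by linarith
    have hd1 : d + 1 ≠ 0 := by linarith
    rw [← hd, hMd]
    field_simp
    ring
  have h5 : |(sechIntegral M q - (A - q / 2 * I2)) / A| ≤ 3 / (M : ℝ) ^ 2 := by
    rw [abs_div, abs_of_pos hA, div_le_iff₀ hA]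
    refine hmain.trans ?_
    rw [hI4']
    have h6 : 3 * A / ((2 * M - 1) * (2 * M - 3)) ≤ 3 * A / (M : ℝ) ^ 2 := by
      gcongr
      nlinarith
    calc q ^ 2 * (3 * A / ((2 * M - 1) * (2 * M - 3))) ≤ 1 * (3 * A / (M : ℝ) ^ 2) := by
          gcongr
          · have : 0 < (2 * M - 1 : ℝ) * (2 * M - 3) := by nlinarith
            positivity
          · nlinarith
      _ = _ := by ring
  have h7 : |q / (4 * M * (2 * M - 1))| ≤ 1 / (M : ℝ) ^ 2 := by
    have : 0 < 4 * M * (2 * M - 1 : ℝ) := by nlinarith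
    rw [abs_of_nonneg (by positivity)]
    gcongr
    nlinarith
  rw [e2]
  calc _ ≤ _ := abs_sub _ _
    _ ≤ 3 / (M : ℝ) ^ 2 + 1 / (M : ℝ) ^ 2 := add_le_add h5 h7
    _ = _ := by ring

/-- Insert q = (1 - ρ²)/(2g), g = 1 + ρ tanh x, into the expansion of the inner integral. The error
keeps the factor sech^M, which makes it usable both in integrals and pointwise. -/
theorem abs_fisherWeight_div_sub_le {ρ : ℝ} (hρ : ρ ∈ Set.Ioo (-1 : ℝ) 1) {M : ℕ} (hM : 3 ≤ M)
    (x : ℝ) :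
    |fisherWeight ρ M x / sechMass (2 * M + 1) - (1 / Real.cosh x) ^ M *
      (√(1 + ρ * Real.tanh x) - (1 - ρ ^ 2) / 8 * (M : ℝ)⁻¹ * (1 / √(1 + ρ * Real.tanh x)))| ≤
      8 * ((M : ℝ)⁻¹) ^ 2 * (1 / Real.cosh x) ^ M := by
  have hρ2 : 0 < 1 - ρ ^ 2 := by nlinarith [hρ.1, hρ.2]
  have hg := one_add_mul_tanh_pos hρ x
  have hM' : (3 : ℝ) ≤ M := by exact_mod_cast hM
  have hσ := pow_pos (sech_pos x) M
  have ht := abs_lt.1 (Real.abs_tanh_lt_one x)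
  have hg2 : 1 + ρ * Real.tanh x ≤ 2 := by
    nlinarith [mul_pos (by linarith [hρ.1] : 0 < 1 + ρ) (by linarith : 0 < 1 - Real.tanh x),
      mul_pos (by linarith [hρ.2] : 0 < 1 - ρ) (by linarith : 0 < 1 + Real.tanh x)]
  -- The point is 1 - ρ² ≤ 2 (1 - |ρ|) ≤ 2 (1 + ρ tanh x).
  have hqle : (1 - ρ ^ 2) / (2 * (1 + ρ * Real.tanh x)) ≤ 1 := by
    rw [div_le_one (by positivity)]
    nlinarith [mul_pos (by linarith [hρ.1] : 0 < 1 + ρ) (by linarith : 0 < 1 - Real.tanh x),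
      mul_pos (by linarith [hρ.2] : 0 < 1 - ρ) (by linarith : 0 < 1 + Real.tanh x),
      sq_nonneg (ρ + Real.tanh x), sq_nonneg (1 + ρ), sq_nonneg (1 - ρ)]
  have hJ := abs_sechIntegral_div_sub_le hM (q := (1 - ρ ^ 2) / (2 * (1 + ρ * Real.tanh x)))
    (by positivity) hqle
  have hs0 : 0 < √(1 + ρ * Real.tanh x) := Real.sqrt_pos.2 hg
  have hs2 : √(1 + ρ * Real.tanh x) ≤ 2 := by
    rw [Real.sqrt_le_left (by norm_num)]
    linarith
  have hss : √(1 + ρ * Real.tanh x) ^ 2 = 1 + ρ * Real.tanh x := Real.sq_sqrt hg.le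
  unfold fisherWeight
  rw [← hss] at hJ
  rw [← hss, Real.sqrt_sq hs0.le]
  set s := √(1 + ρ * Real.tanh x)
  have e : (1 / Real.cosh x) ^ M * s * sechIntegral M ((1 - ρ ^ 2) / (2 * s ^ 2)) /
        sechMass (2 * M + 1) - (1 / Real.cosh x) ^ M *
        (s - (1 - ρ ^ 2) / 8 * (M : ℝ)⁻¹ * (1 / s)) =
      (1 / Real.cosh x) ^ M * s * (sechIntegral M ((1 - ρ ^ 2) / (2 * s ^ 2)) /
        sechMass (2 * M + 1) - (1 - (1 - ρ ^ 2) / (2 * s ^ 2) / (4 * M))) := by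
    field_simp
    ring
  rw [e, abs_mul, abs_of_pos (by positivity)]
  calc _ ≤ (1 / Real.cosh x) ^ M * 2 * (4 / (M : ℝ) ^ 2) := by gcongr
    _ = _ := by
      field_simp
      ring

/-! ### Moments of the weight. -/

/-- The moments of `fisherWeight`, up to a factor which does not depend on `k`. -/
noncomputable def fisherMoment (ρ : ℝ) (k M : ℕ) : ℝ :=
  (∫ x, x ^ k * fisherWeight ρ M x) / (sechMass (2 * M + 1) * sechMass M)

theorem fisherWeight_nonneg (ρ : ℝ) (M : ℕ) (x : ℝ) : 0 ≤ fisherWeight ρ M x := by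
  have h1 := sech_pos x
  unfold fisherWeight sechIntegral
  refine mul_nonneg (by positivity) (integral_nonneg fun t => ?_)
  have h2 := sech_pos t
  simp only [Pi.zero_apply]
  positivity

theorem fisherWeight_le {ρ : ℝ} (hρ : ρ ∈ Set.Ioo (-1 : ℝ) 1) {M : ℕ} (hM : 3 ≤ M) (x : ℝ) :
    fisherWeight ρ M x ≤ 2 * sechMass (2 * M + 1) * (1 / Real.cosh x) ^ M := by
  have hρ2 : 0 < 1 - ρ ^ 2 := by nlinarith [hρ.1, hρ.2]
  have hg := one_add_mul_tanh_pos hρ x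
  have ht := abs_lt.1 (Real.abs_tanh_lt_one x)
  have hσ := pow_pos (sech_pos x) M
  have hg2 : 1 + ρ * Real.tanh x ≤ 2 := by
    nlinarith [mul_pos (by linarith [hρ.1] : 0 < 1 + ρ) (by linarith : 0 < 1 - Real.tanh x),
      mul_pos (by linarith [hρ.2] : 0 < 1 - ρ) (by linarith : 0 < 1 + Real.tanh x)]
  have hs2 : √(1 + ρ * Real.tanh x) ≤ 2 := by
    rw [Real.sqrt_le_left (by norm_num)]
    linarith
  have hJ : ∀ q : ℝ, 0 ≤ q → sechIntegral M q ≤ sechMass (2 * M + 1) := fun q hq =>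
    integral_mono (integrable_sechIntegrand (by omega) hq) (integrable_sech_pow (by omega))
      fun t => (le_abs_self _).trans (sechIntegrand_le M hq t)
  have hJ0 := sechMass_pos (M := 2 * M + 1) (by omega)
  unfold fisherWeight
  calc _ ≤ (1 / Real.cosh x) ^ M * 2 * sechMass (2 * M + 1) := by
        gcongr
        · unfold sechIntegral
          refine integral_nonneg fun t => ?_
          have h2 := sech_pos t
          simp only [Pi.zero_apply]
          positivity
        · exact hJ _ (by positivity)
    _ = _ := by ring

theorem integrable_mul_fisherWeight {ρ : ℝ} (hρ : ρ ∈ Set.Ioo (-1 : ℝ) 1) {M : ℕ} (hM : 3 ≤ M)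
    {f : ℝ → ℝ} (hf : Continuous f) (hi : Integrable fun x => f x * (1 / Real.cosh x) ^ M) :
    Integrable fun x => f x * fisherWeight ρ M x := by
  refine (hi.norm.const_mul (2 * sechMass (2 * M + 1))).mono'
    (hf.mul (continuous_fisherWeight hρ (by omega))).aestronglyMeasurable
    (Eventually.of_forall fun x => ?_)
  have hσ := pow_pos (sech_pos x) M
  rw [norm_mul, norm_mul, Real.norm_of_nonneg (fisherWeight_nonneg ρ M x),
    Real.norm_of_nonneg hσ.le]
  calc ‖f x‖ * fisherWeight ρ M x ≤ ‖f x‖ * (2 * sechMass (2 * M + 1) * (1 / Real.cosh x) ^ M) := by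
        gcongr
        exact fisherWeight_le hρ hM x
    _ = _ := by ring

theorem SinhBound.abs {m : ℕ} {f : ℝ → ℝ} (hf : SinhBound m f) : SinhBound m fun x => |f x| := by
  obtain ⟨hc, p, C, hC, hb⟩ := hf
  exact ⟨hc.abs, p, C, hC, fun x => by simpa using hb x⟩

theorem SinhBound.sqrt_zero {ρ : ℝ} (hρ : ρ ∈ Set.Ioo (-1 : ℝ) 1) :
    SinhBound 0 fun x => √(1 + ρ * Real.tanh x) := by
  refine of_bounded (C := 2) (continuous_sqrt_one_add_mul_tanh ρ) fun x => ?_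
  have := (abs_lt.1 ((abs_mul_tanh_le (ρ := ρ) x).trans_lt (abs_lt.2 hρ))).2
  rw [abs_of_nonneg (Real.sqrt_nonneg _), Real.sqrt_le_left (by norm_num)]
  linarith

theorem SinhBound.inv_sqrt_zero {ρ : ℝ} (hρ : ρ ∈ Set.Ioo (-1 : ℝ) 1) :
    SinhBound 0 fun x => 1 / √(1 + ρ * Real.tanh x) :=
  (((inv_sqrt_one_add_mul_tanh hρ).mono (by omega)).add
    ((const 1).sub ((tanh.const_mul (ρ / 2)).mono (by omega)))).congr fun x => by ring

/-- The relative error M⁻² of the weight is multiplied by the mean of |x|^k, which is O(M^(-⌊k/2⌋));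
`k / 2` is integer division. -/
theorem fisherMoment_sub_isBigO {ρ : ℝ} (hρ : ρ ∈ Set.Ioo (-1 : ℝ) 1) (k : ℕ) :
    (fun M : ℕ => fisherMoment ρ k M -
      (sechMean M (fun x => x ^ k * √(1 + ρ * Real.tanh x)) - (1 - ρ ^ 2) / 8 * (M : ℝ)⁻¹ *
        sechMean M (fun x => x ^ k * (1 / √(1 + ρ * Real.tanh x))))) =O[atTop]
      fun M : ℕ => ((M : ℝ)⁻¹) ^ (k / 2 + 2) := by
  have hb : SinhBound (2 * (k / 2)) fun x => |x ^ k| :=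
    (SinhBound.id_pow k).abs.mono (by omega)
  have h0 : SinhBound 0 fun x => x ^ k * √(1 + ρ * Real.tanh x) :=
    ((SinhBound.id_pow k).mul (SinhBound.sqrt_zero hρ)).mono (by omega)
  have h1 : SinhBound 0 fun x => x ^ k * (1 / √(1 + ρ * Real.tanh x)) :=
    ((SinhBound.id_pow k).mul (SinhBound.inv_sqrt_zero hρ)).mono (by omega)
  have key : (fun M : ℕ => fisherMoment ρ k M -
      (sechMean M (fun x => x ^ k * √(1 + ρ * Real.tanh x)) - (1 - ρ ^ 2) / 8 * (M : ℝ)⁻¹ *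
        sechMean M (fun x => x ^ k * (1 / √(1 + ρ * Real.tanh x))))) =O[atTop]
      fun M : ℕ => ((M : ℝ)⁻¹) ^ 2 * sechMean M fun x => |x ^ k| := by
    refine IsBigO.of_bound 8 ?_
    filter_upwards [eventually_ge_atTop 3, h0.integrable, h1.integrable, hb.integrable,
      (SinhBound.id_pow k).integrable] with M hM i0 i1 ib ik
    have hA := sechMass_pos (M := M) (by omega)
    have hA' := sechMass_pos (M := 2 * M + 1) (by omega)
    have iw := (integrable_mul_fisherWeight hρ hM (continuous_pow k) ik).div_const
      (sechMass (2 * M + 1))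
    have e : fisherMoment ρ k M -
      (sechMean M (fun x => x ^ k * √(1 + ρ * Real.tanh x)) - (1 - ρ ^ 2) / 8 * (M : ℝ)⁻¹ *
        sechMean M (fun x => x ^ k * (1 / √(1 + ρ * Real.tanh x)))) =
        (∫ x, x ^ k * (fisherWeight ρ M x / sechMass (2 * M + 1) - (1 / Real.cosh x) ^ M *
      (√(1 + ρ * Real.tanh x) - (1 - ρ ^ 2) / 8 * (M : ℝ)⁻¹ * (1 / √(1 + ρ * Real.tanh x))))) /
          sechMass M := by
      have e' : (∫ x, x ^ k * (fisherWeight ρ M x / sechMass (2 * M + 1) - (1 / Real.cosh x) ^ M *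
          (√(1 + ρ * Real.tanh x) - (1 - ρ ^ 2) / 8 * (M : ℝ)⁻¹ *
            (1 / √(1 + ρ * Real.tanh x))))) =
          (∫ x, x ^ k * fisherWeight ρ M x) / sechMass (2 * M + 1) -
          ((∫ x, x ^ k * √(1 + ρ * Real.tanh x) * (1 / Real.cosh x) ^ M) -
            (1 - ρ ^ 2) / 8 * (M : ℝ)⁻¹ *
            ∫ x, x ^ k * (1 / √(1 + ρ * Real.tanh x)) * (1 / Real.cosh x) ^ M) := by
        have i01 : Integrable fun x => x ^ k * √(1 + ρ * Real.tanh x) * (1 / Real.cosh x) ^ M -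
            (1 - ρ ^ 2) / 8 * (M : ℝ)⁻¹ *
            (x ^ k * (1 / √(1 + ρ * Real.tanh x)) * (1 / Real.cosh x) ^ M) :=
          i0.sub (i1.const_mul _)
        rw [← integral_const_mul, ← integral_div, ← integral_sub i0 (i1.const_mul _),
          ← integral_sub iw i01]
        refine integral_congr_ae (Eventually.of_forall fun x => ?_)
        ring
      rw [e']
      unfold fisherMoment sechMean
      field_simp
    rw [e, norm_div, Real.norm_of_nonneg hA.le, div_le_iff₀ hA]
    have hm0 : 0 ≤ sechMean M fun x => |x ^ k| := div_nonneg (integral_nonneg fun x => by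
      have := sech_pos x
      simp only [Pi.zero_apply]
      positivity) hA.le
    rw [Real.norm_of_nonneg (r := (M : ℝ)⁻¹ ^ 2 * sechMean M fun x => |x ^ k|) (by positivity)]
    refine (norm_integral_le_of_norm_le (ib.const_mul (8 * ((M : ℝ)⁻¹) ^ 2))
      (Eventually.of_forall fun x => ?_)).trans_eq ?_
    · rw [norm_mul, Real.norm_eq_abs, Real.norm_eq_abs]
      have := abs_fisherWeight_div_sub_le hρ hM x
      calc _ ≤ |x ^ k| * (8 * ((M : ℝ)⁻¹) ^ 2 * (1 / Real.cosh x) ^ M) := by gcongr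
        _ = _ := by ring
    · rw [integral_const_mul, sechMean]
      field_simp
  refine key.trans ?_
  have := (isBigO_refl (fun M : ℕ => ((M : ℝ)⁻¹) ^ 2) atTop).mul hb.isBigO_sechMean
  exact this.congr_right fun M => by ring

/-! ### Arithmetic of truncated expansions in 1/M. -/

/-- `a M = c + O(1 / M)`. -/
def ZerothJet (a : ℕ → ℝ) (c : ℝ) : Prop :=
  (fun M => a M - c) =O[atTop] fun M : ℕ => (M : ℝ)⁻¹

/-- `a M = c + d / M + O(1 / M ^ 2)`. -/
def FirstJet (a : ℕ → ℝ) (c d : ℝ) : Prop :=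
  (fun M => a M - (c + d * (M : ℝ)⁻¹)) =O[atTop] fun M : ℕ => ((M : ℝ)⁻¹) ^ 2

theorem inv_natCast_isBigO_one : (fun M : ℕ => (M : ℝ)⁻¹) =O[atTop] fun _ => (1 : ℝ) :=
  IsBigO.of_bound 1 (Eventually.of_forall fun M => by
    rw [Real.norm_of_nonneg (by positivity)]
    simpa using Nat.cast_inv_le_one M)

theorem inv_natCast_pow_isBigO {j k : ℕ} (h : j ≤ k) :
    (fun M : ℕ => ((M : ℝ)⁻¹) ^ k) =O[atTop] fun M : ℕ => ((M : ℝ)⁻¹) ^ j := by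
  obtain ⟨i, rfl⟩ := Nat.exists_eq_add_of_le h
  have := (isBigO_refl (fun M : ℕ => ((M : ℝ)⁻¹) ^ j) atTop).mul (inv_natCast_isBigO_one.pow i)
  refine (this.congr_left fun M => by ring).congr_right fun M => by simp

theorem FirstJet.zeroth {a : ℕ → ℝ} {c d : ℝ} (h : FirstJet a c d) : ZerothJet a c := by
  have h1 := h.trans (inv_natCast_pow_isBigO (show 1 ≤ 2 by omega))
  have h2 := (isBigO_refl (fun M : ℕ => (M : ℝ)⁻¹) atTop).const_mul_left d
  simp only [pow_one] at h1
  exact (h1.add h2).congr_left fun M => by ring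

theorem ZerothJet.isBigO_one {a : ℕ → ℝ} {c : ℝ} (h : ZerothJet a c) :
    a =O[atTop] fun _ => (1 : ℝ) := by
  have h1 := h.trans inv_natCast_isBigO_one
  exact (h1.add (isBigO_const_const c one_ne_zero atTop)).congr_left fun M => by ring

theorem ZerothJet.tendsto {a : ℕ → ℝ} {c : ℝ} (h : ZerothJet a c) :
    Tendsto a atTop (nhds c) := by
  have := (h.trans_tendsto tendsto_inv_atTop_nhds_zero_nat).add_const c
  simpa using this

theorem ZerothJet.const (c : ℝ) : ZerothJet (fun _ => c) c := by
  simp only [ZerothJet, sub_self]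
  exact isBigO_zero _ _

theorem FirstJet.const (c : ℝ) : FirstJet (fun _ => c) c 0 := by
  simp only [FirstJet, zero_mul, add_zero, sub_self]
  exact isBigO_zero _ _

theorem FirstJet.congr {a b : ℕ → ℝ} {c d : ℝ} (h : FirstJet a c d) (hab : b =ᶠ[atTop] a) :
    FirstJet b c d :=
  IsBigO.congr' h (hab.mono fun M hM => by simp only [hM]) EventuallyEq.rfl

theorem ZerothJet.congr {a b : ℕ → ℝ} {c : ℝ} (h : ZerothJet a c) (hab : b =ᶠ[atTop] a) :
    ZerothJet b c :=
  IsBigO.congr' h (hab.mono fun M hM => by simp only [hM]) EventuallyEq.rfl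

theorem ZerothJet.inv_natCast_mul {a : ℕ → ℝ} {c : ℝ} (h : ZerothJet a c) :
    FirstJet (fun M => (M : ℝ)⁻¹ * a M) 0 c :=
  (((isBigO_refl (fun M : ℕ => (M : ℝ)⁻¹) atTop).mul h).congr_left fun M => by ring).congr_right
    fun M => by ring

theorem ZerothJet.add {a b : ℕ → ℝ} {c d : ℝ} (ha : ZerothJet a c) (hb : ZerothJet b d) :
    ZerothJet (fun M => a M + b M) (c + d) :=
  (IsBigO.add ha hb).congr_left fun M => by ring

theorem FirstJet.add {a b : ℕ → ℝ} {c d c' d' : ℝ} (ha : FirstJet a c d) (hb : FirstJet b c' d') :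
    FirstJet (fun M => a M + b M) (c + c') (d + d') :=
  (IsBigO.add ha hb).congr_left fun M => by ring

theorem ZerothJet.mul {a b : ℕ → ℝ} {c d : ℝ} (ha : ZerothJet a c) (hb : ZerothJet b d) :
    ZerothJet (fun M => a M * b M) (c * d) := by
  have h1 := (IsBigO.mul ha hb.isBigO_one).congr_right fun M => mul_one _
  have h2 := IsBigO.const_mul_left hb c
  exact (h1.add h2).congr_left fun M => by ring

theorem FirstJet.mul {a b : ℕ → ℝ} {c d c' d' : ℝ} (ha : FirstJet a c d) (hb : FirstJet b c' d') :
    FirstJet (fun M => a M * b M) (c * c') (c * d' + d * c') := by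
  have h1 := (IsBigO.mul ha hb.zeroth.isBigO_one).congr_right fun M => mul_one _
  have h2 := IsBigO.const_mul_left hb c
  have h3 := ((isBigO_refl (fun M : ℕ => (M : ℝ)⁻¹) atTop).mul
    (IsBigO.const_mul_left hb.zeroth d)).congr_right fun M => (sq _).symm
  exact ((h1.add h2).add h3).congr_left fun M => by ring

theorem ZerothJet.const_mul {a : ℕ → ℝ} {c : ℝ} (k : ℝ) (ha : ZerothJet a c) :
    ZerothJet (fun M => k * a M) (k * c) := (const k).mul ha

theorem FirstJet.const_mul {a : ℕ → ℝ} {c d : ℝ} (k : ℝ) (ha : FirstJet a c d) :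
    FirstJet (fun M => k * a M) (k * c) (k * d) := by
  simpa using (const k).mul ha

theorem FirstJet.inv {a : ℕ → ℝ} {c d : ℝ} (ha : FirstJet a c d) (hc : c ≠ 0) :
    FirstJet (fun M => (a M)⁻¹) c⁻¹ (-d / c ^ 2) := by
  have ht := ha.zeroth.tendsto
  have hne : ∀ᶠ M in atTop, a M ≠ 0 := ht.eventually_ne hc
  have hinv : (fun M => (a M)⁻¹) =O[atTop] fun _ => (1 : ℝ) := (ht.inv₀ hc).isBigO_one ℝ
  have h1 := ((isBigO_refl (fun M : ℕ => (M : ℝ)⁻¹) atTop).mul ha.zeroth).const_mul_left (d / c ^ 2)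
  have h2 := (IsBigO.const_mul_left ha (-1 / c)).add (h1.congr_right fun M => (sq _).symm)
  have h3 := (h2.mul hinv).congr_right fun M => mul_one _
  refine h3.congr' (hne.mono fun M hM => ?_) EventuallyEq.rfl
  field_simp
  ring

theorem ZerothJet.inv {a : ℕ → ℝ} {c : ℝ} (ha : ZerothJet a c) (hc : c ≠ 0) :
    ZerothJet (fun M => (a M)⁻¹) c⁻¹ := by
  have ht := ha.tendsto
  have hne : ∀ᶠ M in atTop, a M ≠ 0 := ht.eventually_ne hc
  have hinv : (fun M => (a M)⁻¹) =O[atTop] fun _ => (1 : ℝ) := (ht.inv₀ hc).isBigO_one ℝ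
  have h3 := ((IsBigO.const_mul_left ha (-1 / c)).mul hinv).congr_right fun M => mul_one _
  refine h3.congr' (hne.mono fun M hM => ?_) EventuallyEq.rfl
  field_simp
  ring

/-- `M / (M + k) = 1 - k / M + O(1 / M ^ 2)`. -/
theorem FirstJet.div_natCast_add (k : ℕ) : FirstJet (fun M : ℕ => (M : ℝ) / (M + k)) 1 (-k) := by
  have h := (((const 1).add (ZerothJet.const (k : ℝ)).inv_natCast_mul).inv (by norm_num)).congr
    (b := fun M : ℕ => (M : ℝ) / (M + k)) (by
      filter_upwards [eventually_gt_atTop 0] with M hM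
      have : (0 : ℝ) < M := by exact_mod_cast hM
      field_simp)
  simpa using h

/-! ### Expansions of the moments of the weight. -/

theorem FirstJet.sechMean_tanh_sq :
    FirstJet (fun M => (M : ℝ) * sechMean M fun x => Real.tanh x ^ 2) 1 (-1) := by
  have h := FirstJet.div_natCast_add 1
  rw [Nat.cast_one] at h
  refine h.congr ?_
  filter_upwards [eventually_ge_atTop 2] with M hM
  rw [sechMean_tanh_pow_add_two 0 hM, sechMean_tanh_pow_zero hM]
  push_cast
  ring

theorem FirstJet.sechMean_tanh_pow_four :
    FirstJet (fun M => (M : ℝ) ^ 2 * sechMean M fun x => Real.tanh x ^ 4) 3 (-12) := by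
  have h := (sechMean_tanh_sq.mul (FirstJet.div_natCast_add 3)).const_mul 3
  norm_num at h
  refine h.congr ?_
  filter_upwards [eventually_ge_atTop 2] with M hM
  rw [sechMean_tanh_pow_add_two 2 hM]
  push_cast
  ring

theorem ZerothJet.sechMean_tanh_pow_six :
    ZerothJet (fun M => (M : ℝ) ^ 3 * sechMean M fun x => Real.tanh x ^ 6) 15 := by
  have h := ((FirstJet.sechMean_tanh_pow_four.mul (FirstJet.div_natCast_add 5)).const_mul 5).zeroth
  norm_num at h
  refine h.congr ?_
  filter_upwards [eventually_ge_atTop 2] with M hM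
  rw [sechMean_tanh_pow_add_two 4 hM]
  push_cast
  ring

/-- Only means of powers of tanh remain. The inverse root needs two terms fewer than the root,
because it already carries a factor 1/M. -/
theorem fisherMoment_sub_sechMean_tanh_isBigO {ρ : ℝ} (hρ : ρ ∈ Set.Ioo (-1 : ℝ) 1) (k : ℕ) :
    (fun M : ℕ => fisherMoment ρ k M -
      ((sechMean M fun x => Real.tanh x ^ k) + ρ / 2 * (sechMean M fun x => Real.tanh x ^ (k + 1)) +
        (k / 3 - ρ ^ 2 / 8) * (sechMean M fun x => Real.tanh x ^ (k + 2)) +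
        (ρ ^ 3 / 16 + k * ρ / 6) * (sechMean M fun x => Real.tanh x ^ (k + 3)) -
        (1 - ρ ^ 2) / 8 * (M : ℝ)⁻¹ * ((sechMean M fun x => Real.tanh x ^ k) -
          ρ / 2 * (sechMean M fun x => Real.tanh x ^ (k + 1))))) =O[atTop]
      fun M : ℕ => ((M : ℝ)⁻¹) ^ (k / 2 + 2) := by
  have h0 := fisherMoment_sub_isBigO hρ k
  have s1 := SinhBound.id_pow_mul_sqrt hρ k
  have s2 := SinhBound.id_pow_mul_inv_sqrt hρ k
  have h1 := (s1.mono (show 2 * (k / 2 + 2) ≤ k + 4 by omega)).isBigO_sechMean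
  have h2 := (s2.mono (show 2 * (k / 2 + 1) ≤ k + 2 by omega)).isBigO_sechMean
  have h3 := ((isBigO_refl (fun M : ℕ => (M : ℝ)⁻¹) atTop).mul h2).const_mul_left
    (-((1 - ρ ^ 2) / 8))
  have h4 := (h0.add h1).add (h3.congr_right fun M => by ring)
  refine h4.congr' ?_ EventuallyEq.rfl
  have t := fun j => (SinhBound.tanh_pow j).integrable
  filter_upwards [t k, t (k + 1), t (k + 2), t (k + 3), s1.integrable, s2.integrable]
    with M t0 t1 t2 t3 i1 i2
  have c1 := fun (c : ℝ) => (t1.const_mul c).congr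
    (g := fun x => c * Real.tanh x ^ (k + 1) * (1 / Real.cosh x) ^ M)
    (Eventually.of_forall fun x => by simp only; ring)
  have c2 := fun (c : ℝ) => (t2.const_mul c).congr
    (g := fun x => c * Real.tanh x ^ (k + 2) * (1 / Real.cosh x) ^ M)
    (Eventually.of_forall fun x => by simp only; ring)
  have c3 := fun (c : ℝ) => (t3.const_mul c).congr
    (g := fun x => c * Real.tanh x ^ (k + 3) * (1 / Real.cosh x) ^ M)
    (Eventually.of_forall fun x => by simp only; ring)
  have c01 := (t0.add (c1 (ρ / 2))).congr
    (g := fun x => (Real.tanh x ^ k + ρ / 2 * Real.tanh x ^ (k + 1)) * (1 / Real.cosh x) ^ M)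
    (Eventually.of_forall fun x => by simp only [Pi.add_apply]; ring)
  have c012 := (c01.add (c2 (k / 3 - ρ ^ 2 / 8))).congr
    (g := fun x => (Real.tanh x ^ k + ρ / 2 * Real.tanh x ^ (k + 1) +
      (k / 3 - ρ ^ 2 / 8) * Real.tanh x ^ (k + 2)) * (1 / Real.cosh x) ^ M)
    (Eventually.of_forall fun x => by simp only [Pi.add_apply]; ring)
  have c0123 := (c012.add (c3 (ρ ^ 3 / 16 + k * ρ / 6))).congr
    (g := fun x => (Real.tanh x ^ k + ρ / 2 * Real.tanh x ^ (k + 1) +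
      (k / 3 - ρ ^ 2 / 8) * Real.tanh x ^ (k + 2) +
      (ρ ^ 3 / 16 + k * ρ / 6) * Real.tanh x ^ (k + 3)) * (1 / Real.cosh x) ^ M)
    (Eventually.of_forall fun x => by simp only [Pi.add_apply]; ring)
  have d01 := (t0.add (c1 (-(ρ / 2)))).congr
    (g := fun x => (Real.tanh x ^ k + -(ρ / 2) * Real.tanh x ^ (k + 1)) * (1 / Real.cosh x) ^ M)
    (Eventually.of_forall fun x => by simp only [Pi.add_apply]; ring)
  have e1 := sechMean_add_of_integrable i1 c0123
  have e2 := sechMean_add_of_integrable i2 d01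
  rw [sechMean_add_of_integrable c012 (c3 _), sechMean_add_of_integrable c01 (c2 _),
    sechMean_add_of_integrable t0 (c1 _), sechMean_const_mul, sechMean_const_mul,
    sechMean_const_mul] at e1
  rw [sechMean_add_of_integrable t0 (c1 _), sechMean_const_mul] at e2
  have e3 : (sechMean M fun x => x ^ k * √(1 + ρ * Real.tanh x)) = _ := Eq.trans
    (congrArg _ (funext fun x => by ring)) e1
  have e4 : (sechMean M fun x => x ^ k * (1 / √(1 + ρ * Real.tanh x))) = _ := Eq.trans
    (congrArg _ (funext fun x => by ring)) e2
  rw [e3, e4]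
  ring

theorem FirstJet.of_sub_isBigO {a b : ℕ → ℝ} {c d : ℝ} (hb : FirstJet b c d)
    (h : (fun M => a M - b M) =O[atTop] fun M : ℕ => ((M : ℝ)⁻¹) ^ 2) : FirstJet a c d :=
  (h.add hb).congr_left fun M => by ring

theorem ZerothJet.of_sub_isBigO {a b : ℕ → ℝ} {c : ℝ} (hb : ZerothJet b c)
    (h : (fun M => a M - b M) =O[atTop] fun M : ℕ => (M : ℝ)⁻¹) : ZerothJet a c :=
  (h.add hb).congr_left fun M => by ring

theorem isBigO_natCast_pow_mul {a : ℕ → ℝ} {j k : ℕ}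
    (h : a =O[atTop] fun M : ℕ => ((M : ℝ)⁻¹) ^ (k + j)) :
    (fun M : ℕ => (M : ℝ) ^ j * a M) =O[atTop] fun M : ℕ => ((M : ℝ)⁻¹) ^ k := by
  refine ((isBigO_refl (fun M : ℕ => (M : ℝ) ^ j) atTop).mul h).congr' EventuallyEq.rfl ?_
  filter_upwards [eventually_gt_atTop 0] with M hM
  have : (M : ℝ) ≠ 0 := by positivity
  rw [pow_add, mul_left_comm, ← mul_pow, mul_inv_cancel₀ this, one_pow, mul_one]

theorem ZerothJet.natCast_inv_mul {a : ℕ → ℝ} {c : ℝ} (h : ZerothJet a c) :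
    ZerothJet (fun M => (M : ℝ)⁻¹ * a M) 0 := h.inv_natCast_mul.zeroth

section

variable {ρ : ℝ}

/-- Odd powers of tanh have mean zero. For even k this leaves the powers k and k + 2. For odd k it
leaves k + 1 and k + 3, and only k + 1 matters to the single order kept. Here -ρ²/8 from tanh² and
-(1 - ρ²)/8 from the inner integral add up to -1/8. -/
theorem firstJet_fisherMoment_zero (hρ : ρ ∈ Set.Ioo (-1 : ℝ) 1) :
    FirstJet (fisherMoment ρ 0) 1 (-1 / 8) := by
  have h := fisherMoment_sub_sechMean_tanh_isBigO hρ 0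
  have j2 := (FirstJet.sechMean_tanh_sq.zeroth.inv_natCast_mul).const_mul (-(ρ ^ 2 / 8))
  have j0 := ((ZerothJet.const 1).inv_natCast_mul).const_mul (-((1 - ρ ^ 2) / 8))
  have j := ((FirstJet.const 1).add j2).add j0
  convert FirstJet.of_sub_isBigO j (h.congr' ?_ EventuallyEq.rfl) using 1
  · ring
  · ring
  filter_upwards [eventually_ge_atTop 2] with M hM
  have hM0 : (M : ℝ) ≠ 0 := by positivity
  have o1 := sechMean_tanh_pow_odd 0 hM
  have o3 := sechMean_tanh_pow_odd 1 hM
  have o0 := sechMean_tanh_pow_zero hM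
  norm_num at o1 o3 o0 ⊢
  rw [o1, o3, o0]
  field_simp
  ring

theorem zerothJet_fisherMoment_one (hρ : ρ ∈ Set.Ioo (-1 : ℝ) 1) :
    ZerothJet (fun M => M * fisherMoment ρ 1 M) (ρ / 2) := by
  have h := isBigO_natCast_pow_mul (j := 1) (k := 1) (fisherMoment_sub_sechMean_tanh_isBigO hρ 1)
  simp only [pow_one] at h
  have j2 := FirstJet.sechMean_tanh_sq.zeroth.const_mul (ρ / 2)
  have j4 := (FirstJet.sechMean_tanh_pow_four.zeroth.natCast_inv_mul).const_mul
    (ρ ^ 3 / 16 + ρ / 6)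
  have j2' := (FirstJet.sechMean_tanh_sq.zeroth.natCast_inv_mul).const_mul
    ((1 - ρ ^ 2) / 8 * (ρ / 2))
  have j := (j2.add j4).add j2'
  convert ZerothJet.of_sub_isBigO j (h.congr' ?_ EventuallyEq.rfl) using 1
  · ring
  filter_upwards [eventually_ge_atTop 2] with M hM
  have hM0 : (M : ℝ) ≠ 0 := by positivity
  have o1 := sechMean_tanh_pow_odd 0 hM
  have o3 := sechMean_tanh_pow_odd 1 hM
  norm_num at o1 o3 ⊢
  rw [o1, o3]
  field_simp
  ring

theorem firstJet_fisherMoment_two (hρ : ρ ∈ Set.Ioo (-1 : ℝ) 1) :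
    FirstJet (fun M => M * fisherMoment ρ 2 M) 1 (7 / 8 - ρ ^ 2 / 4) := by
  have h := isBigO_natCast_pow_mul (j := 1) (k := 2) (fisherMoment_sub_sechMean_tanh_isBigO hρ 2)
  simp only [pow_one] at h
  have j4 := (FirstJet.sechMean_tanh_pow_four.zeroth.inv_natCast_mul).const_mul
    (2 / 3 - ρ ^ 2 / 8)
  have j2' := (FirstJet.sechMean_tanh_sq.zeroth.inv_natCast_mul).const_mul (-((1 - ρ ^ 2) / 8))
  have j := (FirstJet.sechMean_tanh_sq.add j4).add j2'
  convert FirstJet.of_sub_isBigO j (h.congr' ?_ EventuallyEq.rfl) using 1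
  · ring
  · ring
  filter_upwards [eventually_ge_atTop 2] with M hM
  have hM0 : (M : ℝ) ≠ 0 := by positivity
  have o3 := sechMean_tanh_pow_odd 1 hM
  have o5 := sechMean_tanh_pow_odd 2 hM
  norm_num at o3 o5 ⊢
  rw [o3, o5]
  field_simp
  ring

theorem zerothJet_fisherMoment_three (hρ : ρ ∈ Set.Ioo (-1 : ℝ) 1) :
    ZerothJet (fun M => (M : ℝ) ^ 2 * fisherMoment ρ 3 M) (3 * ρ / 2) := by
  have h := isBigO_natCast_pow_mul (j := 2) (k := 1) (fisherMoment_sub_sechMean_tanh_isBigO hρ 3)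
  simp only [pow_one] at h
  have j4 := FirstJet.sechMean_tanh_pow_four.zeroth.const_mul (ρ / 2)
  have j6 := (ZerothJet.sechMean_tanh_pow_six.natCast_inv_mul).const_mul
    (ρ ^ 3 / 16 + ρ / 2)
  have j4' := (FirstJet.sechMean_tanh_pow_four.zeroth.natCast_inv_mul).const_mul
    ((1 - ρ ^ 2) / 8 * (ρ / 2))
  have j := (j4.add j6).add j4'
  convert ZerothJet.of_sub_isBigO j (h.congr' ?_ EventuallyEq.rfl) using 1
  · ring
  filter_upwards [eventually_ge_atTop 2] with M hM
  have hM0 : (M : ℝ) ≠ 0 := by positivity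
  have o3 := sechMean_tanh_pow_odd 1 hM
  have o5 := sechMean_tanh_pow_odd 2 hM
  norm_num at o3 o5 ⊢
  rw [o3, o5]
  field_simp
  ring

theorem firstJet_fisherMoment_four (hρ : ρ ∈ Set.Ioo (-1 : ℝ) 1) :
    FirstJet (fun M => (M : ℝ) ^ 2 * fisherMoment ρ 4 M) 3 (61 / 8 - 3 * ρ ^ 2 / 2) := by
  have h := isBigO_natCast_pow_mul (j := 2) (k := 2) (fisherMoment_sub_sechMean_tanh_isBigO hρ 4)
  have j6 := (ZerothJet.sechMean_tanh_pow_six.inv_natCast_mul).const_mul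
    (4 / 3 - ρ ^ 2 / 8)
  have j4' := (FirstJet.sechMean_tanh_pow_four.zeroth.inv_natCast_mul).const_mul
    (-((1 - ρ ^ 2) / 8))
  have j := (FirstJet.sechMean_tanh_pow_four.add j6).add j4'
  convert FirstJet.of_sub_isBigO j (h.congr' ?_ EventuallyEq.rfl) using 1
  · ring
  · ring
  filter_upwards [eventually_ge_atTop 2] with M hM
  have hM0 : (M : ℝ) ≠ 0 := by positivity
  have o5 := sechMean_tanh_pow_odd 2 hM
  have o7 := sechMean_tanh_pow_odd 3 hM
  norm_num at o5 o7 ⊢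
  rw [o5, o7]
  field_simp
  ring

end

/-! ### Variance, skewness and kurtosis from the moments. -/

/-- The moments about `artanh ρ` of the Fisher transformation of the empirical correlation
coefficient of a sample of size `M + 2`. -/
noncomputable def fisherZMoment (ρ : ℝ) (k M : ℕ) : ℝ :=
  (∫ x, x ^ k * fisherWeight ρ M x) / ∫ x, fisherWeight ρ M x

theorem fisherZMoment_eq {ρ : ℝ} (k : ℕ) {M : ℕ} (hM : 2 ≤ M) :
    fisherZMoment ρ k M = fisherMoment ρ k M * (fisherMoment ρ 0 M)⁻¹ := by
  have h1 := sechMass_pos hM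
  have h2 := sechMass_pos (M := 2 * M + 1) (by omega)
  unfold fisherZMoment fisherMoment
  simp only [pow_zero, one_mul]
  -- If the mass were 0, both sides would vanish by the convention for division by zero, so
  -- positivity is not needed here.
  by_cases h : ∫ x, fisherWeight ρ M x = 0
  · simp [h]
  · field_simp

section

variable {ρ : ℝ}

theorem zerothJet_fisherZMoment_one (hρ : ρ ∈ Set.Ioo (-1 : ℝ) 1) :
    ZerothJet (fun M => M * fisherZMoment ρ 1 M) (ρ / 2) := by
  have j := (zerothJet_fisherMoment_one hρ).mul
    ((firstJet_fisherMoment_zero hρ).zeroth.inv one_ne_zero)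
  norm_num at j
  refine j.congr ?_
  filter_upwards [eventually_ge_atTop 2] with M hM
  rw [fisherZMoment_eq 1 hM]
  ring

theorem firstJet_fisherZMoment_two (hρ : ρ ∈ Set.Ioo (-1 : ℝ) 1) :
    FirstJet (fun M => M * fisherZMoment ρ 2 M) 1 (1 - ρ ^ 2 / 4) := by
  have j := (firstJet_fisherMoment_two hρ).mul
    ((firstJet_fisherMoment_zero hρ).inv one_ne_zero)
  convert j.congr (b := fun M => M * fisherZMoment ρ 2 M) ?_ using 1
  · ring
  · ring
  filter_upwards [eventually_ge_atTop 2] with M hM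
  rw [fisherZMoment_eq 2 hM]
  ring

theorem zerothJet_fisherZMoment_three (hρ : ρ ∈ Set.Ioo (-1 : ℝ) 1) :
    ZerothJet (fun M => (M : ℝ) ^ 2 * fisherZMoment ρ 3 M) (3 * ρ / 2) := by
  have j := (zerothJet_fisherMoment_three hρ).mul
    ((firstJet_fisherMoment_zero hρ).zeroth.inv one_ne_zero)
  norm_num at j
  refine j.congr ?_
  filter_upwards [eventually_ge_atTop 2] with M hM
  rw [fisherZMoment_eq 3 hM]
  ring

theorem firstJet_fisherZMoment_four (hρ : ρ ∈ Set.Ioo (-1 : ℝ) 1) :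
    FirstJet (fun M => (M : ℝ) ^ 2 * fisherZMoment ρ 4 M) 3 (8 - 3 * ρ ^ 2 / 2) := by
  have j := (firstJet_fisherMoment_four hρ).mul
    ((firstJet_fisherMoment_zero hρ).inv one_ne_zero)
  convert j.congr (b := fun M => (M : ℝ) ^ 2 * fisherZMoment ρ 4 M) ?_ using 1
  · ring
  · ring
  filter_upwards [eventually_ge_atTop 2] with M hM
  rw [fisherZMoment_eq 4 hM]
  ring

/-- The variance in terms of moments. -/
theorem firstJet_fisherZ_variance (hρ : ρ ∈ Set.Ioo (-1 : ℝ) 1) :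
    FirstJet (fun M => M * (fisherZMoment ρ 2 M - fisherZMoment ρ 1 M ^ 2)) 1 (1 - ρ ^ 2 / 2) := by
  have h1 := zerothJet_fisherZMoment_one hρ
  have j := (firstJet_fisherZMoment_two hρ).add
    ((h1.mul h1).inv_natCast_mul.const_mul (-1))
  convert j.congr (b := fun M => M * (fisherZMoment ρ 2 M - fisherZMoment ρ 1 M ^ 2)) ?_ using 1
  · ring
  · ring
  filter_upwards [eventually_gt_atTop 0] with M hM
  have : (M : ℝ) ≠ 0 := by positivity
  field_simp
  ring

/-- The third central moment in terms of moments. -/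
theorem zerothJet_fisherZ_third (hρ : ρ ∈ Set.Ioo (-1 : ℝ) 1) :
    ZerothJet (fun M => (M : ℝ) ^ 2 * (fisherZMoment ρ 3 M -
      3 * fisherZMoment ρ 1 M * fisherZMoment ρ 2 M + 2 * fisherZMoment ρ 1 M ^ 3)) 0 := by
  have h1 := zerothJet_fisherZMoment_one hρ
  have h2 := (firstJet_fisherZMoment_two hρ).zeroth
  have h3 := zerothJet_fisherZMoment_three hρ
  -- The leading terms cancel, 3ρ/2 - 3 (ρ/2) = 0, and the cube of the mean is one order smaller.
  have j := (h3.add ((h1.mul h2).const_mul (-3))).add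
    (((h1.mul h1).mul h1).natCast_inv_mul.const_mul 2)
  convert j.congr (b := fun M => (M : ℝ) ^ 2 * (fisherZMoment ρ 3 M -
      3 * fisherZMoment ρ 1 M * fisherZMoment ρ 2 M + 2 * fisherZMoment ρ 1 M ^ 3)) ?_ using 1
  · ring
  filter_upwards [eventually_gt_atTop 0] with M hM
  have : (M : ℝ) ≠ 0 := by positivity
  field_simp
  ring

/-- The fourth central moment in terms of moments. -/
theorem firstJet_fisherZ_fourth (hρ : ρ ∈ Set.Ioo (-1 : ℝ) 1) :
    FirstJet (fun M => (M : ℝ) ^ 2 * (fisherZMoment ρ 4 M -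
      4 * fisherZMoment ρ 1 M * fisherZMoment ρ 3 M +
      6 * fisherZMoment ρ 1 M ^ 2 * fisherZMoment ρ 2 M - 3 * fisherZMoment ρ 1 M ^ 4))
      3 (8 - 3 * ρ ^ 2) := by
  have h1 := zerothJet_fisherZMoment_one hρ
  have h2 := (firstJet_fisherZMoment_two hρ).zeroth
  have h3 := zerothJet_fisherZMoment_three hρ
  have h4 := firstJet_fisherZMoment_four hρ
  have j := ((h4.add ((h1.mul h3).inv_natCast_mul.const_mul (-4))).add
    (((h1.mul h1).mul h2).inv_natCast_mul.const_mul 6)).add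
    ((((h1.mul h1).mul h1).mul h1).natCast_inv_mul.inv_natCast_mul.const_mul (-3))
  convert j.congr (b := fun M => (M : ℝ) ^ 2 * (fisherZMoment ρ 4 M -
      4 * fisherZMoment ρ 1 M * fisherZMoment ρ 3 M +
      6 * fisherZMoment ρ 1 M ^ 2 * fisherZMoment ρ 2 M - 3 * fisherZMoment ρ 1 M ^ 4)) ?_ using 1
  · ring
  · ring
  filter_upwards [eventually_gt_atTop 0] with M hM
  have : (M : ℝ) ≠ 0 := by positivity
  field_simp
  ring

end

theorem exists_abs_le_of_isBigO_inv_pow {a : ℕ → ℝ} {j : ℕ}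
    (h : a =O[atTop] fun M : ℕ => ((M : ℝ)⁻¹) ^ j) :
    ∃ C : ℝ, 0 ≤ C ∧ ∀ᶠ M : ℕ in atTop, |a M| ≤ C / ((M + 2 : ℕ) : ℝ) ^ j := by
  obtain ⟨C, hC, hb⟩ := h.exists_nonneg
  -- M + 2 ≤ 3 M for M ≥ 1 trades powers of M for powers of the sample size.
  refine ⟨C * 3 ^ j, by positivity, ?_⟩
  filter_upwards [hb.bound, eventually_ge_atTop 1] with M hM h1
  have hM1 : (1 : ℝ) ≤ M := by exact_mod_cast h1
  rw [Real.norm_eq_abs, Real.norm_of_nonneg (by positivity)] at hM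
  refine hM.trans ?_
  rw [mul_div_assoc, ← div_pow]
  gcongr
  rw [inv_eq_one_div, div_le_div_iff₀ (by linarith) (by positivity)]
  push_cast
  linarith

section

variable {ρ : ℝ}

theorem fisherZMoment_one_sub_isBigO (hρ : ρ ∈ Set.Ioo (-1 : ℝ) 1) :
    (fun M : ℕ => fisherZMoment ρ 1 M - ρ / (2 * ((M + 2 : ℕ) : ℝ))) =O[atTop]
      fun M : ℕ => ((M : ℝ)⁻¹) ^ 2 := by
  have j := ((zerothJet_fisherZMoment_one hρ).add
    ((FirstJet.div_natCast_add 2).zeroth.const_mul (-(ρ / 2)))).inv_natCast_mul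
  refine IsBigO.congr' j ?_ EventuallyEq.rfl
  filter_upwards [eventually_gt_atTop 0] with M hM
  have : (M : ℝ) ≠ 0 := by positivity
  push_cast
  field_simp
  ring

/-- With n = M + 2, 1/M = 1/n + 2/n² + O(n⁻³), so the coefficient 1 - ρ²/2 in M becomes 3 - ρ²/2 =
(6 - ρ²)/2 in n. -/
theorem fisherZ_variance_sub_isBigO (hρ : ρ ∈ Set.Ioo (-1 : ℝ) 1) :
    (fun M : ℕ => (fisherZMoment ρ 2 M - fisherZMoment ρ 1 M ^ 2) - fisherVar ρ (M + 2)) =O[atTop]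
      fun M : ℕ => ((M : ℝ)⁻¹) ^ 3 := by
  have r := FirstJet.div_natCast_add 2
  have j := ((firstJet_fisherZ_variance hρ).add (r.const_mul (-1))).add
    ((r.zeroth.mul r.zeroth).inv_natCast_mul.const_mul (-((6 - ρ ^ 2) / 2)))
  have j' := (isBigO_refl (fun M : ℕ => (M : ℝ)⁻¹) atTop).mul j
  refine (j'.congr' ?_ EventuallyEq.rfl).congr_right fun M => by ring
  filter_upwards [eventually_gt_atTop 0] with M hM
  have : (M : ℝ) ≠ 0 := by positivity
  unfold fisherVar
  push_cast
  field_simp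
  ring

/-- The first-order coefficient is (8 - 3ρ²) - 3 (2 - ρ²) = 2: ρ cancels, and 2/M and 2/n agree to
this order. -/
theorem fisherZ_excessKurtosis_sub_isBigO (hρ : ρ ∈ Set.Ioo (-1 : ℝ) 1) :
    (fun M : ℕ => (fisherZMoment ρ 4 M - 4 * fisherZMoment ρ 1 M * fisherZMoment ρ 3 M +
      6 * fisherZMoment ρ 1 M ^ 2 * fisherZMoment ρ 2 M - 3 * fisherZMoment ρ 1 M ^ 4) /
      (fisherZMoment ρ 2 M - fisherZMoment ρ 1 M ^ 2) ^ 2 - 3 - 2 / ((M + 2 : ℕ) : ℝ)) =O[atTop]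
      fun M : ℕ => ((M : ℝ)⁻¹) ^ 2 := by
  have v := firstJet_fisherZ_variance hρ
  have hv : ∀ᶠ M in atTop, _ ≠ (0 : ℝ) := v.zeroth.tendsto.eventually_ne one_ne_zero
  have vi := v.inv one_ne_zero
  have j := (((firstJet_fisherZ_fourth hρ).mul (vi.mul vi)).add (FirstJet.const (-3))).add
    ((FirstJet.div_natCast_add 2).zeroth.inv_natCast_mul.const_mul (-2))
  have e : (3 * (1⁻¹ * 1⁻¹) + -3 + -2 * 0 : ℝ) = 0 := by norm_num
  refine IsBigO.congr' j ?_ EventuallyEq.rfl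
  filter_upwards [eventually_gt_atTop 0, hv] with M hM hv
  have : (M : ℝ) ≠ 0 := by positivity
  have := right_ne_zero_of_mul hv
  push_cast
  field_simp
  ring

/-- The third central moment is O(M⁻³) and the variance is of exact order 1/M, so the skewness is
O(M^(-3/2)). The factor √M keeps the exponents integral. -/
theorem fisherZ_skewness_isBigO (hρ : ρ ∈ Set.Ioo (-1 : ℝ) 1) :
    (fun M : ℕ => √(M : ℝ) * ((fisherZMoment ρ 3 M -
      3 * fisherZMoment ρ 1 M * fisherZMoment ρ 2 M + 2 * fisherZMoment ρ 1 M ^ 3) /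
      √(fisherZMoment ρ 2 M - fisherZMoment ρ 1 M ^ 2) ^ 3)) =O[atTop]
      fun M : ℕ => (M : ℝ)⁻¹ := by
  have v := (firstJet_fisherZ_variance hρ).zeroth.tendsto
  have hv : ∀ᶠ M in atTop, (0 : ℝ) < _ := v.eventually_const_lt one_pos
  have vi := ((v.sqrt.pow 3).inv₀ (by norm_num)).isBigO_one ℝ
  have j := (IsBigO.mul (zerothJet_fisherZ_third hρ) vi).congr_right fun M => mul_one _
  refine IsBigO.congr' j ?_ EventuallyEq.rfl
  filter_upwards [eventually_gt_atTop 0, hv] with M hM hv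
  have hM0 : (0 : ℝ) < M := by positivity
  have hv1 := (mul_pos_iff_of_pos_left hM0).1 hv
  have := Real.sqrt_pos.2 hM0
  have := Real.sqrt_pos.2 hv1
  rw [Real.sqrt_mul hM0.le, sub_zero]
  nth_rewrite 1 [← Real.sq_sqrt hM0.le]
  field_simp

theorem exists_abs_fisherZ_skewness_le (hρ : ρ ∈ Set.Ioo (-1 : ℝ) 1) :
    ∃ C : ℝ, 0 ≤ C ∧ ∀ᶠ M : ℕ in atTop, |(fisherZMoment ρ 3 M -
      3 * fisherZMoment ρ 1 M * fisherZMoment ρ 2 M + 2 * fisherZMoment ρ 1 M ^ 3) /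
      √(fisherZMoment ρ 2 M - fisherZMoment ρ 1 M ^ 2) ^ 3| ≤
      C / ((M + 2 : ℕ) : ℝ) ^ (3 / 2 : ℝ) := by
  obtain ⟨C, hC, hb⟩ := exists_abs_le_of_isBigO_inv_pow (j := 1)
    ((fisherZ_skewness_isBigO hρ).congr_right fun M => (pow_one _).symm)
  refine ⟨2 * C, by positivity, ?_⟩
  filter_upwards [hb, eventually_ge_atTop 1] with M hM h1
  have hM1 : (1 : ℝ) ≤ M := by exact_mod_cast h1
  have hs := Real.sqrt_pos.2 (by linarith : (0 : ℝ) < M)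
  have hn : (0 : ℝ) < ((M + 2 : ℕ) : ℝ) := by positivity
  rw [abs_mul, abs_of_pos hs, pow_one] at hM
  have hs2 : √((M + 2 : ℕ) : ℝ) ≤ 2 * √(M : ℝ) := by
    rw [Real.sqrt_le_left (by positivity), mul_pow, Real.sq_sqrt (by linarith)]
    push_cast
    linarith
  have e : ((M + 2 : ℕ) : ℝ) ^ (3 / 2 : ℝ) = ((M + 2 : ℕ) : ℝ) * √((M + 2 : ℕ) : ℝ) := by
    rw [show (3 / 2 : ℝ) = 1 + 1 / 2 by norm_num, Real.rpow_add hn, Real.rpow_one,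
      ← Real.sqrt_eq_rpow]
  rw [e, le_div_iff₀ (by positivity)]
  rw [le_div_iff₀ hn] at hM
  set S := |(fisherZMoment ρ 3 M - 3 * fisherZMoment ρ 1 M * fisherZMoment ρ 2 M +
    2 * fisherZMoment ρ 1 M ^ 3) / √(fisherZMoment ρ 2 M - fisherZMoment ρ 1 M ^ 2) ^ 3|
  calc S * (((M + 2 : ℕ) : ℝ) * √((M + 2 : ℕ) : ℝ)) ≤ S * (((M + 2 : ℕ) : ℝ) * (2 * √(M : ℝ))) := by
        gcongr
    _ = 2 * (√(M : ℝ) * S * ((M + 2 : ℕ) : ℝ)) := by ring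
    _ ≤ _ := by gcongr

end

/-! ### From the weight to the random variable. -/

theorem measurable_sampleCorr {n : ℕ} :
    Measurable fun p : Fin n → ℝ × ℝ => sampleCorr (fun i => (p i).1) fun i => (p i).2 := by
  unfold sampleCorr sampleMean
  fun_prop

theorem measurable_artanh : Measurable Real.artanh := by
  unfold Real.artanh
  fun_prop

theorem IsBivariateNormalSample.aemeasurable_sampleCorr {Ω : Type*} [MeasurableSpace Ω]
    {P : Measure Ω} {n : ℕ} {X Y : Fin n → Ω → ℝ} {μ₁ μ₂ σ₁ σ₂ ρ : ℝ}
    (h : IsBivariateNormalSample P X Y μ₁ μ₂ σ₁ σ₂ ρ) :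
    AEMeasurable (fun ω => sampleCorr (fun i => X i ω) fun i => Y i ω) P :=
  measurable_sampleCorr.comp_aemeasurable
    (f := fun ω i => (X i ω, Y i ω)) (aemeasurable_pi_lambda _ fun i => (h.gaussian i).aemeasurable)

theorem IsBivariateNormalSample.aemeasurable_fisherZ {Ω : Type*} [MeasurableSpace Ω]
    {P : Measure Ω} {n : ℕ} {X Y : Fin n → Ω → ℝ} {μ₁ μ₂ σ₁ σ₂ ρ : ℝ}
    (h : IsBivariateNormalSample P X Y μ₁ μ₂ σ₁ σ₂ ρ) : AEMeasurable (fisherZ X Y) P :=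
  measurable_artanh.comp_aemeasurable h.aemeasurable_sampleCorr

/-- The density of `artanh r - artanh ρ` for a sample of size `M + 2`. -/
noncomputable def fisherDensity (ρ : ℝ) (M : ℕ) (x : ℝ) : ℝ :=
  fisherWeight ρ M x / ∫ y, fisherWeight ρ M y

theorem fisherDensity_nonneg (ρ : ℝ) (M : ℕ) (x : ℝ) : 0 ≤ fisherDensity ρ M x :=
  div_nonneg (fisherWeight_nonneg ρ M x) (integral_nonneg (fisherWeight_nonneg ρ M))

theorem continuous_fisherDensity {ρ : ℝ} (hρ : ρ ∈ Set.Ioo (-1 : ℝ) 1) {M : ℕ} (hM : 1 ≤ M) :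
    Continuous (fisherDensity ρ M) :=
  (continuous_fisherWeight hρ hM).div_const _

theorem integrable_fisherWeight {ρ : ℝ} (hρ : ρ ∈ Set.Ioo (-1 : ℝ) 1) {M : ℕ} (hM : 3 ≤ M) :
    Integrable (fisherWeight ρ M) := by
  have h := integrable_mul_fisherWeight hρ hM (f := fun _ => 1) continuous_const
    (by simpa using integrable_sech_pow (k := M) (by omega))
  simpa using h

theorem IsBivariateNormalSample.lintegral_sampleCorr_eq_fisherDensity {ρ : ℝ}
    (hρ : ρ ∈ Set.Ioo (-1 : ℝ) 1) {M : ℕ} (hM : 3 ≤ M) {Ω : Type*} [MeasurableSpace Ω]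
    {P : Measure Ω} [IsProbabilityMeasure P] {X Y : Fin (M + 2) → Ω → ℝ}
    {μ₁ μ₂ σ₁ σ₂ : ℝ} (hσ₁ : 0 < σ₁) (hσ₂ : 0 < σ₂)
    (h : IsBivariateNormalSample P X Y μ₁ μ₂ σ₁ σ₂ ρ) {F : ℝ → ENNReal} (hF : Measurable F) :
    ∫⁻ ω, F (sampleCorr (fun i => X i ω) (fun i => Y i ω)) ∂P =
      ∫⁻ x, F (Real.tanh (Real.artanh ρ + x)) * ENNReal.ofReal (fisherDensity ρ M x) := by
  obtain ⟨c, hc⟩ := IsBivariateNormalSample.lintegral_sampleCorr_eq hρ (M := M) (by omega)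
  have hm := (continuous_fisherWeight hρ (M := M) (by omega)).measurable
  -- Testing with F = 1 identifies the anonymous constant as the inverse of the mass of the weight.
  -- It also shows that this mass is positive, since otherwise 1 = 0.
  have h1 := hc hσ₁ hσ₂ h (F := fun _ => 1) measurable_const
  simp only [lintegral_const, measure_univ, mul_one, one_mul] at h1
  rw [← ofReal_integral_eq_lintegral_ofReal (integrable_fisherWeight hρ hM)
    (Eventually.of_forall (fisherWeight_nonneg ρ M))] at h1
  have hW0 : 0 < ∫ x, fisherWeight ρ M x := by
    by_contra hn
    rw [ENNReal.ofReal_of_nonpos (not_lt.1 hn), mul_zero] at h1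
    exact one_ne_zero h1
  have hce : c = (ENNReal.ofReal (∫ x, fisherWeight ρ M x))⁻¹ :=
    ENNReal.eq_inv_of_mul_eq_one_left h1.symm
  have hcT : c ≠ ⊤ := by
    rw [hce]
    simpa using hW0
  rw [hc hσ₁ hσ₂ h hF, ← lintegral_const_mul' _ _ hcT]
  refine lintegral_congr fun x => ?_
  rw [fisherDensity, ENNReal.ofReal_div_of_pos hW0, hce, div_eq_mul_inv]
  ring

section

variable {ρ : ℝ} {M : ℕ} {Ω : Type*} [MeasurableSpace Ω] {P : Measure Ω} [IsProbabilityMeasure P]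
  {X Y : Fin (M + 2) → Ω → ℝ} {μ₁ μ₂ σ₁ σ₂ : ℝ}

theorem IsBivariateNormalSample.lintegral_fisherZ (hρ : ρ ∈ Set.Ioo (-1 : ℝ) 1) (hM : 3 ≤ M)
    (hσ₁ : 0 < σ₁) (hσ₂ : 0 < σ₂) (h : IsBivariateNormalSample P X Y μ₁ μ₂ σ₁ σ₂ ρ)
    {F : ℝ → ENNReal} (hF : Measurable F) :
    ∫⁻ ω, F (fisherZ X Y ω) ∂P =
      ∫⁻ x, F (Real.artanh ρ + x) * ENNReal.ofReal (fisherDensity ρ M x) := by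
  have := h.lintegral_sampleCorr_eq_fisherDensity hρ hM hσ₁ hσ₂ (hF.comp measurable_artanh)
  simpa only [Function.comp_apply, Real.artanh_tanh, fisherZ] using this

theorem IsBivariateNormalSample.map_fisherZ_sub (hρ : ρ ∈ Set.Ioo (-1 : ℝ) 1) (hM : 3 ≤ M)
    (hσ₁ : 0 < σ₁) (hσ₂ : 0 < σ₂) (h : IsBivariateNormalSample P X Y μ₁ μ₂ σ₁ σ₂ ρ) :
    P.map (fun ω => fisherZ X Y ω - Real.artanh ρ) =
      volume.withDensity fun x => ENNReal.ofReal (fisherDensity ρ M x) := by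
  have hm := (continuous_fisherDensity hρ (M := M) (by omega)).measurable
  refine Measure.ext_of_lintegral _ fun F hF => ?_
  rw [lintegral_map' hF.aemeasurable (h.aemeasurable_fisherZ.sub_const _),
    h.lintegral_fisherZ (F := fun z => F (z - Real.artanh ρ)) hρ hM hσ₁ hσ₂
      (hF.comp (measurable_id.sub_const _)),
    lintegral_withDensity_eq_lintegral_mul _ hm.ennreal_ofReal hF]
  refine lintegral_congr fun x => ?_
  simp only [add_sub_cancel_left, Pi.mul_apply, mul_comm]

theorem IsBivariateNormalSample.integrable_fisherZ_pow (hρ : ρ ∈ Set.Ioo (-1 : ℝ) 1) (hM : 3 ≤ M)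
    (hσ₁ : 0 < σ₁) (hσ₂ : 0 < σ₂) (h : IsBivariateNormalSample P X Y μ₁ μ₂ σ₁ σ₂ ρ) {k : ℕ}
    (hi : Integrable fun x => x ^ k * (1 / Real.cosh x) ^ M) :
    Integrable (fun ω => (fisherZ X Y ω - Real.artanh ρ) ^ k) P := by
  have hm := (continuous_fisherDensity hρ (M := M) (by omega)).measurable
  have hc : Continuous fun x : ℝ => x ^ k := continuous_pow k
  have hU := h.aemeasurable_fisherZ.sub_const (Real.artanh ρ)
  refine (integrable_map_measure (g := fun x : ℝ => x ^ k) hc.aestronglyMeasurable hU).1 ?_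
  rw [h.map_fisherZ_sub hρ hM hσ₁ hσ₂, integrable_withDensity_iff hm.ennreal_ofReal
    (Eventually.of_forall fun x => ENNReal.ofReal_lt_top)]
  simp only [ENNReal.toReal_ofReal (fisherDensity_nonneg ρ M _)]
  simp only [fisherDensity, ← mul_div_assoc]
  exact (integrable_mul_fisherWeight hρ hM hc hi).div_const _

theorem IsBivariateNormalSample.integral_fisherZ_pow (hρ : ρ ∈ Set.Ioo (-1 : ℝ) 1) (hM : 3 ≤ M)
    (hσ₁ : 0 < σ₁) (hσ₂ : 0 < σ₂) (h : IsBivariateNormalSample P X Y μ₁ μ₂ σ₁ σ₂ ρ) (k : ℕ) :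
    ∫ ω, (fisherZ X Y ω - Real.artanh ρ) ^ k ∂P = fisherZMoment ρ k M := by
  have hm := (continuous_fisherDensity hρ (M := M) (by omega)).measurable
  have hc : Continuous fun x : ℝ => x ^ k := continuous_pow k
  have hU := h.aemeasurable_fisherZ.sub_const (Real.artanh ρ)
  rw [← integral_map (f := fun x : ℝ => x ^ k) hU hc.aestronglyMeasurable,
    h.map_fisherZ_sub hρ hM hσ₁ hσ₂,
    integral_withDensity_eq_integral_toReal_smul hm.ennreal_ofReal
    (Eventually.of_forall fun x => ENNReal.ofReal_lt_top), fisherZMoment, ← integral_div]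
  refine integral_congr_ae (Eventually.of_forall fun x => ?_)
  simp only [ENNReal.toReal_ofReal (fisherDensity_nonneg ρ M _), smul_eq_mul]
  rw [fisherDensity]
  ring

theorem IsBivariateNormalSample.memLp_fisherZ (hρ : ρ ∈ Set.Ioo (-1 : ℝ) 1) (hM : 3 ≤ M)
    (hσ₁ : 0 < σ₁) (hσ₂ : 0 < σ₂) (h : IsBivariateNormalSample P X Y μ₁ μ₂ σ₁ σ₂ ρ)
    (hi : Integrable fun x => x ^ 4 * (1 / Real.cosh x) ^ M) : MemLp (fisherZ X Y) 4 P := by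
  have h4 := h.integrable_fisherZ_pow hρ hM hσ₁ hσ₂ hi
  have hU := h.aemeasurable_fisherZ.sub_const (Real.artanh ρ)
  have : MemLp (fun ω => fisherZ X Y ω - Real.artanh ρ) 4 P := by
    rw [← integrable_norm_rpow_iff hU.aestronglyMeasurable (by norm_num) (by norm_num)]
    refine h4.congr (Eventually.of_forall fun ω => ?_)
    simp only [ENNReal.toReal_ofNat, Real.norm_eq_abs]
    rw [show (4 : ℝ) = ((4 : ℕ) : ℝ) by norm_num, Real.rpow_natCast,
      Even.pow_abs ⟨2, rfl⟩]
  convert this.add (memLp_const (Real.artanh ρ)) using 1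
  ext ω
  simp

/-- The central moments of the Fisher transformation. -/
theorem IsBivariateNormalSample.fisherZ_moments (hρ : ρ ∈ Set.Ioo (-1 : ℝ) 1) (hM : 3 ≤ M)
    (hσ₁ : 0 < σ₁) (hσ₂ : 0 < σ₂) (h : IsBivariateNormalSample P X Y μ₁ μ₂ σ₁ σ₂ ρ)
    (hi : Integrable fun x => x ^ 4 * (1 / Real.cosh x) ^ M) :
    ∫ ω, fisherZ X Y ω ∂P = Real.artanh ρ + fisherZMoment ρ 1 M ∧
    variance (fisherZ X Y) P = fisherZMoment ρ 2 M - fisherZMoment ρ 1 M ^ 2 ∧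
    centralMoment (fisherZ X Y) 3 P = fisherZMoment ρ 3 M -
      3 * fisherZMoment ρ 1 M * fisherZMoment ρ 2 M + 2 * fisherZMoment ρ 1 M ^ 3 ∧
    centralMoment (fisherZ X Y) 4 P = fisherZMoment ρ 4 M -
      4 * fisherZMoment ρ 1 M * fisherZMoment ρ 3 M +
      6 * fisherZMoment ρ 1 M ^ 2 * fisherZMoment ρ 2 M - 3 * fisherZMoment ρ 1 M ^ 4 := by
  have hL := h.memLp_fisherZ hρ hM hσ₁ hσ₂ hi
  have hU : MemLp (fun ω => fisherZ X Y ω - Real.artanh ρ) 4 P := hL.sub (memLp_const _)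
  have ip : ∀ k ≤ 4, Integrable (fun ω => (fisherZ X Y ω - Real.artanh ρ) ^ k) P := fun k hk => by
    have hk' : MemLp (fun ω => fisherZ X Y ω - Real.artanh ρ) k P :=
      hU.mono_exponent (by exact_mod_cast hk)
    have := hk'.integrable_norm_pow'
    refine this.mono' ((h.aemeasurable_fisherZ.sub_const _).pow_const k).aestronglyMeasurable
      (Eventually.of_forall fun ω => by simp)
  have i1 := ip 1 (by norm_num)
  have i2 := ip 2 (by norm_num)
  have i3 := ip 3 (by norm_num)
  have i4 := ip 4 (by norm_num)
  have m := h.integral_fisherZ_pow hρ hM hσ₁ hσ₂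
  have m1 := m 1
  have m2 := m 2
  have m3 := m 3
  have m4 := m 4
  set U := fun ω => fisherZ X Y ω - Real.artanh ρ with hUdef
  set a := fisherZMoment ρ 1 M
  have hE : ∫ ω, fisherZ X Y ω ∂P = Real.artanh ρ + a := by
    simp only [pow_one] at m1 i1
    rw [← m1, integral_sub (hL.integrable (by norm_num)) (integrable_const _)]
    simp
  refine ⟨hE, ?_, ?_, ?_⟩
  · rw [variance_eq_integral hL.1.aemeasurable, hE]
    have : ∀ ω, (fisherZ X Y ω - (Real.artanh ρ + a)) ^ 2 =
        U ω ^ 2 - 2 * a * U ω ^ 1 + a ^ 2 := fun ω => by simp only [hUdef]; ring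
    simp only [this]
    have s1 : Integrable (fun ω => U ω ^ 2 - 2 * a * U ω ^ 1) P := i2.sub (i1.const_mul _)
    rw [integral_add s1 (integrable_const _), integral_sub i2 (i1.const_mul _), integral_const_mul, m1, m2]
    simp
    ring
  · simp only [centralMoment, hE, Pi.pow_apply, Pi.sub_apply]
    have : ∀ ω, (fisherZ X Y ω - (Real.artanh ρ + a)) ^ 3 =
        U ω ^ 3 - 3 * a * U ω ^ 2 + 3 * a ^ 2 * U ω ^ 1 - a ^ 3 := fun ω => by
      simp only [hUdef]; ring
    simp only [this]
    have s1 : Integrable (fun ω => U ω ^ 3 - 3 * a * U ω ^ 2) P := i3.sub (i2.const_mul _)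
    have s2 : Integrable (fun ω => U ω ^ 3 - 3 * a * U ω ^ 2 + 3 * a ^ 2 * U ω ^ 1) P :=
      s1.add (i1.const_mul _)
    rw [integral_sub s2 (integrable_const _), integral_add s1 (i1.const_mul _),
      integral_sub i3 (i2.const_mul _), integral_const_mul, integral_const_mul, m1, m2, m3]
    simp
    ring
  · simp only [centralMoment, hE, Pi.pow_apply, Pi.sub_apply]
    have : ∀ ω, (fisherZ X Y ω - (Real.artanh ρ + a)) ^ 4 =
        U ω ^ 4 - 4 * a * U ω ^ 3 + 6 * a ^ 2 * U ω ^ 2 - 4 * a ^ 3 * U ω ^ 1 + a ^ 4 := fun ω => by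
      simp only [hUdef]; ring
    simp only [this]
    have s1 : Integrable (fun ω => U ω ^ 4 - 4 * a * U ω ^ 3) P := i4.sub (i3.const_mul _)
    have s2 : Integrable (fun ω => U ω ^ 4 - 4 * a * U ω ^ 3 + 6 * a ^ 2 * U ω ^ 2) P :=
      s1.add (i2.const_mul _)
    have s3 : Integrable (fun ω => U ω ^ 4 - 4 * a * U ω ^ 3 + 6 * a ^ 2 * U ω ^ 2 -
      4 * a ^ 3 * U ω ^ 1) P := s2.sub (i1.const_mul _)
    rw [integral_add s3 (integrable_const _), integral_sub s2 (i1.const_mul _),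
      integral_add s1 (i2.const_mul _),
      integral_sub i4 (i3.const_mul _), integral_const_mul, integral_const_mul,
      integral_const_mul, m1, m2, m3, m4]
    simp
    ring

end

/-! ### Densities of the standardized variable and of r. -/

/-- The density of the standardized Fisher transformation of a sample of size `M + 2`. -/
noncomputable def standardizedFisherDensity (ρ : ℝ) (M : ℕ) (z : ℝ) : ℝ :=
  √(fisherVar ρ (M + 2)) *
    fisherDensity ρ M (ρ / (2 * ((M + 2 : ℕ) : ℝ)) + √(fisherVar ρ (M + 2)) * z)

theorem standardizedFisherDensity_nonneg (ρ : ℝ) (M : ℕ) (z : ℝ) :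
    0 ≤ standardizedFisherDensity ρ M z :=
  mul_nonneg (Real.sqrt_nonneg _) (fisherDensity_nonneg _ _ _)

theorem continuous_standardizedFisherDensity {ρ : ℝ} (hρ : ρ ∈ Set.Ioo (-1 : ℝ) 1) {M : ℕ}
    (hM : 1 ≤ M) : Continuous (standardizedFisherDensity ρ M) :=
  continuous_const.mul ((continuous_fisherDensity hρ hM).comp (by fun_prop))

theorem fisherVar_pos {ρ : ℝ} (hρ : ρ ∈ Set.Ioo (-1 : ℝ) 1) (n : ℕ) (hn : 0 < n) :
    0 < fisherVar ρ n := by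
  have : (0 : ℝ) < n := by exact_mod_cast hn
  have : 0 < 6 - ρ ^ 2 := by nlinarith [hρ.1, hρ.2]
  unfold fisherVar
  positivity

theorem lintegral_eq_lintegral_comp_affine (a : ℝ) {s : ℝ} (hs : 0 < s) (F : ℝ → ENNReal) :
    ∫⁻ x, F x = ∫⁻ z, ENNReal.ofReal s * F (a + s * z) := by
  have hd : ∀ z ∈ Set.univ, HasDerivWithinAt (fun z : ℝ => a + s * z) s Set.univ z := fun z _ =>
    (((hasDerivAt_id z).const_mul s).const_add a).hasDerivWithinAt.congr_deriv (mul_one s)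
  have hinj : Set.InjOn (fun z : ℝ => a + s * z) Set.univ := fun x _ y _ hxy => by
    simpa [hs.ne'] using hxy
  have h := lintegral_image_eq_lintegral_abs_deriv_mul MeasurableSet.univ hd hinj F
  have hr : (fun z : ℝ => a + s * z) '' Set.univ = Set.univ := by
    refine Set.eq_univ_of_forall fun x => ⟨(x - a) / s, trivial, ?_⟩
    field_simp
    ring
  rwa [hr, setLIntegral_univ, setLIntegral_univ, abs_of_pos hs] at h

theorem range_tanh_eq : Real.tanh '' Set.univ = Set.Ioo (-1) 1 := by
  ext r
  constructor
  · rintro ⟨x, -, rfl⟩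
    exact ⟨Real.neg_one_lt_tanh x, Real.tanh_lt_one x⟩
  · exact fun hr => ⟨Real.artanh r, trivial, Real.tanh_artanh hr⟩

theorem lintegral_Ioo_eq_lintegral_comp_tanh (F : ℝ → ENNReal) :
    ∫⁻ r in Set.Ioo (-1) 1, F r =
      ∫⁻ x, ENNReal.ofReal (1 - Real.tanh x ^ 2) * F (Real.tanh x) := by
  have hinj : Set.InjOn Real.tanh Set.univ := fun x _ y _ hxy => by
    rw [← Real.artanh_tanh x, hxy, Real.artanh_tanh]
  have h := lintegral_image_eq_lintegral_abs_deriv_mul MeasurableSet.univ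
    (fun x _ => (hasDerivAt_tanh x).hasDerivWithinAt) hinj F
  rw [range_tanh_eq, setLIntegral_univ] at h
  rw [h]
  refine lintegral_congr fun x => ?_
  have := abs_lt.1 (Real.abs_tanh_lt_one x)
  rw [abs_of_nonneg (by nlinarith)]

theorem continuousOn_artanh : ContinuousOn Real.artanh (Set.Ioo (-1) 1) := by
  unfold Real.artanh
  refine ContinuousOn.log (ContinuousOn.sqrt (ContinuousOn.div (by fun_prop) (by fun_prop) ?_)) ?_
  · intro x hx
    linarith [hx.2]
  · intro x hx
    have h1 : 0 < 1 + x := by linarith [hx.1]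
    have h2 : 0 < 1 - x := by linarith [hx.2]
    positivity

section

variable {ρ : ℝ} {M : ℕ} {Ω : Type*} [MeasurableSpace Ω] {P : Measure Ω} [IsProbabilityMeasure P]
  {X Y : Fin (M + 2) → Ω → ℝ} {μ₁ μ₂ σ₁ σ₂ : ℝ}

theorem IsBivariateNormalSample.map_standardized_fisherZ (hρ : ρ ∈ Set.Ioo (-1 : ℝ) 1)
    (hM : 3 ≤ M) (hσ₁ : 0 < σ₁) (hσ₂ : 0 < σ₂)
    (h : IsBivariateNormalSample P X Y μ₁ μ₂ σ₁ σ₂ ρ) :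
    P.map (fun ω => (fisherZ X Y ω - fisherMean ρ (M + 2)) / √(fisherVar ρ (M + 2))) =
      volume.withDensity fun z => ENNReal.ofReal (standardizedFisherDensity ρ M z) := by
  have hV := Real.sqrt_pos.2 (fisherVar_pos hρ (M + 2) (by omega))
  have hm := (continuous_standardizedFisherDensity hρ (M := M) (by omega)).measurable
  refine Measure.ext_of_lintegral _ fun F hF => ?_
  rw [lintegral_map' hF.aemeasurable ((h.aemeasurable_fisherZ.sub_const _).div_const _),
    h.lintegral_fisherZ (F := fun z => F ((z - fisherMean ρ (M + 2)) / √(fisherVar ρ (M + 2))))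
      hρ hM hσ₁ hσ₂ (hF.comp ((measurable_id.sub_const _).div_const _)),
    lintegral_withDensity_eq_lintegral_mul _ hm.ennreal_ofReal hF,
    lintegral_eq_lintegral_comp_affine (ρ / (2 * ((M + 2 : ℕ) : ℝ))) hV]
  refine lintegral_congr fun z => ?_
  have e : (Real.artanh ρ + (ρ / (2 * ((M + 2 : ℕ) : ℝ)) + √(fisherVar ρ (M + 2)) * z) -
      fisherMean ρ (M + 2)) / √(fisherVar ρ (M + 2)) = z := by
    rw [div_eq_iff hV.ne', fisherMean]
    ring
  rw [e, Pi.mul_apply, standardizedFisherDensity, ENNReal.ofReal_mul hV.le]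
  ring

/-- The density of the correlation coefficient of a sample of size `M + 2`. -/
noncomputable def sampleCorrDensity (ρ : ℝ) (M : ℕ) (r : ℝ) : ℝ :=
  standardizedFisherDensity ρ M
    ((Real.artanh r - fisherMean ρ (M + 2)) / √(fisherVar ρ (M + 2))) /
      ((1 - r ^ 2) * √(fisherVar ρ (M + 2)))

theorem continuousOn_sampleCorrDensity (hρ : ρ ∈ Set.Ioo (-1 : ℝ) 1) (hM : 1 ≤ M) :
    ContinuousOn (sampleCorrDensity ρ M) (Set.Ioo (-1) 1) := by
  have hV := Real.sqrt_pos.2 (fisherVar_pos hρ (M + 2) (by omega))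
  refine ContinuousOn.div ((continuous_standardizedFisherDensity hρ hM).comp_continuousOn
    ((continuousOn_artanh.sub continuousOn_const).div_const _)) (by fun_prop) fun r hr => ?_
  have : 0 < 1 - r ^ 2 := by nlinarith [hr.1, hr.2]
  positivity

theorem sampleCorrDensity_nonneg {r : ℝ} (hr : r ∈ Set.Ioo (-1 : ℝ) 1) :
    0 ≤ sampleCorrDensity ρ M r := by
  have : 0 < 1 - r ^ 2 := by nlinarith [hr.1, hr.2]
  have := standardizedFisherDensity_nonneg ρ M
    ((Real.artanh r - fisherMean ρ (M + 2)) / √(fisherVar ρ (M + 2)))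
  unfold sampleCorrDensity
  positivity

/-- Change variables r = tanh: the Jacobian 1 - tanh² cancels the factor 1 - r² in the density, and
the standardization cancels √V. -/
theorem IsBivariateNormalSample.map_sampleCorr (hρ : ρ ∈ Set.Ioo (-1 : ℝ) 1)
    (hM : 3 ≤ M) (hσ₁ : 0 < σ₁) (hσ₂ : 0 < σ₂)
    (h : IsBivariateNormalSample P X Y μ₁ μ₂ σ₁ σ₂ ρ) :
    P.map (fun ω => sampleCorr (fun i => X i ω) (fun i => Y i ω)) =
      (volume.restrict (Set.Ioo (-1) 1)).withDensity
        fun r => ENNReal.ofReal (sampleCorrDensity ρ M r) := by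
  have hV := Real.sqrt_pos.2 (fisherVar_pos hρ (M + 2) (by omega))
  have hm := (continuous_standardizedFisherDensity hρ (M := M) (by omega)).measurable
  have hm' : Measurable (sampleCorrDensity ρ M) :=
    (hm.comp ((measurable_artanh.sub_const _).div_const _)).div (by fun_prop)
  refine Measure.ext_of_lintegral _ fun F hF => ?_
  rw [lintegral_map' hF.aemeasurable h.aemeasurable_sampleCorr,
    h.lintegral_sampleCorr_eq_fisherDensity hρ hM hσ₁ hσ₂ hF,
    lintegral_withDensity_eq_lintegral_mul _ hm'.ennreal_ofReal hF,
    lintegral_Ioo_eq_lintegral_comp_tanh]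
  refine Eq.trans (lintegral_congr fun x => ?_)
    (lintegral_add_left_eq_self (μ := volume) _ (Real.artanh ρ))
  have ht := abs_lt.1 (Real.abs_tanh_lt_one (Real.artanh ρ + x))
  have ht2 : 0 < 1 - Real.tanh (Real.artanh ρ + x) ^ 2 := by nlinarith
  have e : ρ / (2 * ((M + 2 : ℕ) : ℝ)) + √(fisherVar ρ (M + 2)) *
      ((Real.artanh ρ + x - fisherMean ρ (M + 2)) / √(fisherVar ρ (M + 2))) = x := by
    rw [mul_div_cancel₀ _ hV.ne', fisherMean]
    ring
  rw [Pi.mul_apply, sampleCorrDensity, standardizedFisherDensity, Real.artanh_tanh, e, ← mul_assoc,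
    ← ENNReal.ofReal_mul ht2.le, mul_comm]
  congr 2
  field_simp

end

/-! ### Expansions in M^(-1/2) with constants of polynomial growth. -/

/-- `F M z = O(M ^ (-j / 2))` with constants of polynomial growth in `z`. -/
def PolyO (j : ℕ) (F : ℕ → ℝ → ℝ) : Prop :=
  ∃ (C : ℝ) (K : ℕ), 0 ≤ C ∧ ∀ᶠ M : ℕ in atTop, ∀ z, |F M z| ≤ C * (√(M : ℝ))⁻¹ ^ j * (1 + z ^ 2) ^ K

theorem inv_sqrt_natCast_le_one (M : ℕ) : (√(M : ℝ))⁻¹ ≤ 1 := by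
  rcases Nat.eq_zero_or_pos M with rfl | h
  · simp
  · exact inv_le_one_of_one_le₀ (Real.one_le_sqrt.2 (by exact_mod_cast h))

theorem inv_sqrt_natCast_sq (M : ℕ) : (√(M : ℝ))⁻¹ ^ 2 = (M : ℝ)⁻¹ := by
  rw [inv_pow, Real.sq_sqrt (Nat.cast_nonneg M)]

namespace PolyO

variable {j k : ℕ} {F G : ℕ → ℝ → ℝ}

theorem mono (hF : PolyO j F) (h : k ≤ j) : PolyO k F := by
  obtain ⟨C, K, hC, hb⟩ := hF
  refine ⟨C, K, hC, hb.mono fun M hM z => (hM z).trans ?_⟩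
  have := pow_le_pow_of_le_one (by positivity) (inv_sqrt_natCast_le_one M) h
  gcongr

theorem add (hF : PolyO j F) (hG : PolyO j G) : PolyO j fun M z => F M z + G M z := by
  obtain ⟨C, K, hC, hb⟩ := hF
  obtain ⟨D, L, hD, hd⟩ := hG
  refine ⟨C + D, max K L, by positivity, ?_⟩
  filter_upwards [hb, hd] with M h1 h2 z
  have hz : 1 ≤ 1 + z ^ 2 := by nlinarith [sq_nonneg z]
  calc |F M z + G M z| ≤ |F M z| + |G M z| := abs_add_le _ _
    _ ≤ C * (√(M : ℝ))⁻¹ ^ j * (1 + z ^ 2) ^ K + D * (√(M : ℝ))⁻¹ ^ j * (1 + z ^ 2) ^ L :=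
        add_le_add (h1 z) (h2 z)
    _ ≤ C * (√(M : ℝ))⁻¹ ^ j * (1 + z ^ 2) ^ max K L +
        D * (√(M : ℝ))⁻¹ ^ j * (1 + z ^ 2) ^ max K L := by
      gcongr
      · exact le_max_left _ _
      · exact le_max_right _ _
    _ = _ := by ring

theorem mul (hF : PolyO j F) (hG : PolyO k G) : PolyO (j + k) fun M z => F M z * G M z := by
  obtain ⟨C, K, hC, hb⟩ := hF
  obtain ⟨D, L, hD, hd⟩ := hG
  refine ⟨C * D, K + L, by positivity, ?_⟩
  filter_upwards [hb, hd] with M h1 h2 z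
  rw [abs_mul]
  calc |F M z| * |G M z| ≤ (C * (√(M : ℝ))⁻¹ ^ j * (1 + z ^ 2) ^ K) *
        (D * (√(M : ℝ))⁻¹ ^ k * (1 + z ^ 2) ^ L) :=
        mul_le_mul (h1 z) (h2 z) (abs_nonneg _) (by positivity)
    _ = _ := by ring

theorem of_le (hG : PolyO j G) (h : ∀ᶠ M in atTop, ∀ z, |F M z| ≤ |G M z|) : PolyO j F := by
  obtain ⟨D, L, hD, hd⟩ := hG
  refine ⟨D, L, hD, ?_⟩
  filter_upwards [h, hd] with M h1 h2 z
  exact (h1 z).trans (h2 z)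

theorem congr (hF : PolyO j F) (h : ∀ᶠ M in atTop, ∀ z, G M z = F M z) : PolyO j G :=
  hF.of_le (h.mono fun M hM z => by rw [hM])

theorem const (c : ℝ) : PolyO 0 fun _ _ => c :=
  ⟨|c|, 0, abs_nonneg c, Eventually.of_forall fun M z => by simp⟩

theorem id : PolyO 0 fun _ z => z :=
  ⟨1, 1, zero_le_one, Eventually.of_forall fun M z => by
    simp only [pow_zero, one_mul, pow_one]
    exact abs_le.2 ⟨by nlinarith [sq_nonneg (z + 1)], by nlinarith [sq_nonneg (z - 1)]⟩⟩

theorem const_mul (c : ℝ) (hF : PolyO j F) : PolyO j fun M z => c * F M z :=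
  ((const c).mul hF).mono (by omega)

theorem pow (hF : PolyO j F) (i : ℕ) : PolyO (j * i) fun M z => F M z ^ i := by
  induction i with
  | zero => exact (const 1).congr (Eventually.of_forall fun M z => by simp)
  | succ i ih => exact (ih.mul hF).congr (Eventually.of_forall fun M z => by ring)

theorem abs (hF : PolyO j F) : PolyO j fun M z => |F M z| :=
  hF.of_le (Eventually.of_forall fun M z => by simp)

theorem inv_sqrt : PolyO 1 fun M _ => (√(M : ℝ))⁻¹ :=
  ⟨1, 0, zero_le_one, Eventually.of_forall fun M z => by
    rw [abs_of_nonneg (by positivity)]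
    simp⟩

theorem of_isBigO {a : ℕ → ℝ} (h : a =O[atTop] fun M : ℕ => (M : ℝ)⁻¹ ^ j) :
    PolyO (2 * j) fun M _ => a M := by
  obtain ⟨C, hC, hb⟩ := h.exists_nonneg
  refine ⟨C, 0, hC, hb.bound.mono fun M hM z => ?_⟩
  rw [Real.norm_eq_abs, Real.norm_of_nonneg (by positivity)] at hM
  rw [pow_mul, inv_sqrt_natCast_sq]
  simpa using hM

/-- The bound is uniform after multiplication by a rapidly decreasing function. -/
theorem exists_mul_le (hF : PolyO j F) {S : ℕ → ℝ → ℝ} (hS0 : ∀ M z, 0 ≤ S M z)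
    (hS : ∀ K : ℕ, ∃ D : ℝ, ∀ᶠ M in atTop, ∀ z, (1 + z ^ 2) ^ K * S M z ≤ D) :
    ∃ C : ℝ, 0 ≤ C ∧ ∀ᶠ M : ℕ in atTop, ∀ z, |F M z| * S M z ≤ C * (√(M : ℝ))⁻¹ ^ j := by
  obtain ⟨C, K, hC, hb⟩ := hF
  obtain ⟨D, hD⟩ := hS K
  refine ⟨C * |D|, by positivity, ?_⟩
  filter_upwards [hb, hD] with M h1 h2 z
  calc |F M z| * S M z ≤ C * (√(M : ℝ))⁻¹ ^ j * (1 + z ^ 2) ^ K * S M z := by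
        gcongr
        · exact hS0 M z
        · exact h1 z
    _ = C * (√(M : ℝ))⁻¹ ^ j * ((1 + z ^ 2) ^ K * S M z) := by ring
    _ ≤ C * (√(M : ℝ))⁻¹ ^ j * |D| := by
        gcongr
        exact (h2 z).trans (le_abs_self D)
    _ = _ := by ring

end PolyO

/-- `F M z = f₀ z + f₁ z / √M + f₂ z / M + O(M ^ (-3 / 2))`, with constants of polynomial growth. -/
structure PolyJet (F : ℕ → ℝ → ℝ) (f₀ f₁ f₂ : ℝ → ℝ) : Prop where
  zero : PolyO 0 fun _ => f₀
  one : PolyO 0 fun _ => f₁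
  two : PolyO 0 fun _ => f₂
  rem : PolyO 3 fun M z => F M z - (f₀ z + (√(M : ℝ))⁻¹ * f₁ z + (M : ℝ)⁻¹ * f₂ z)

theorem PolyO.inv_natCast : PolyO 2 fun M _ => (M : ℝ)⁻¹ :=
  (inv_sqrt.pow 2).congr (Eventually.of_forall fun M _ => (inv_sqrt_natCast_sq M).symm)

namespace PolyJet

variable {F G : ℕ → ℝ → ℝ} {f₀ f₁ f₂ g₀ g₁ g₂ : ℝ → ℝ}

theorem polyO (hF : PolyJet F f₀ f₁ f₂) : PolyO 0 F :=
  ((hF.rem.mono (by omega)).add ((hF.zero.add ((PolyO.inv_sqrt.mul hF.one).mono (by omega))).add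
    ((PolyO.inv_natCast.mul hF.two).mono (by omega)))).congr
    (Eventually.of_forall fun M z => by ring)

theorem polyO_one (hF : PolyJet F (fun _ => 0) f₁ f₂) : PolyO 1 F :=
  ((hF.rem.mono (by omega)).add (((PolyO.inv_sqrt.mul hF.one).mono (by omega)).add
    ((PolyO.inv_natCast.mul hF.two).mono (by omega)))).congr
    (Eventually.of_forall fun M z => by ring)

theorem of_sub (hG : PolyJet G g₀ g₁ g₂) (h : PolyO 3 fun M z => F M z - G M z) :
    PolyJet F g₀ g₁ g₂ :=
  ⟨hG.zero, hG.one, hG.two, (h.add hG.rem).congr (Eventually.of_forall fun M z => by ring)⟩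

theorem congr (hG : PolyJet G g₀ g₁ g₂) (h : ∀ᶠ M in atTop, ∀ z, F M z = G M z)
    (h₀ : ∀ z, f₀ z = g₀ z) (h₁ : ∀ z, f₁ z = g₁ z) (h₂ : ∀ z, f₂ z = g₂ z) :
    PolyJet F f₀ f₁ f₂ := by
  rw [funext h₀, funext h₁, funext h₂]
  exact ⟨hG.zero, hG.one, hG.two, hG.rem.congr (h.mono fun M hM z => by rw [hM])⟩

theorem add (hF : PolyJet F f₀ f₁ f₂) (hG : PolyJet G g₀ g₁ g₂) :
    PolyJet (fun M z => F M z + G M z) (fun z => f₀ z + g₀ z) (fun z => f₁ z + g₁ z)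
      (fun z => f₂ z + g₂ z) :=
  ⟨hF.zero.add hG.zero, hF.one.add hG.one, hF.two.add hG.two,
    (hF.rem.add hG.rem).congr (Eventually.of_forall fun M z => by ring)⟩

theorem mul (hF : PolyJet F f₀ f₁ f₂) (hG : PolyJet G g₀ g₁ g₂) :
    PolyJet (fun M z => F M z * G M z) (fun z => f₀ z * g₀ z)
      (fun z => f₀ z * g₁ z + f₁ z * g₀ z) (fun z => f₀ z * g₂ z + f₁ z * g₁ z + f₂ z * g₀ z) := by
  refine ⟨hF.zero.mul hG.zero, (hF.zero.mul hG.one).add (hF.one.mul hG.zero),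
    ((hF.zero.mul hG.two).add (hF.one.mul hG.one)).add (hF.two.mul hG.zero), ?_⟩
  have h1 := hF.rem.mul hG.polyO
  have h2 := (hF.zero.mul hG.rem).mono (k := 3) (by omega)
  have h3 := ((PolyO.inv_sqrt.mul hF.one).mul hG.rem).mono (k := 3) (by omega)
  have h4 := ((PolyO.inv_natCast.mul hF.two).mul hG.rem).mono (k := 3) (by omega)
  have c12 := ((PolyO.inv_natCast.mul PolyO.inv_sqrt).mul
    ((hF.one.mul hG.two).add (hF.two.mul hG.one))).mono (k := 3) (by omega)
  have c22 := ((PolyO.inv_natCast.mul PolyO.inv_natCast).mul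
    (hF.two.mul hG.two)).mono (k := 3) (by omega)
  refine (((((h1.add h2).add h3).add h4).add c12).add c22).congr
    (Eventually.of_forall fun M z => ?_)
  -- The product of the two M^(-1/2) terms belongs to order 1/M.
  have e := inv_sqrt_natCast_sq M
  linear_combination (f₁ z * g₁ z) * e

theorem const (c : ℝ) : PolyJet (fun _ _ => c) (fun _ => c) (fun _ => 0) (fun _ => 0) :=
  ⟨PolyO.const c, PolyO.const 0, PolyO.const 0, ⟨0, 0, le_rfl, by simp⟩⟩

theorem id : PolyJet (fun _ z => z) (fun z => z) (fun _ => 0) (fun _ => 0) :=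
  ⟨PolyO.id, PolyO.const 0, PolyO.const 0, ⟨0, 0, le_rfl, by simp⟩⟩

theorem inv_sqrt : PolyJet (fun M _ => (√(M : ℝ))⁻¹) (fun _ => 0) (fun _ => 1) (fun _ => 0) :=
  ⟨PolyO.const 0, PolyO.const 1, PolyO.const 0, ⟨0, 0, le_rfl, by simp⟩⟩

theorem inv_natCast : PolyJet (fun M _ => (M : ℝ)⁻¹) (fun _ => 0) (fun _ => 0) (fun _ => 1) :=
  ⟨PolyO.const 0, PolyO.const 0, PolyO.const 1, ⟨0, 0, le_rfl, by simp⟩⟩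

theorem of_firstJet {a : ℕ → ℝ} {c d : ℝ} (h : FirstJet a c d) :
    PolyJet (fun M _ => a M) (fun _ => c) (fun _ => 0) (fun _ => d) :=
  ⟨PolyO.const c, PolyO.const 0, PolyO.const d, ((PolyO.of_isBigO h).mono (by omega)).congr
    (Eventually.of_forall fun M z => by ring)⟩

theorem inv_sqrt_mul_of_zerothJet {a : ℕ → ℝ} {c : ℝ} (h : ZerothJet a c) :
    PolyJet (fun M _ => (√(M : ℝ))⁻¹ * a M) (fun _ => 0) (fun _ => c) (fun _ => 0) := by
  have h' : (fun M => a M - c) =O[atTop] fun M : ℕ => (M : ℝ)⁻¹ ^ 1 := by simpa [ZerothJet] using h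
  exact ⟨PolyO.const 0, PolyO.const c, PolyO.const 0,
    (PolyO.inv_sqrt.mul (PolyO.of_isBigO h')).congr
    (Eventually.of_forall fun M z => by ring)⟩

end PolyJet

/-! ### Asymptotics of the normalising constant. -/

/-- First √a - 1 = O(a - 1), because √a + 1 ≥ 1; then √a = 1 + (a - 1)/2 - (√a - 1)²/2 exactly. -/
theorem FirstJet.sqrt {a : ℕ → ℝ} {d : ℝ} (ha : FirstJet a 1 d) :
    FirstJet (fun M => √(a M)) 1 (d / 2) := by
  have ht := ha.zeroth.tendsto
  have h0 : (fun M => √(a M) - 1) =O[atTop] fun M : ℕ => (M : ℝ)⁻¹ := by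
    refine (IsBigO.of_bound 1 ?_).trans ha.zeroth
    filter_upwards [ht.eventually_const_lt one_pos] with M hM
    have h1 := Real.sqrt_nonneg (a M)
    have h2 : a M - 1 = (√(a M) - 1) * (√(a M) + 1) := by
      linear_combination -(Real.sq_sqrt hM.le)
    rw [one_mul, h2, norm_mul]
    refine le_mul_of_one_le_right (norm_nonneg _) ?_
    rw [Real.norm_of_nonneg (by linarith)]
    linarith
  have h1 := (IsBigO.const_mul_left ha (1 / 2)).add ((h0.mul h0).const_mul_left (-(1 / 2)) |>.congr_right
    fun M => (sq _).symm)
  refine IsBigO.congr' h1 ?_ EventuallyEq.rfl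
  filter_upwards [ht.eventually_const_lt one_pos] with M hM
  linear_combination (-(1 / 2)) * (Real.sq_sqrt hM.le)

theorem monotone_tanh : Monotone Real.tanh := by
  refine monotone_of_hasDerivAt_nonneg hasDerivAt_tanh fun x => ?_
  have := abs_lt.1 (Real.abs_tanh_lt_one x)
  simp only [Pi.zero_apply]
  nlinarith

theorem tendsto_tanh_atTop : Tendsto Real.tanh atTop (nhds 1) := by
  refine tendsto_atTop_isLUB monotone_tanh ?_
  rw [← Set.image_univ, range_tanh_eq]
  exact isLUB_Ioo (by norm_num)

theorem tendsto_tanh_atBot : Tendsto Real.tanh atBot (nhds (-1)) := by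
  refine tendsto_atBot_isGLB monotone_tanh ?_
  rw [← Set.image_univ, range_tanh_eq]
  exact isGLB_Ioo (by norm_num)

theorem tendsto_sinh_atTop : Tendsto Real.sinh atTop atTop := Real.sinhOrderIso.tendsto_atTop

theorem tendsto_sinh_atBot : Tendsto Real.sinh atBot atBot := Real.sinhOrderIso.tendsto_atBot

theorem tendsto_sech_atTop : Tendsto (fun x => 1 / Real.cosh x) atTop (nhds 0) := by
  simp only [one_div]
  exact (tendsto_atTop_mono (fun x => (Real.sinh_lt_cosh x).le)
    tendsto_sinh_atTop).inv_tendsto_atTop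

theorem tendsto_sech_atBot : Tendsto (fun x => 1 / Real.cosh x) atBot (nhds 0) := by
  have := tendsto_sech_atTop.comp tendsto_neg_atBot_atTop
  simpa [Function.comp_def] using this

theorem sechMass_two : sechMass 2 = 2 := by
  have h := integral_of_hasDerivAt_of_tendsto (fun x => hasDerivAt_tanh x)
    ((integrable_sech_pow le_rfl).congr (Eventually.of_forall fun x => sech_sq x))
    tendsto_tanh_atBot tendsto_tanh_atTop
  unfold sechMass
  simp only [sech_sq]
  rw [h]
  norm_num

theorem sechMass_three : sechMass 3 = Real.pi / 2 := by
  have hd : ∀ x, HasDerivAt (fun x => (Real.tanh x * (1 / Real.cosh x) +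
      Real.arctan (Real.sinh x)) / 2) ((1 / Real.cosh x) ^ 3) x := fun x => by
    refine ((((hasDerivAt_tanh x).mul (hasDerivAt_sech x)).add
      (Real.hasDerivAt_sinh x).arctan).div_const 2).congr_deriv ?_
    have hc := Real.cosh_pos x
    have hs : Real.sinh x ^ 2 = Real.cosh x ^ 2 - 1 := by linarith [Real.cosh_sq x]
    have h1 : 1 + Real.sinh x ^ 2 = Real.cosh x ^ 2 := by linarith [Real.cosh_sq x]
    rw [h1, ← sech_sq, Real.tanh_eq_sinh_div_cosh]
    field_simp
    nlinarith
  have htop := ((tendsto_tanh_atTop.mul tendsto_sech_atTop).add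
    ((Real.tendsto_arctan_atTop.mono_right nhdsWithin_le_nhds).comp tendsto_sinh_atTop)).div_const 2
  have hbot := ((tendsto_tanh_atBot.mul tendsto_sech_atBot).add
    ((Real.tendsto_arctan_atBot.mono_right nhdsWithin_le_nhds).comp tendsto_sinh_atBot)).div_const 2
  have h := integral_of_hasDerivAt_of_tendsto hd (integrable_sech_pow (by omega)) hbot htop
  unfold sechMass
  rw [h]
  ring

/-- Wallis's product: by the recurrence the left side does not depend on M, and at M = 2 it is 2 · 2
· π/2. -/
theorem sechMass_mul_sechMass_succ {M : ℕ} (hM : 2 ≤ M) :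
    M * (sechMass M * sechMass (M + 1)) = 2 * Real.pi := by
  induction M, hM using Nat.le_induction with
  | base =>
    rw [sechMass_two, sechMass_three]
    push_cast
    ring
  | succ M hM ih =>
    have h := sechMass_add_two hM
    rw [← ih]
    push_cast
    linear_combination (sechMass (M + 1)) * h

/-- Log-convexity, i.e. Cauchy–Schwarz: the integral of sech^M (t - sech)² is a nonnegative
quadratic polynomial in t. -/
theorem sechMass_succ_sq_le {M : ℕ} (hM : 2 ≤ M) :
    sechMass (M + 1) ^ 2 ≤ sechMass M * sechMass (M + 2) := by
  have h : ∀ t : ℝ, 0 ≤ sechMass M * (t * t) + (-2 * sechMass (M + 1)) * t + sechMass (M + 2) := by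
    intro t
    have e : sechMass M * (t * t) + (-2 * sechMass (M + 1)) * t + sechMass (M + 2) =
        ∫ x, (1 / Real.cosh x) ^ M * (t - 1 / Real.cosh x) ^ 2 := by
      have i0 := (integrable_sech_pow (k := M) (by omega)).const_mul (t ^ 2)
      have i1 := (integrable_sech_pow (k := M + 1) (by omega)).const_mul (2 * t)
      have i2 := integrable_sech_pow (k := M + 2) (by omega)
      have i01 : Integrable fun x => t ^ 2 * (1 / Real.cosh x) ^ M -
        2 * t * (1 / Real.cosh x) ^ (M + 1) := i0.sub i1
      have : ∀ x, (1 / Real.cosh x) ^ M * (t - 1 / Real.cosh x) ^ 2 =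
          t ^ 2 * (1 / Real.cosh x) ^ M - 2 * t * (1 / Real.cosh x) ^ (M + 1) +
            (1 / Real.cosh x) ^ (M + 2) := fun x => by ring
      simp only [this]
      rw [integral_add i01 i2, integral_sub i0 i1, integral_const_mul, integral_const_mul]
      unfold sechMass
      ring
    rw [e]
    refine integral_nonneg fun x => ?_
    have := sech_pos x
    simp only [Pi.zero_apply]
    positivity
  have := discrim_le_zero h
  unfold discrim at this
  linarith

/-- Stirling-type expansion of `∫ sech ^ M`. -/
theorem firstJet_sechMass_sq :
    FirstJet (fun M => M * sechMass M ^ 2 / (2 * Real.pi)) 1 (1 / 2) := by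
  refine IsBigO.of_bound 1 ?_
  filter_upwards [eventually_ge_atTop 4] with M hM
  have hM4 : (4 : ℝ) ≤ M := by exact_mod_cast hM
  have hpi := Real.pi_pos
  obtain ⟨k, rfl⟩ : ∃ k, M = k + 1 := ⟨M - 1, by omega⟩
  have a0 := sechMass_pos (M := k) (by omega)
  have a1 := sechMass_pos (M := k + 1) (by omega)
  have a2 := sechMass_pos (M := k + 2) (by omega)
  have p1 := sechMass_mul_sechMass_succ (M := k + 1) (by omega)
  have r0 := sechMass_add_two (M := k) (by omega)
  have r1 := sechMass_add_two (M := k + 1) (by omega)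
  have l0 := sechMass_succ_sq_le (M := k) (by omega)
  have l1 := sechMass_succ_sq_le (M := k + 1) (by omega)
  rw [show k + 1 + 1 = k + 2 by ring] at p1 l1
  set m : ℝ := ((k + 1 : ℕ) : ℝ) with hm
  have hk : (k : ℝ) = m - 1 := by rw [hm]; push_cast; ring
  set a := sechMass (k + 1)
  set b := sechMass (k + 2)
  -- By Wallis's product the quantity to expand is r = a/b. Log-convexity at k and at k + 1 encloses
  -- it, 1 + 1/m ≤ r² ≤ 1/(1 - 1/m), so r lies within m⁻² of 1 + 1/(2m).
  have e : m * a ^ 2 / (2 * Real.pi) = a / b := by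
    rw [← p1]
    field_simp
  have hr0 : sechMass k = m * b / (m - 1) := by
    rw [eq_div_iff (by linarith)]
    rw [hk] at r0
    linarith
  have hr1 : sechMass (k + 1 + 2) = m * a / (m + 1) := by
    rw [eq_div_iff (by linarith)]
    linarith
  rw [hr0, div_mul_eq_mul_div, le_div_iff₀ (by linarith)] at l0
  rw [hr1, mul_div_assoc', le_div_iff₀ (by linarith)] at l1
  rw [e, Real.norm_eq_abs, Real.norm_of_nonneg (by positivity), one_mul]
  set r := a / b with hr
  have hab : a = r * b := by rw [hr]; field_simp
  have hr0 : 0 < r := by positivity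
  rw [hab] at l0 l1
  have h0 : r ^ 2 * (m - 1) ≤ m := by
    have : 0 < b ^ 2 := by positivity
    nlinarith
  have h1 : m + 1 ≤ r ^ 2 * m := by
    have : 0 < b ^ 2 := by positivity
    nlinarith
  obtain ⟨ε, hε⟩ : ∃ ε : ℝ, ε = m⁻¹ := ⟨_, rfl⟩
  have hme : m * ε = 1 := by rw [hε]; exact mul_inv_cancel₀ (by linarith)
  have hε0 : 0 < ε := by rw [hε]; positivity
  have hε4 : ε ≤ 1 / 4 := by nlinarith
  have g0 : r ^ 2 * (1 - ε) ≤ 1 := by nlinarith [mul_le_mul_of_nonneg_left h0 hε0.le]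
  have g1 : 1 + ε ≤ r ^ 2 := by nlinarith [mul_le_mul_of_nonneg_left h1 hε0.le]
  rw [← hε, abs_le]
  constructor
  · by_contra hn
    push Not at hn
    have : r < 1 + 1 / 2 * ε - ε ^ 2 := by linarith
    have h3 : r ^ 2 < (1 + 1 / 2 * ε - ε ^ 2) ^ 2 := by gcongr
    have h4 : (1 + 1 / 2 * ε - ε ^ 2) ^ 2 = 1 + ε - ε ^ 2 * (7 / 4 + ε * (1 - ε)) := by ring
    have h5 : 0 ≤ ε ^ 2 * (7 / 4 + ε * (1 - ε)) := by
      have : 0 < 1 - ε := by linarith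
      positivity
    linarith
  · by_contra hn
    push Not at hn
    have : 1 + 1 / 2 * ε + ε ^ 2 < r := by linarith
    have h3 : (1 + 1 / 2 * ε + ε ^ 2) ^ 2 < r ^ 2 := by gcongr
    have h4 : (1 + 1 / 2 * ε + ε ^ 2) ^ 2 * (1 - ε) = 1 + ε ^ 2 * (5 / 4 * (1 - ε) - ε ^ 3) := by
      ring
    have h5 : 0 ≤ ε ^ 2 * (5 / 4 * (1 - ε) - ε ^ 3) := by
      have : ε ^ 3 ≤ 1 / 4 := by
        calc ε ^ 3 ≤ (1 / 4) ^ 3 := by gcongr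
          _ ≤ _ := by norm_num
      exact mul_nonneg (sq_nonneg _) (by linarith)
    nlinarith

theorem firstJet_sechMass :
    FirstJet (fun M => √(M : ℝ) * sechMass M / √(2 * Real.pi)) 1 (1 / 4) := by
  have h := firstJet_sechMass_sq.sqrt
  rw [show (1 / 2 / 2 : ℝ) = 1 / 4 by norm_num] at h
  refine h.congr ?_
  filter_upwards [eventually_ge_atTop 2] with M hM
  rw [Real.sqrt_div (by positivity), Real.sqrt_mul (Nat.cast_nonneg M),
    Real.sqrt_sq (sechMass_pos hM).le]

theorem firstJet_fisherVar (ρ : ℝ) :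
    FirstJet (fun M => M * fisherVar ρ (M + 2)) 1 (1 - ρ ^ 2 / 2) := by
  have r := FirstJet.div_natCast_add 2
  have j := r.add ((r.zeroth.mul r.zeroth).inv_natCast_mul.const_mul ((6 - ρ ^ 2) / 2))
  convert j.congr (b := fun M => M * fisherVar ρ (M + 2)) ?_ using 1
  · ring
  · push_cast
    ring
  filter_upwards [eventually_gt_atTop 0] with M hM
  have : (M : ℝ) ≠ 0 := by positivity
  unfold fisherVar
  push_cast
  field_simp

/-! ### Pointwise Taylor bounds. -/

theorem abs_tanh_le_abs (x : ℝ) : |Real.tanh x| ≤ |x| := by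
  refine abs_le_of_deriv_le (f' := fun x => 1 - Real.tanh x ^ 2) (g' := fun _ => 1)
    (f := Real.tanh) (g := fun x => x) hasDerivAt_tanh hasDerivAt_id (by simp) (by simp)
    (fun x _ => ?_) (fun x _ => ?_) (fun x => by simp) (fun x => by simp) x
  · have := abs_lt.1 (Real.abs_tanh_lt_one x)
    nlinarith
  · nlinarith [sq_nonneg (Real.tanh x)]

theorem abs_id_sub_tanh_le (x : ℝ) : |x - Real.tanh x| ≤ |x| ^ 3 := by
  rw [← abs_pow]
  refine abs_le_of_deriv_le (f' := fun x => Real.tanh x ^ 2)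
    (g' := fun x => 3 * x ^ 2) (f := fun x => x - Real.tanh x) (g := fun x => x ^ 3)
    (fun x => ((hasDerivAt_id x).sub (hasDerivAt_tanh x)).congr_deriv (by ring))
    (fun x => (hasDerivAt_pow 3 x).congr_deriv (by norm_num)) (by simp) (by simp)
    (fun x _ => sq_nonneg _) (fun x _ => ?_) (fun x => ?_) (fun x => ?_) x
  · have h1 := sq_le_sq.2 (abs_tanh_le_abs x)
    nlinarith [sq_nonneg x]
  · rw [Real.tanh_neg, ← abs_neg]
    ring_nf
  · rw [← abs_neg]
    ring_nf

theorem abs_tanh_sub_le (x : ℝ) : |Real.tanh x - x + x ^ 3 / 3| ≤ |x ^ 5| := by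
  have hx2 : ∀ x : ℝ, Real.tanh x ^ 2 ≤ x ^ 2 := fun x => sq_le_sq.2 (abs_tanh_le_abs x)
  refine abs_le_of_deriv_le (f' := fun x => x ^ 2 - Real.tanh x ^ 2)
    (g' := fun x => 5 * x ^ 4) (f := fun x => Real.tanh x - x + x ^ 3 / 3) (g := fun x => x ^ 5)
    (fun x => (((hasDerivAt_tanh x).sub (hasDerivAt_id x)).add
      ((hasDerivAt_pow 3 x).div_const 3)).congr_deriv (by norm_num; ring))
    (fun x => (hasDerivAt_pow 5 x).congr_deriv (by norm_num)) (by simp) (by simp)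
    (fun x _ => sub_nonneg.2 (hx2 x)) (fun x hx => ?_) (fun x => ?_) (fun x => ?_) x
  · have h1 := abs_le.1 (abs_id_sub_tanh_le x)
    have h2 := abs_le.1 (abs_tanh_le_abs x)
    rw [abs_of_nonneg hx] at h1 h2
    have h3 : x ^ 2 - Real.tanh x ^ 2 = (x - Real.tanh x) * (x + Real.tanh x) := by ring
    rw [h3]
    calc (x - Real.tanh x) * (x + Real.tanh x) ≤ x ^ 3 * (x + x) := by
          refine mul_le_mul h1.2 (by linarith) (by linarith) (by positivity)
      _ ≤ _ := by nlinarith [sq_nonneg (x ^ 2)]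
  · rw [Real.tanh_neg, ← abs_neg]
    ring_nf
  · rw [← abs_neg]
    ring_nf

theorem hasDerivAt_log_cosh (x : ℝ) :
    HasDerivAt (fun x => Real.log (Real.cosh x)) (Real.tanh x) x := by
  have := (Real.hasDerivAt_cosh x).log (Real.cosh_pos x).ne'
  rwa [← Real.tanh_eq_sinh_div_cosh] at this

theorem abs_log_cosh_sub_le (x : ℝ) :
    |Real.log (Real.cosh x) - x ^ 2 / 2 + x ^ 4 / 12| ≤ x ^ 6 := by
  have hd : ∀ x, HasDerivAt (fun x => Real.log (Real.cosh x) - x ^ 2 / 2 + x ^ 4 / 12)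
      (Real.tanh x - x + x ^ 3 / 3) x := fun x =>
    (((hasDerivAt_log_cosh x).sub ((hasDerivAt_pow 2 x).div_const 2)).add
      ((hasDerivAt_pow 4 x).div_const 12)).congr_deriv (by norm_num; ring)
  have h6 : |x ^ 6| = x ^ 6 := abs_of_nonneg (by positivity)
  rw [← h6]
  have habs : ∀ x : ℝ, 0 ≤ x → 0 ≤ Real.tanh x - x + x ^ 3 / 3 := by
    have hm : MonotoneOn (fun x => Real.tanh x - x + x ^ 3 / 3) (Set.Ici 0) := by
      have hd' : ∀ x, HasDerivAt (fun x => Real.tanh x - x + x ^ 3 / 3)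
          (x ^ 2 - Real.tanh x ^ 2) x := fun x =>
        (((hasDerivAt_tanh x).sub (hasDerivAt_id x)).add
          ((hasDerivAt_pow 3 x).div_const 3)).congr_deriv (by norm_num; ring)
      refine monotoneOn_of_deriv_nonneg (convex_Ici 0)
        (fun y _ => (hd' y).continuousAt.continuousWithinAt)
        (fun y _ => (hd' y).differentiableAt.differentiableWithinAt) fun y _ => ?_
      rw [(hd' y).deriv]
      exact sub_nonneg.2 (sq_le_sq.2 (abs_tanh_le_abs y))
    intro x hx
    have := hm (Set.mem_Ici.2 le_rfl) (Set.mem_Ici.2 hx) hx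
    simpa using this
  refine abs_le_of_deriv_le (g' := fun x => 6 * x ^ 5) (g := fun x => x ^ 6) hd
    (fun x => (hasDerivAt_pow 6 x).congr_deriv (by norm_num)) (by simp) (by simp)
    (fun x hx => habs x hx) (fun x hx => ?_) (fun x => ?_) (fun x => ?_) x
  · have := (le_abs_self _).trans (abs_tanh_sub_le x)
    have h5 : 0 ≤ x ^ 5 := by positivity
    rw [abs_of_nonneg h5] at this
    linarith
  · rw [Real.cosh_neg]
    ring_nf
  · ring_nf

theorem sech_pow_eq_exp (x : ℝ) (M : ℕ) :
    (1 / Real.cosh x) ^ M = Real.exp (-(M * Real.log (Real.cosh x))) := by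
  rw [← mul_neg, Real.exp_nat_mul, Real.exp_neg, Real.exp_log (Real.cosh_pos x), one_div]

/-- Taylor's formula for |d| ≤ 1; beyond that every term is dominated by |d|³ or e^d. The weight 1 +
e^d, rather than e^|d|, becomes e^a + e^b in `abs_exp_sub_mul_le`, that is, the sum of two functions
known to decay. -/
theorem abs_exp_sub_quadratic_le (d : ℝ) :
    |Real.exp d - (1 + d + d ^ 2 / 2)| ≤ 3 * |d| ^ 3 * (1 + Real.exp d) := by
  have he := Real.exp_pos d
  have hd3 : 0 ≤ |d| ^ 3 := by positivity
  rcases le_or_gt |d| 1 with h | h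
  · have h1 := Real.exp_bound h (n := 3) (by norm_num)
    norm_num [Finset.sum_range_succ, Nat.factorial] at h1
    nlinarith
  · have h3 : 1 ≤ |d| ^ 3 := one_le_pow₀ h.le
    rcases le_or_gt 0 d with h0 | h0
    · have h1 := Real.quadratic_le_exp_of_nonneg h0
      rw [abs_of_nonneg (by linarith)]
      nlinarith [sq_nonneg d]
    · have h1 : Real.exp d ≤ 1 := Real.exp_le_one_iff.2 h0.le
      rw [abs_of_neg h0] at *
      have h2 : d ^ 2 ≤ (-d) ^ 3 := by nlinarith [sq_nonneg d]
      have h4 : -d ≤ (-d) ^ 3 := by nlinarith [sq_nonneg d]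
      rw [abs_le]
      constructor <;> nlinarith [sq_nonneg d]

theorem abs_exp_sub_mul_le (a b : ℝ) :
    |Real.exp b - Real.exp a * (1 + (b - a) + (b - a) ^ 2 / 2)| ≤
      3 * |b - a| ^ 3 * (Real.exp a + Real.exp b) := by
  have h := abs_exp_sub_quadratic_le (b - a)
  have e : Real.exp b = Real.exp a * Real.exp (b - a) := by rw [← Real.exp_add]; ring_nf
  have h0 := Real.exp_pos a
  have e2 : Real.exp b - Real.exp a * (1 + (b - a) + (b - a) ^ 2 / 2) =
    Real.exp a * (Real.exp (b - a) - (1 + (b - a) + (b - a) ^ 2 / 2)) := by rw [e]; ring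
  rw [e2, abs_mul, abs_of_pos h0]
  calc _ ≤ Real.exp a * (3 * |b - a| ^ 3 * (1 + Real.exp (b - a))) := by gcongr
    _ = _ := by rw [e]; ring

theorem one_add_sq_div_two_le_cosh (x : ℝ) : 1 + x ^ 2 / 2 ≤ Real.cosh x := by
  have h1 := Real.cosh_two_mul (x / 2)
  have h2 := Real.cosh_sq (x / 2)
  have h3 := sq_le_sq.2 (abs_le_abs_sinh (x / 2))
  rw [mul_div_cancel₀ x two_ne_zero] at h1
  nlinarith

/-- `sech ^ M` decays faster than any fixed power of `1 + M x ^ 2`. -/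
theorem sech_pow_le (K : ℕ) {M : ℕ} (hM : K ≤ M) (hK : 0 < K) (x : ℝ) :
    (1 + M * x ^ 2 / (2 * K)) ^ K * (1 / Real.cosh x) ^ M ≤ 1 := by
  have hK' : (0 : ℝ) < K := by exact_mod_cast hK
  have hp : (1 : ℝ) ≤ M / K := by
    rw [one_le_div hK']
    exact_mod_cast hM
  have hs : 0 ≤ x ^ 2 / 2 := by positivity
  -- Bernoulli's inequality with the exponent M/K ≥ 1.
  have h1 := one_add_mul_self_le_rpow_one_add (s := x ^ 2 / 2) (by linarith) hp
  have h2 : (1 + M * x ^ 2 / (2 * K)) ^ K ≤ Real.cosh x ^ M := by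
    calc (1 + M * x ^ 2 / (2 * K)) ^ K = (1 + M / K * (x ^ 2 / 2)) ^ K := by
          congr 2
          field_simp
      _ ≤ ((1 + x ^ 2 / 2) ^ ((M : ℝ) / K)) ^ K := by gcongr
      _ = (1 + x ^ 2 / 2) ^ M := by
          rw [← Real.rpow_natCast, ← Real.rpow_mul (by positivity), div_mul_cancel₀ _ hK'.ne',
            Real.rpow_natCast]
      _ ≤ _ := by
          gcongr
          exact one_add_sq_div_two_le_cosh x
  have hc := Real.cosh_pos x
  rw [one_div, inv_pow, ← div_eq_mul_inv, div_le_one (by positivity)]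
  exact h2

theorem abs_sqrt_one_add_mul_tanh_sub_le {ρ : ℝ} (hρ : ρ ∈ Set.Ioo (-1 : ℝ) 1) (x : ℝ) :
    |√(1 + ρ * Real.tanh x) - (1 + ρ / 2 * x - ρ ^ 2 / 8 * x ^ 2)| ≤ 2 * |x| ^ 3 + 2 * |x| ^ 4 := by
  have hρ1 : |ρ| < 1 := abs_lt.2 hρ
  have h1 := abs_sqrt_one_add_sub_le ((abs_mul_tanh_le (ρ := ρ) x).trans_lt hρ1)
  have ht := abs_tanh_le_abs x
  have hs : |ρ * Real.tanh x| ≤ |x| := by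
    rw [abs_mul]
    exact (mul_le_of_le_one_left (abs_nonneg _) hρ1.le).trans ht
  have h2 := abs_id_sub_tanh_le x
  have e : √(1 + ρ * Real.tanh x) - (1 + ρ / 2 * x - ρ ^ 2 / 8 * x ^ 2) =
      (√(1 + ρ * Real.tanh x) - (1 + ρ * Real.tanh x / 2 - (ρ * Real.tanh x) ^ 2 / 8 +
        (ρ * Real.tanh x) ^ 3 / 16)) - ρ / 2 * (x - Real.tanh x) +
      ρ ^ 2 / 8 * ((x - Real.tanh x) * (x + Real.tanh x)) + (ρ * Real.tanh x) ^ 3 / 16 := by ring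
  have b2 : |ρ / 2 * (x - Real.tanh x)| ≤ 1 / 2 * |x| ^ 3 := by
    rw [abs_mul, abs_div, abs_two]
    gcongr
  have b3 : |ρ ^ 2 / 8 * ((x - Real.tanh x) * (x + Real.tanh x))| ≤
      1 / 8 * (|x| ^ 3 * (|x| + |x|)) := by
    rw [abs_mul, abs_mul, abs_of_nonneg (by positivity : 0 ≤ ρ ^ 2 / 8)]
    have : ρ ^ 2 ≤ 1 := by nlinarith [hρ.1, hρ.2]
    have : |x + Real.tanh x| ≤ |x| + |x| := (abs_add_le _ _).trans (by linarith)
    gcongr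
  have b4 : |(ρ * Real.tanh x) ^ 3 / 16| ≤ |x| ^ 3 / 16 := by
    rw [abs_div, abs_pow, abs_of_pos (by norm_num : (0 : ℝ) < 16)]
    gcongr
  have b1 : |ρ * Real.tanh x| ^ 4 ≤ |x| ^ 4 := by gcongr
  have h3 : 0 ≤ |x| ^ 3 := by positivity
  have h4 : 0 ≤ |x| ^ 4 := by positivity
  rw [e]
  calc _ ≤ |ρ * Real.tanh x| ^ 4 + 1 / 2 * |x| ^ 3 + 1 / 8 * (|x| ^ 3 * (|x| + |x|)) +
        |x| ^ 3 / 16 :=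
        (abs_add_le _ _).trans (add_le_add ((abs_add_le _ _).trans (add_le_add
          ((abs_sub _ _).trans (add_le_add h1 b2)) b3)) b4)
    _ ≤ |x| ^ 4 + 1 / 2 * |x| ^ 3 + 1 / 8 * (|x| ^ 3 * (|x| + |x|)) + |x| ^ 3 / 16 := by gcongr
    _ = 9 / 16 * |x| ^ 3 + 5 / 4 * |x| ^ 4 := by ring
    _ ≤ _ := by linarith

theorem exists_abs_inv_sqrt_one_add_mul_tanh_sub_le {ρ : ℝ} (hρ : ρ ∈ Set.Ioo (-1 : ℝ) 1) :
    ∃ C : ℝ, 0 ≤ C ∧ ∀ x, |1 / √(1 + ρ * Real.tanh x) - 1| ≤ |x| + C * |x| ^ 2 := by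
  have hρ1 : |ρ| < 1 := abs_lt.2 hρ
  refine ⟨2 / (1 - |ρ|), div_nonneg (by norm_num) (by linarith), fun x => ?_⟩
  have h1 := abs_inv_sqrt_one_add_sub_le (δ := 1 - |ρ|) (by linarith)
    ((abs_mul_tanh_le (ρ := ρ) x).trans (by linarith))
  have ht := abs_tanh_le_abs x
  have hs : |ρ * Real.tanh x| ≤ |x| := by
    rw [abs_mul]
    exact (mul_le_of_le_one_left (abs_nonneg _) hρ1.le).trans ht
  have e : 1 / √(1 + ρ * Real.tanh x) - 1 = (1 / √(1 + ρ * Real.tanh x) -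
    (1 - ρ * Real.tanh x / 2)) - ρ * Real.tanh x / 2 := by ring
  rw [e]
  have b : |ρ * Real.tanh x / 2| ≤ |x| := by
    rw [abs_div, abs_two]
    linarith [abs_nonneg x, abs_nonneg (ρ * Real.tanh x)]
  have h0 : 0 ≤ 2 / (1 - |ρ|) := div_nonneg (by norm_num) (by linarith)
  calc _ ≤ 2 / (1 - |ρ|) * |ρ * Real.tanh x| ^ 2 + |x| := (abs_sub _ _).trans (add_le_add h1 b)
    _ ≤ 2 / (1 - |ρ|) * |x| ^ 2 + |x| := by gcongr
    _ = _ := by ring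

/-! ### Expansion of the standardized density. -/

/-- The argument of `fisherDensity` in `standardizedFisherDensity`, scaled by `√M`. -/
noncomputable def fisherArg (ρ : ℝ) (M : ℕ) (z : ℝ) : ℝ :=
  √(M : ℝ) * (ρ / (2 * ((M + 2 : ℕ) : ℝ)) + √(fisherVar ρ (M + 2)) * z)

theorem inv_sqrt_mul_fisherArg (ρ : ℝ) {M : ℕ} (hM : 0 < M) (z : ℝ) :
    (√(M : ℝ))⁻¹ * fisherArg ρ M z =
      ρ / (2 * ((M + 2 : ℕ) : ℝ)) + √(fisherVar ρ (M + 2)) * z := by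
  have : 0 < √(M : ℝ) := Real.sqrt_pos.2 (by exact_mod_cast hM)
  rw [fisherArg, inv_mul_cancel_left₀ this.ne']

theorem fisherArg_eq (ρ : ℝ) {M : ℕ} (hM : 0 < M) (z : ℝ) :
    fisherArg ρ M z = √(M * fisherVar ρ (M + 2)) * z +
      (√(M : ℝ))⁻¹ * (ρ / 2 * ((M : ℝ) / (M + 2))) := by
  have hM' : (0 : ℝ) < M := by exact_mod_cast hM
  have hs : 0 < √(M : ℝ) := Real.sqrt_pos.2 hM'
  have e : (√(M : ℝ))⁻¹ * M = √(M : ℝ) := by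
    rw [inv_mul_eq_iff_eq_mul₀ hs.ne', Real.mul_self_sqrt hM'.le]
  rw [fisherArg, Real.sqrt_mul hM'.le]
  rw [← div_div]
  push_cast
  linear_combination (-(ρ / 2) / (M + 2 : ℝ)) * e

section

variable {ρ : ℝ}

theorem polyJet_fisherArg : PolyJet (fisherArg ρ) (fun z => z) (fun _ => ρ / 2)
    (fun z => (1 / 2 - ρ ^ 2 / 4) * z) := by
  have h1 := (PolyJet.of_firstJet (firstJet_fisherVar ρ).sqrt).mul PolyJet.id
  have h2 := PolyJet.inv_sqrt_mul_of_zerothJet ((FirstJet.div_natCast_add 2).zeroth.const_mul (ρ / 2))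
  refine (h1.add h2).congr ?_ (fun z => by ring) (fun z => by ring) (fun z => by ring)
  filter_upwards [eventually_gt_atTop 0] with M hM z
  simpa using fisherArg_eq ρ hM z

theorem polyO_inv_sqrt_mul_fisherArg : PolyO 1 fun M z => (√(M : ℝ))⁻¹ * fisherArg ρ M z :=
  PolyO.inv_sqrt.mul polyJet_fisherArg.polyO

theorem natCast_mul_inv_sqrt_pow {M : ℕ} (hM : 0 < M) (j : ℕ) :
    (M : ℝ) * (√(M : ℝ))⁻¹ ^ (j + 2) = (√(M : ℝ))⁻¹ ^ j := by
  have hM' : (0 : ℝ) < M := by exact_mod_cast hM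
  rw [pow_add, inv_sqrt_natCast_sq]
  field_simp

/-- The difference of the exponents of the normal density and of `sech ^ M`. -/
noncomputable def fisherExponent (ρ : ℝ) (M : ℕ) (z : ℝ) : ℝ :=
  z ^ 2 / 2 - M * Real.log (Real.cosh ((√(M : ℝ))⁻¹ * fisherArg ρ M z))

/-- Writing y for `fisherArg`, M log cosh (y/√M) is y²/2 - y⁴/(12M) up to y⁶/M². The term -(ρ/2) z
comes from the shift ρ/(2n) of the centre. -/
theorem polyJet_fisherExponent : PolyJet (fisherExponent ρ) (fun _ => 0) (fun z => -(ρ / 2 * z))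
    (fun z => z ^ 4 / 12 - (1 / 2 - ρ ^ 2 / 4) * z ^ 2 - ρ ^ 2 / 8) := by
  have y2 := (polyJet_fisherArg (ρ := ρ)).mul (polyJet_fisherArg (ρ := ρ))
  have h1 := (PolyJet.const (1 / 2)).mul (PolyJet.id.mul PolyJet.id)
  have h2 := (PolyJet.const (-(1 / 2))).mul y2
  have h3 := (PolyJet.const (1 / 12)).mul (PolyJet.inv_natCast.mul (y2.mul y2))
  have hG : PolyJet (fun M z => z ^ 2 / 2 - fisherArg ρ M z ^ 2 / 2 +
      (M : ℝ)⁻¹ * fisherArg ρ M z ^ 4 / 12) (fun _ => 0) (fun z => -(ρ / 2 * z))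
    (fun z => z ^ 4 / 12 - (1 / 2 - ρ ^ 2 / 4) * z ^ 2 - ρ ^ 2 / 8) :=
    ((h1.add h2).add h3).congr (Eventually.of_forall fun M z => by ring) (fun z => by ring)
      (fun z => by ring) (fun z => by ring)
  refine hG.of_sub ?_
  have hb := ((PolyO.inv_sqrt.pow 4).mul ((polyJet_fisherArg (ρ := ρ)).polyO.pow 6)).mono
    (k := 3) (by omega)
  refine hb.of_le ?_
  filter_upwards [eventually_gt_atTop 0] with M hM z
  have hM' : (0 : ℝ) < M := by exact_mod_cast hM
  set δ := (√(M : ℝ))⁻¹ with hδ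
  set y := fisherArg ρ M z
  have h := abs_log_cosh_sub_le (δ * y)
  have e2 : (M : ℝ) * δ ^ 2 = 1 := natCast_mul_inv_sqrt_pow hM 0
  have e4 : (M : ℝ) * δ ^ 4 = (M : ℝ)⁻¹ := by
    rw [natCast_mul_inv_sqrt_pow hM 2, inv_sqrt_natCast_sq]
  have e6 : (M : ℝ) * δ ^ 6 = δ ^ 4 := natCast_mul_inv_sqrt_pow hM 4
  have e : fisherExponent ρ M z - (z ^ 2 / 2 - y ^ 2 / 2 + (M : ℝ)⁻¹ * y ^ 4 / 12) =
      -(M * (Real.log (Real.cosh (δ * y)) - (δ * y) ^ 2 / 2 + (δ * y) ^ 4 / 12)) := by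
    rw [fisherExponent]
    linear_combination (-(y ^ 2 / 2)) * e2 + (y ^ 4 / 12) * e4
  rw [e, abs_neg, abs_mul, abs_of_pos hM', abs_of_nonneg (a := δ ^ 4 * y ^ 6) (by positivity),
    ← e6]
  calc _ ≤ M * (δ * y) ^ 6 := by gcongr
    _ = _ := by ring

theorem polyJet_sqrt_one_add_mul_tanh (hρ : ρ ∈ Set.Ioo (-1 : ℝ) 1) :
    PolyJet (fun M z => √(1 + ρ * Real.tanh ((√(M : ℝ))⁻¹ * fisherArg ρ M z)))
      (fun _ => 1) (fun z => ρ / 2 * z) (fun z => ρ ^ 2 / 4 - ρ ^ 2 / 8 * z ^ 2) := by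
  have hy := polyJet_fisherArg (ρ := ρ)
  have hx := PolyJet.inv_sqrt.mul hy
  have hG := ((PolyJet.const 1).add ((PolyJet.const (ρ / 2)).mul hx)).add
    ((PolyJet.const (-(ρ ^ 2 / 8))).mul (hx.mul hx))
  have hG' := hG.congr (f₀ := fun _ => 1) (f₁ := fun z => ρ / 2 * z)
    (f₂ := fun z => ρ ^ 2 / 4 - ρ ^ 2 / 8 * z ^ 2) (Eventually.of_forall fun M z => rfl)
    (fun z => by ring) (fun z => by ring) (fun z => by ring)
  refine hG'.of_sub ?_
  have hX := (polyO_inv_sqrt_mul_fisherArg (ρ := ρ)).abs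
  have hb := ((hX.pow 3).const_mul 2).add (((hX.pow 4).mono (k := 3) (by omega)).const_mul 2)
  refine hb.of_le (Eventually.of_forall fun M z => ?_)
  refine le_trans (le_of_eq ?_) ((abs_sqrt_one_add_mul_tanh_sub_le hρ _).trans (le_abs_self _))
  congr 1
  ring

theorem polyJet_inv_mul_inv_sqrt_one_add_mul_tanh (hρ : ρ ∈ Set.Ioo (-1 : ℝ) 1) :
    PolyJet (fun M z => (M : ℝ)⁻¹ *
      (1 / √(1 + ρ * Real.tanh ((√(M : ℝ))⁻¹ * fisherArg ρ M z))))
      (fun _ => 0) (fun _ => 0) (fun _ => 1) := by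
  refine PolyJet.inv_natCast.of_sub ?_
  obtain ⟨C, hC, h⟩ := exists_abs_inv_sqrt_one_add_mul_tanh_sub_le hρ
  have hX := (polyO_inv_sqrt_mul_fisherArg (ρ := ρ)).abs
  have hb := PolyO.inv_natCast.mul (hX.add (((hX.pow 2).mono (k := 1) (by omega)).const_mul C))
  refine hb.of_le (Eventually.of_forall fun M z => ?_)
  rw [← mul_sub_one, abs_mul, abs_mul]
  exact mul_le_mul_of_nonneg_left ((h _).trans (le_abs_self _)) (abs_nonneg _)

/-- `fisherWeight` divided by its leading factor, as a function of the standardized variable. -/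
noncomputable def fisherFactor (ρ : ℝ) (M : ℕ) (z : ℝ) : ℝ :=
  fisherWeight ρ M ((√(M : ℝ))⁻¹ * fisherArg ρ M z) / sechMass (2 * M + 1) *
    Real.cosh ((√(M : ℝ))⁻¹ * fisherArg ρ M z) ^ M

/-- The error in `abs_fisherWeight_div_sub_le` carries sech^M, so after multiplication by cosh^M it
is 8 M⁻² uniformly in z. -/
theorem polyJet_fisherFactor (hρ : ρ ∈ Set.Ioo (-1 : ℝ) 1) :
    PolyJet (fisherFactor ρ) (fun _ => 1) (fun z => ρ / 2 * z)
      (fun z => 3 * ρ ^ 2 / 8 - 1 / 8 - ρ ^ 2 / 8 * z ^ 2) := by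
  have h := (polyJet_sqrt_one_add_mul_tanh hρ).add ((PolyJet.const (-((1 - ρ ^ 2) / 8))).mul
    (polyJet_inv_mul_inv_sqrt_one_add_mul_tanh hρ))
  have h' := h.congr (f₀ := fun _ => 1) (f₁ := fun z => ρ / 2 * z)
    (f₂ := fun z => 3 * ρ ^ 2 / 8 - 1 / 8 - ρ ^ 2 / 8 * z ^ 2)
    (Eventually.of_forall fun M z => rfl)
    (fun z => by ring) (fun z => by ring) (fun z => by ring)
  refine h'.of_sub ?_
  have hb := ((PolyO.inv_natCast.pow 2).const_mul 8).mono (k := 3) (by omega)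
  refine hb.of_le ?_
  filter_upwards [eventually_ge_atTop 3] with M hM z
  set x := (√(M : ℝ))⁻¹ * fisherArg ρ M z with hx
  have hc := pow_pos (Real.cosh_pos x) M
  have h1 := mul_le_mul_of_nonneg_right (abs_fisherWeight_div_sub_le hρ hM x) hc.le
  have e : (1 / Real.cosh x) ^ M * Real.cosh x ^ M = 1 := by
    rw [← mul_pow, one_div_mul_cancel (Real.cosh_pos x).ne', one_pow]
  rw [← abs_of_pos hc, ← abs_mul, abs_of_pos hc, mul_assoc _ _ (Real.cosh x ^ M), e, mul_one] at h1
  refine le_trans (le_of_eq ?_) (h1.trans (le_abs_self _))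
  congr 1
  rw [fisherFactor, ← hx, sub_mul]
  linear_combination (√(1 + ρ * Real.tanh x) - (1 - ρ ^ 2) / 8 * (M : ℝ)⁻¹ *
    (1 / √(1 + ρ * Real.tanh x))) * e

/-- The normalizing constant of the standardized density. -/
noncomputable def fisherConst (ρ : ℝ) (M : ℕ) : ℝ :=
  √(fisherVar ρ (M + 2)) / (sechMass M * fisherMoment ρ 0 M)

/-- Three contributions to the 1/M coefficient: 1/2 - ρ²/4 from √V, -1/4 from the mass of sech^M,
and +1/8 from the zeroth moment. -/
theorem firstJet_fisherConst (hρ : ρ ∈ Set.Ioo (-1 : ℝ) 1) :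
    FirstJet (fisherConst ρ) (1 / √(2 * Real.pi))
      (1 / √(2 * Real.pi) * (3 / 8 - ρ ^ 2 / 4)) := by
  have j := (((firstJet_fisherVar ρ).sqrt.mul (firstJet_sechMass.inv one_ne_zero)).mul
    ((firstJet_fisherMoment_zero hρ).inv one_ne_zero)).const_mul (1 / √(2 * Real.pi))
  convert j.congr (b := fisherConst ρ) ?_ using 1
  · ring
  · ring
  filter_upwards [eventually_gt_atTop 0] with M hM
  have hM' : (0 : ℝ) < M := by exact_mod_cast hM
  have hs : 0 < √(M : ℝ) := Real.sqrt_pos.2 hM'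
  have hp : 0 < √(2 * Real.pi) := Real.sqrt_pos.2 (by positivity)
  rw [fisherConst, Real.sqrt_mul hM'.le, inv_div, mul_comm (√(M : ℝ)) (sechMass M), div_eq_mul_inv,
    mul_inv, div_eq_mul_inv _ (sechMass M * √(M : ℝ)), mul_inv]
  field_simp

theorem standardizedFisherDensity_eq {M : ℕ} (hM : 2 ≤ M) (z : ℝ) :
    standardizedFisherDensity ρ M z = fisherConst ρ M * fisherFactor ρ M z *
      (1 / Real.cosh ((√(M : ℝ))⁻¹ * fisherArg ρ M z)) ^ M := by
  have hA := sechMass_pos hM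
  have hA' := sechMass_pos (M := 2 * M + 1) (by omega)
  have hW : ∫ x, fisherWeight ρ M x =
      sechMass M * fisherMoment ρ 0 M * sechMass (2 * M + 1) := by
    unfold fisherMoment
    simp only [pow_zero, one_mul]
    field_simp
  rw [standardizedFisherDensity, ← inv_sqrt_mul_fisherArg ρ (by omega), fisherDensity, hW,
    fisherConst, fisherFactor]
  set x := (√(M : ℝ))⁻¹ * fisherArg ρ M z
  have e : Real.cosh x ^ M * (1 / Real.cosh x) ^ M = 1 := by
    rw [← mul_pow, mul_one_div_cancel (Real.cosh_pos x).ne', one_pow]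
  rw [mul_assoc _ _ ((1 / Real.cosh x) ^ M), mul_assoc _ _ ((1 / Real.cosh x) ^ M), e, mul_one]
  simp only [div_eq_mul_inv, mul_inv]
  ring

/-- From t^K / K! ≤ e^t at t = (1 + z²)/2. The quantifier over M is vacuous and only matches the
form that `PolyO.exists_mul_le` expects. -/
theorem exists_one_add_sq_pow_mul_exp_le (K : ℕ) :
    ∃ D : ℝ, ∀ᶠ _ : ℕ in atTop, ∀ z : ℝ, (1 + z ^ 2) ^ K * Real.exp (-(z ^ 2 / 2)) ≤ D := by
  refine ⟨2 ^ K * K.factorial * Real.exp (1 / 2), Eventually.of_forall fun _ z => ?_⟩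
  have h := Real.pow_div_factorial_le_exp ((1 + z ^ 2) / 2) (by positivity) K
  rw [div_le_iff₀ (by positivity), div_pow, div_le_iff₀ (by positivity)] at h
  calc (1 + z ^ 2) ^ K * Real.exp (-(z ^ 2 / 2)) ≤
        Real.exp ((1 + z ^ 2) / 2) * K.factorial * 2 ^ K * Real.exp (-(z ^ 2 / 2)) := by gcongr
    _ = 2 ^ K * K.factorial * (Real.exp ((1 + z ^ 2) / 2) * Real.exp (-(z ^ 2 / 2))) := by ring
    _ = _ := by
      rw [← Real.exp_add]
      ring_nf

/-- `fisherArg` is s z + b with s → 1 and |b| ≤ 1. Once s > 1/2, z² ≤ 4 (s z)² ≤ 8 (s z + b)² + 8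
b². -/
theorem eventually_sq_le_fisherArg (hρ : ρ ∈ Set.Ioo (-1 : ℝ) 1) :
    ∀ᶠ M : ℕ in atTop, ∀ z, z ^ 2 ≤ 8 + 8 * fisherArg ρ M z ^ 2 := by
  have hs := (firstJet_fisherVar ρ).sqrt.zeroth.tendsto
  filter_upwards [hs.eventually_const_lt (u := 1 / 2) (by norm_num), eventually_gt_atTop 0]
    with M h1 hM z
  rw [fisherArg_eq ρ hM]
  set s := √(M * fisherVar ρ (M + 2))
  have hM' : (0 : ℝ) < M := by exact_mod_cast hM
  have hb : |(√(M : ℝ))⁻¹ * (ρ / 2 * ((M : ℝ) / (M + 2)))| ≤ 1 := by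
    have a1 := inv_sqrt_natCast_le_one M
    have a2 : |ρ / 2| ≤ 1 := by
      rw [abs_le]
      constructor <;> linarith [hρ.1, hρ.2]
    have a3 : (M : ℝ) / (M + 2) ≤ 1 := by
      rw [div_le_one (by positivity)]
      linarith
    rw [abs_mul, abs_mul, abs_of_nonneg (by positivity : 0 ≤ (√(M : ℝ))⁻¹),
      abs_of_nonneg (by positivity : 0 ≤ (M : ℝ) / (M + 2))]
    exact mul_le_one₀ a1 (by positivity) (mul_le_one₀ a2 (by positivity) a3)
  set b := (√(M : ℝ))⁻¹ * (ρ / 2 * ((M : ℝ) / (M + 2)))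
  have hb2 : b ^ 2 ≤ 1 := by
    rw [← sq_abs]
    exact pow_le_one₀ (abs_nonneg b) hb
  have hs2 : 1 / 4 ≤ s ^ 2 := by nlinarith
  have h3 : (s * z) ^ 2 ≤ 2 * (s * z + b) ^ 2 + 2 * b ^ 2 := by nlinarith [sq_nonneg (s * z + b + b)]
  nlinarith [mul_le_mul_of_nonneg_right hs2 (sq_nonneg z)]

theorem exists_one_add_sq_pow_mul_sech_pow_le (hρ : ρ ∈ Set.Ioo (-1 : ℝ) 1) (K : ℕ) :
    ∃ D : ℝ, ∀ᶠ M : ℕ in atTop, ∀ z : ℝ, (1 + z ^ 2) ^ K *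
      (1 / Real.cosh ((√(M : ℝ))⁻¹ * fisherArg ρ M z)) ^ M ≤ D := by
  -- K + 1 in place of K because `sech_pow_le` needs a positive exponent; 16 leaves room for 1 + z²
  -- ≤ 9 + 8 y².
  refine ⟨(16 * ((K + 1 : ℕ) : ℝ)) ^ (K + 1), ?_⟩
  filter_upwards [eventually_sq_le_fisherArg hρ, eventually_ge_atTop (K + 1)] with M h1 hM z
  set y := fisherArg ρ M z with hy
  set x := (√(M : ℝ))⁻¹ * y with hx
  have hMx : M * x ^ 2 = y ^ 2 := by
    have := natCast_mul_inv_sqrt_pow (M := M) (by omega) 0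
    rw [hx, mul_pow, ← mul_assoc]
    simp only [zero_add, pow_zero] at this
    rw [this, one_mul]
  have h2 := sech_pow_le (K + 1) hM (by omega) x
  rw [hMx] at h2
  have hS := pow_pos (sech_pos x) M
  have hz : 1 ≤ 1 + z ^ 2 := by nlinarith [sq_nonneg z]
  have hK : (1 : ℝ) ≤ ((K + 1 : ℕ) : ℝ) := by
    push_cast
    linarith [Nat.cast_nonneg (α := ℝ) K]
  have h3 : 1 + z ^ 2 ≤ 16 * ((K + 1 : ℕ) : ℝ) * (1 + y ^ 2 / (2 * ((K + 1 : ℕ) : ℝ))) := by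
    have e : 16 * ((K + 1 : ℕ) : ℝ) * (1 + y ^ 2 / (2 * ((K + 1 : ℕ) : ℝ))) =
        16 * ((K + 1 : ℕ) : ℝ) + 8 * y ^ 2 := by
      field_simp
      ring
    rw [e]
    linarith [h1 z]
  calc (1 + z ^ 2) ^ K * (1 / Real.cosh x) ^ M ≤ (1 + z ^ 2) ^ (K + 1) * (1 / Real.cosh x) ^ M := by
        gcongr
        omega
    _ ≤ (16 * ((K + 1 : ℕ) : ℝ) * (1 + y ^ 2 / (2 * ((K + 1 : ℕ) : ℝ)))) ^ (K + 1) *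
        (1 / Real.cosh x) ^ M := by gcongr
    _ = (16 * ((K + 1 : ℕ) : ℝ)) ^ (K + 1) * ((1 + y ^ 2 / (2 * ((K + 1 : ℕ) : ℝ))) ^ (K + 1) *
        (1 / Real.cosh x) ^ M) := by
      rw [mul_pow]
      ring
    _ ≤ (16 * ((K + 1 : ℕ) : ℝ)) ^ (K + 1) * 1 := by gcongr
    _ = _ := mul_one _

/-- Up to the factor `exp (-z ^ 2 / 2)`, the Edgeworth approximation is the expansion of the
standardized density. -/
theorem polyO_edgeworth_sub (hρ : ρ ∈ Set.Ioo (-1 : ℝ) 1) :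
    PolyO 3 fun M z => fisherConst ρ M * fisherFactor ρ M z *
        (1 + fisherExponent ρ M z + fisherExponent ρ M z ^ 2 / 2) -
      1 / √(2 * Real.pi) * (1 + 2 / ((M + 2 : ℕ) : ℝ) * (z ^ 4 - 6 * z ^ 2 + 3) / 24) := by
  have hD := polyJet_fisherExponent (ρ := ρ)
  have hT := ((PolyJet.of_firstJet (firstJet_fisherConst hρ)).mul (polyJet_fisherFactor hρ)).mul
    (((PolyJet.const 1).add hD).add ((PolyJet.const (1 / 2)).mul (hD.mul hD)))
  have z2 := PolyJet.id.mul PolyJet.id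
  have hp := ((z2.mul z2).add ((PolyJet.const (-6)).mul z2)).add (PolyJet.const 3)
  have hn := PolyJet.of_firstJet (FirstJet.div_natCast_add 2).zeroth.inv_natCast_mul
  have hE := (PolyJet.const (1 / √(2 * Real.pi))).mul
    ((PolyJet.const 1).add ((PolyJet.const (1 / 12)).mul (hn.mul hp)))
  -- The coefficients of `hT` and `hE` agree at all three orders, so only remainders survive. At
  -- order M^(-1/2) the term (ρ/2) z of the prefactor cancels -(ρ/2) z of the exponent.
  have hr := hT.rem.add (hE.rem.const_mul (-1))
  refine hr.congr ?_
  filter_upwards [eventually_gt_atTop 0] with M hM z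
  have hM' : (0 : ℝ) < M := by exact_mod_cast hM
  have e : (2 : ℝ) / ((M + 2 : ℕ) : ℝ) = 2 * ((M : ℝ)⁻¹ * (M / (M + (2 : ℕ)))) := by
    push_cast
    field_simp
  rw [e]
  ring

/-- Replacing sech^M by e^(-z²/2) (1 + D + D²/2) costs |D|³ times (e^(-z²/2) + sech^M). Both
functions beat the polynomial growth of the constants, so the bound is uniform on the whole line and
no tail needs separate treatment. -/
theorem exists_abs_standardizedFisherDensity_sub_le (hρ : ρ ∈ Set.Ioo (-1 : ℝ) 1) :
    ∃ C : ℝ, 0 ≤ C ∧ ∀ᶠ M : ℕ in atTop, ∀ z,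
      |standardizedFisherDensity ρ M z - edgeworthDensity 0 (2 / ((M + 2 : ℕ) : ℝ)) z| ≤
        C / ((M + 2 : ℕ) : ℝ) ^ (3 / 2 : ℝ) := by
  have hD := polyJet_fisherExponent (ρ := ρ)
  have hcB := ((PolyJet.of_firstJet (firstJet_fisherConst hρ)).mul (polyJet_fisherFactor hρ)).polyO
  have hR := hcB.mul ((hD.polyO_one.pow 3).const_mul 3)
  have hS0 : ∀ (M : ℕ) (z : ℝ),
      0 ≤ (1 / Real.cosh ((√(M : ℝ))⁻¹ * fisherArg ρ M z)) ^ M := fun M z =>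
    (pow_pos (sech_pos _) M).le
  obtain ⟨C₁, hC₁, h₁⟩ := hR.exists_mul_le (S := fun _ z => Real.exp (-(z ^ 2 / 2)))
    (fun _ z => (Real.exp_pos _).le) exists_one_add_sq_pow_mul_exp_le
  obtain ⟨C₂, hC₂, h₂⟩ := hR.exists_mul_le hS0 (exists_one_add_sq_pow_mul_sech_pow_le hρ)
  obtain ⟨C₃, hC₃, h₃⟩ := (polyO_edgeworth_sub hρ).exists_mul_le
    (S := fun _ z => Real.exp (-(z ^ 2 / 2)))
    (fun _ z => (Real.exp_pos _).le) exists_one_add_sq_pow_mul_exp_le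
  -- 8 = 2³ comes from √n ≤ 2 √M, cubed.
  refine ⟨8 * (C₁ + C₂ + C₃), by positivity, ?_⟩
  filter_upwards [h₁, h₂, h₃, eventually_ge_atTop 2] with M h₁ h₂ h₃ hM z
  replace h₁ := h₁ z
  replace h₂ := h₂ z
  replace h₃ := h₃ z
  rw [standardizedFisherDensity_eq hM, edgeworthDensity]
  set x := (√(M : ℝ))⁻¹ * fisherArg ρ M z with hx
  set cB := fisherConst ρ M * fisherFactor ρ M z with hcBdef
  set S := (1 / Real.cosh x) ^ M with hSdef
  set E := Real.exp (-(z ^ 2 / 2)) with hE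
  set D := fisherExponent ρ M z with hDdef
  set δ := (√(M : ℝ))⁻¹ with hδ
  have hexp := abs_exp_sub_mul_le (-(z ^ 2 / 2)) (-(M * Real.log (Real.cosh x)))
  rw [← sech_pow_eq_exp, show -(M * Real.log (Real.cosh x)) - -(z ^ 2 / 2) = D by
    rw [hDdef, fisherExponent]; ring, ← hE, ← hSdef] at hexp
  have e : cB * S - E / √(2 * Real.pi) * (1 + 0 * (z ^ 3 - 3 * z) / 6 +
      2 / ((M + 2 : ℕ) : ℝ) * (z ^ 4 - 6 * z ^ 2 + 3) / 24 +
      0 ^ 2 * (z ^ 6 - 15 * z ^ 4 + 45 * z ^ 2 - 15) / 72) =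
      cB * (S - E * (1 + D + D ^ 2 / 2)) + (cB * (1 + D + D ^ 2 / 2) -
        1 / √(2 * Real.pi) * (1 + 2 / ((M + 2 : ℕ) : ℝ) * (z ^ 4 - 6 * z ^ 2 + 3) / 24)) * E := by
    ring
  rw [e]
  have hE0 : 0 < E := Real.exp_pos _
  have b1 : |cB * (S - E * (1 + D + D ^ 2 / 2))| ≤ C₁ * δ ^ 3 + C₂ * δ ^ 3 := by
    rw [abs_mul]
    calc |cB| * |S - E * (1 + D + D ^ 2 / 2)| ≤ |cB| * (3 * |D| ^ 3 * (E + S)) := by gcongr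
      _ = |cB * (3 * D ^ 3)| * E + |cB * (3 * D ^ 3)| * S := by
        rw [abs_mul cB, abs_mul 3, abs_pow, abs_of_pos (by norm_num : (0 : ℝ) < 3)]
        ring
      _ ≤ _ := add_le_add h₁ h₂
  have b2 : |(cB * (1 + D + D ^ 2 / 2) - 1 / √(2 * Real.pi) *
      (1 + 2 / ((M + 2 : ℕ) : ℝ) * (z ^ 4 - 6 * z ^ 2 + 3) / 24)) * E| ≤ C₃ * δ ^ 3 := by
    rw [abs_mul, abs_of_pos hE0]
    exact h₃
  refine ((abs_add_le _ _).trans (add_le_add b1 b2)).trans ?_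
  have hM' : (2 : ℝ) ≤ M := by exact_mod_cast hM
  have hn : (0 : ℝ) < ((M + 2 : ℕ) : ℝ) := by positivity
  have hs : 0 < √(M : ℝ) := Real.sqrt_pos.2 (by linarith)
  have hs2 : √((M + 2 : ℕ) : ℝ) ≤ 2 * √(M : ℝ) := by
    rw [Real.sqrt_le_left (by positivity), mul_pow, Real.sq_sqrt (by linarith)]
    push_cast
    linarith
  have en : ((M + 2 : ℕ) : ℝ) ^ (3 / 2 : ℝ) = √((M + 2 : ℕ) : ℝ) ^ 3 := by
    rw [Real.sqrt_eq_rpow, ← Real.rpow_natCast, ← Real.rpow_mul hn.le]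
    norm_num
  rw [en, le_div_iff₀ (by positivity)]
  have e3 : δ ^ 3 * √(M : ℝ) ^ 3 = 1 := by
    rw [← mul_pow, hδ, inv_mul_cancel₀ hs.ne', one_pow]
  calc (C₁ * δ ^ 3 + C₂ * δ ^ 3 + C₃ * δ ^ 3) * √((M + 2 : ℕ) : ℝ) ^ 3 ≤
        (C₁ * δ ^ 3 + C₂ * δ ^ 3 + C₃ * δ ^ 3) * (2 * √(M : ℝ)) ^ 3 := by gcongr
    _ = 8 * (C₁ + C₂ + C₃) * (δ ^ 3 * √(M : ℝ) ^ 3) := by ring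
    _ = _ := by rw [e3, mul_one]

end

end

/-! ### Assembling the result. -/

theorem mainTheorem1 (ρ : ℝ) (hρ : ρ ∈ Set.Ioo (-1 : ℝ) 1) :
    ∃ (C : ℝ) (N : ℕ), ∀ n : ℕ, N ≤ n →
      ∀ (Ω : Type*) [MeasurableSpace Ω] (P : Measure Ω) [IsProbabilityMeasure P]
        (X Y : Fin n → Ω → ℝ) (μ₁ μ₂ σ₁ σ₂ : ℝ), 0 < σ₁ → 0 < σ₂ →
        IsBivariateNormalSample P X Y μ₁ μ₂ σ₁ σ₂ ρ →
        -- `artanh r` has finite moments up to order four, and their expansions are as stated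
        MemLp (fisherZ X Y) 4 P ∧
        |(∫ ω, fisherZ X Y ω ∂P) - (Real.artanh ρ + ρ / (2 * n))| ≤ C / (n : ℝ) ^ 2 ∧
        |variance (fisherZ X Y) P - (1 / n + (6 - ρ ^ 2) / (2 * n ^ 2))| ≤ C / (n : ℝ) ^ 3 ∧
        |skewness (fisherZ X Y) P| ≤ C / (n : ℝ) ^ (3 / 2 : ℝ) ∧
        |excessKurtosis (fisherZ X Y) P - 2 / n| ≤ C / (n : ℝ) ^ 2 ∧
        -- Edgeworth approximation to the density of the standardized variable `(artanh r - m) / √V`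
        (∃ g : ℝ → ℝ, Continuous g ∧ (∀ z, 0 ≤ g z) ∧
          P.map (fun ω => (fisherZ X Y ω - fisherMean ρ n) / √(fisherVar ρ n)) =
            volume.withDensity (fun z => ENNReal.ofReal (g z)) ∧
          ∀ z, |g z - edgeworthDensity 0 (2 / n) z| ≤ C / (n : ℝ) ^ (3 / 2 : ℝ)) ∧
        -- the resulting approximation to the density of `r` on `(-1, 1)`
        (∃ f : ℝ → ℝ, ContinuousOn f (Set.Ioo (-1) 1) ∧ (∀ r ∈ Set.Ioo (-1 : ℝ) 1, 0 ≤ f r) ∧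
          P.map (fun ω => sampleCorr (fun i => X i ω) (fun i => Y i ω)) =
            (volume.restrict (Set.Ioo (-1) 1)).withDensity (fun r => ENNReal.ofReal (f r)) ∧
          ∀ r ∈ Set.Ioo (-1 : ℝ) 1,
            |f r - edgeworthDensity 0 (2 / n) ((Real.artanh r - fisherMean ρ n) / √(fisherVar ρ n)) /
                ((1 - r ^ 2) * √(fisherVar ρ n))| ≤
              C / (n : ℝ) ^ (3 / 2 : ℝ) / ((1 - r ^ 2) * √(fisherVar ρ n))) := by
  obtain ⟨C₁, hC₁, h₁⟩ := exists_abs_le_of_isBigO_inv_pow (fisherZMoment_one_sub_isBigO hρ)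
  obtain ⟨C₂, hC₂, h₂⟩ := exists_abs_le_of_isBigO_inv_pow (fisherZ_variance_sub_isBigO hρ)
  obtain ⟨C₃, hC₃, h₃⟩ := exists_abs_fisherZ_skewness_le hρ
  obtain ⟨C₄, hC₄, h₄⟩ := exists_abs_le_of_isBigO_inv_pow (fisherZ_excessKurtosis_sub_isBigO hρ)
  obtain ⟨C₅, hC₅, h₅⟩ := exists_abs_standardizedFisherDensity_sub_le hρ
  obtain ⟨N, hN⟩ := Filter.eventually_atTop.1 (h₁.and (h₂.and (h₃.and (h₄.and (h₅.and
    ((SinhBound.id_pow 4).integrable.and (Filter.eventually_ge_atTop 3)))))))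
  -- The sum of the five constants serves all estimates at once. Each was obtained from functions of
  -- ρ and M alone, hence the uniformity over probability spaces, means and variances.
  have hle : ∀ {c d a : ℝ}, 0 ≤ d → c ≤ C₁ + C₂ + C₃ + C₄ + C₅ → a ≤ c / d →
      a ≤ (C₁ + C₂ + C₃ + C₄ + C₅) / d := fun hd hc ha =>
    ha.trans (div_le_div_of_nonneg_right hc hd)
  refine ⟨C₁ + C₂ + C₃ + C₄ + C₅, N + 2, fun n hn Ω _ P _ X Y μ₁ μ₂ σ₁ σ₂ hσ₁ hσ₂ h => ?_⟩
  obtain ⟨M, rfl⟩ : ∃ M, n = M + 2 := ⟨n - 2, by omega⟩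
  obtain ⟨b₁, b₂, b₃, b₄, b₅, hi, hM⟩ := hN M (by omega)
  obtain ⟨m₁, m₂, m₃, m₄⟩ := h.fisherZ_moments hρ hM hσ₁ hσ₂ hi
  have hn0 : (0 : ℝ) ≤ ((M + 2 : ℕ) : ℝ) := Nat.cast_nonneg _
  have hV := Real.sqrt_pos.2 (fisherVar_pos hρ (M + 2) (by omega))
  refine ⟨h.memLp_fisherZ hρ hM hσ₁ hσ₂ hi, ?_, ?_, ?_, ?_,
    ⟨standardizedFisherDensity ρ M, continuous_standardizedFisherDensity hρ (by omega),
      standardizedFisherDensity_nonneg ρ M, h.map_standardized_fisherZ hρ hM hσ₁ hσ₂,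
      fun z => hle (by positivity) (by linarith) (b₅ z)⟩,
    ⟨sampleCorrDensity ρ M, continuousOn_sampleCorrDensity hρ (by omega),
      fun r hr => sampleCorrDensity_nonneg hr, h.map_sampleCorr hρ hM hσ₁ hσ₂,
      fun r hr => ?_⟩⟩
  · rw [m₁, add_sub_add_left_eq_sub]
    exact hle (by positivity) (by linarith) b₁
  · rw [m₂]
    exact hle (by positivity) (by linarith) b₂
  · rw [skewness, m₂, m₃]
    exact hle (by positivity) (by linarith) b₃
  · rw [excessKurtosis, m₂, m₄]
    exact hle (by positivity) (by linarith) b₄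
  · have hr2 : 0 < 1 - r ^ 2 := by nlinarith [hr.1, hr.2]
    have hd : 0 < (1 - r ^ 2) * √(fisherVar ρ (M + 2)) := mul_pos hr2 hV
    rw [sampleCorrDensity, ← sub_div, abs_div, abs_of_pos hd]
    exact div_le_div_of_nonneg_right (hle (by positivity) (by linarith) (b₅ _)) hd.le
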